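/- **Notation.** For $\bm x\in\mathbb R^n$ let $\mathrm{avg}(\bm x)=\frac1n\sum_i x_i$, $\mathrm{std}(\bm x)=\big(\frac1n\sum_i(x_i-\mathrm{avg}(\bm x))^2\big)^{1/2}$ and $\mathrm{emp}(\bm x)=\frac1n\sum_{k=1}^n\delta_{x_k}$. Write $f(n)=\tilde O(n^{\alpha})$ if there are positive constants $N_0,C_1,C_2$ with $|f(n)|<C_1n^{\alpha}\log^{C_2}(n)$ for all $n>N_0$. Random measures $\mu_n$ on $\mathbb R$, defined on a common probability space, converge almost surely to a deterministic probability measure $\rho$, written $\mu_n\xrightarrow{\mathrm{a.s.}}\rho$, if for every compactly supported continuous $f:\mathbb R\to\mathbb R$, almost surely $\int f\,d\mu_n\to\int f\,d\rho$. **Ensembles.** On one probability space let, for every $n$, $\bm\Lambda_n=(\lambda_1\le\dots\le\lambda_n)$ be a random vector in $\mathbb R^n$ (entries in increasing order almost surely) and $\Phi_n$ a Haar-distributed random matrix in the orthogonal group $\mathcal O(n)$, independent of $\bm\Lambda_n$; put $A=A_n=\Phi_n\,\mathrm{diag}(\bm\Lambda_n)\,\Phi_n^{T}$, a matrix drawn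 from the orthogonally invariant ensemble with eigenvalue distribution the law of $\bm\Lambda_n$. Nothing is assumed about the joint law for different $n$. Let $\bm\varphi^{(k)}$ be an eigenvector of $A$ for its $k$-th smallest eigenvalue $\lambda_k$; if $\lambda_k$ is a repeated eigenvalue, $\bm\varphi^{(k)}$ is the $k$-th column of $\Phi_n$. The nodal count and nodal surplus are $$\phi(A,k)=\big|\{i<j:\ A_{ij}\bm\varphi^{(k)}_i\bm\varphi^{(k)}_j>0\}\big|,\qquad \sigma(A,k)=\phi(A,k)-(k-1),$$ and their normalizations are the vectors $$\phi_{\mathcal N}(A)=\Big(\tfrac{\pi^{3/2}}{\sqrt2}\Big(\tfrac{\phi(A,k)}{\binom n2}-\tfrac12\Big)n^{1/2}\Big)_{k=1}^n,\qquad \sigma_{\mathcal N}(A)=\Big(\tfrac{\pi^{3/2}}{\sqrt2}\Big(\tfrac{\sigma(A,k)}{\binom n2}-\tfrac12\Big)n^{1/2}\Big)_{k=1}^n.$$ **Corollary (general convergence).** Assume the spectral growth bound: there are $r(n)=\tilde O(1)$ and $\delta(n)=\tilde O(n^{-3/2})$ such that, for every $n$, $$\mathbb P\Big[\Big\|\frac{\bm\Lambda_n-\mathrm{avg}(\bm\Lambda_n)}{\mathrm{std}(\bm\Lambda_n)}\Big\|_\infty\le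 r(n)\Big]\ge1-\delta(n).$$ Suppose that for every $n\ge2$, almost surely, $\mathrm{avg}(\bm\Lambda_n)=0$ and $\mathrm{std}(\bm\Lambda_n)=1$, and that $\mathrm{emp}(\bm\Lambda_n)\xrightarrow{\mathrm{a.s.}}\rho$ as $n\to\infty$ for some probability measure $\rho$ on $\mathbb R$. Then $$\mathrm{emp}(\phi_{\mathcal N}(A_n))\xrightarrow{\mathrm{a.s.}}\rho\qquad\text{and}\qquad \mathrm{emp}(\sigma_{\mathcal N}(A_n))\xrightarrow{\mathrm{a.s.}}\rho .$$ -/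

import Mathlib

open MeasureTheory ProbabilityTheory Filter Topology
open scoped ENNReal

noncomputable section

namespace NodalCount

/-- The average of the coordinates of `x`. -/
def avg {n : ℕ} (x : Fin n → ℝ) : ℝ := (∑ i, x i) / n

/-- The standard deviation of the coordinates of `x`. -/
def std {n : ℕ} (x : Fin n → ℝ) : ℝ := Real.sqrt ((∑ i, (x i - avg x) ^ 2) / n)

/-- The empirical distribution `(1/n) ∑ δ_{x_k}` of the coordinates of `x`. -/
def emp {n : ℕ} (x : Fin n → ℝ) : Measure ℝ := (n : ℝ≥0∞)⁻¹ • ∑ k, Measure.dirac (x k)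

/-- Almost sure convergence of a sequence of random measures on `ℝ` to a deterministic one, tested
against compactly supported continuous functions. -/
def ConvergesAS {Ω : Type*} [MeasurableSpace Ω] (P : Measure Ω)
    (μ : ℕ → Ω → Measure ℝ) (ρ : Measure ℝ) : Prop :=
  ∀ f : ℝ → ℝ, Continuous f → HasCompactSupport f →
    ∀ᵐ ω ∂P, Tendsto (fun n => ∫ x, f x ∂(μ n ω)) atTop (𝓝 (∫ x, f x ∂ρ))

/-- `f(n) = Õ(n ^ α)`. -/
def IsTildeO (f : ℕ → ℝ) (α : ℝ) : Prop :=
  ∃ (N₀ : ℕ) (C₁ C₂ : ℝ), 0 < N₀ ∧ 0 < C₁ ∧ 0 < C₂ ∧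
    ∀ n : ℕ, N₀ < n → |f n| < C₁ * (n : ℝ) ^ α * Real.log n ^ C₂

/-- The orthogonal group `O(n)` carries its Borel `σ`-algebra. -/
instance instMeasurableSpaceOrthogonalGroup (n : ℕ) :
    MeasurableSpace (Matrix.orthogonalGroup (Fin n) ℝ) := borel _

instance instBorelSpaceOrthogonalGroup (n : ℕ) :
    BorelSpace (Matrix.orthogonalGroup (Fin n) ℝ) := ⟨rfl⟩

/-- The matrix `Φ diag(Λ) Φᵀ` with eigenvalues `Λ` and eigenvectors the columns of `Φ`. -/
def ensembleMatrix {n : ℕ} (Λ : Fin n → ℝ) (Φ : Matrix.orthogonalGroup (Fin n) ℝ) :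
    Matrix (Fin n) (Fin n) ℝ :=
  (Φ : Matrix (Fin n) (Fin n) ℝ) * Matrix.diagonal Λ * (Φ : Matrix (Fin n) (Fin n) ℝ).transpose

/-- The random matrix `Φ diag(Λ) Φᵀ` is drawn from the orthogonally invariant ensemble whose
eigenvalue distribution is the law of `Λ`: the eigenvalues `Λ` are listed in increasing order and
`Φ` is a Haar-distributed orthogonal matrix that is independent of `Λ`. -/
structure IsOrthogonalEnsemble {Ω : Type*} [MeasurableSpace Ω] (P : Measure Ω) {n : ℕ}
    (Λ : Ω → Fin n → ℝ) (Φ : Ω → Matrix.orthogonalGroup (Fin n) ℝ) : Prop where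
  measurable_eigenvalues : Measurable Λ
  measurable_frame : Measurable Φ
  monotone : ∀ᵐ ω ∂P, Monotone (Λ ω)
  haar : (P.map Φ).IsHaarMeasure
  indep : IndepFun Λ Φ P

/-- The spectral growth bound: `‖(Λ - avg Λ) / std Λ‖_∞ = Õ(1)` with probability at least
`1 - Õ(n ^ (-3/2))`. The norm on `Fin n → ℝ` is the supremum norm. -/
def SpectralGrowthBound {Ω : Type*} [MeasurableSpace Ω] (P : Measure Ω)
    (Λ : (n : ℕ) → Ω → Fin n → ℝ) : Prop :=
  ∃ r δ : ℕ → ℝ, IsTildeO r 0 ∧ IsTildeO δ (-3 / 2) ∧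
    ∀ n, 1 - δ n ≤
      P.real {ω | ‖(fun i : Fin n => (Λ n ω i - avg (Λ n ω)) / std (Λ n ω))‖ ≤ r n}

/-- `v k` is an eigenvector of `Φ diag(Λ) Φᵀ` for its `k`-th smallest eigenvalue `Λ k`, for every
`k`. When `Λ k` is a simple eigenvalue this is no choice up to scaling. Only when `Λ k` is repeated
is the choice prescribed: it is then the `k`-th column of `Φ`. -/
def IsEigenvectorSystem {n : ℕ} (Λ : Fin n → ℝ) (Φ : Matrix.orthogonalGroup (Fin n) ℝ)
    (v : Fin n → Fin n → ℝ) : Prop :=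
  ∀ k, v k ≠ 0 ∧ (ensembleMatrix Λ Φ).mulVec (v k) = Λ k • v k ∧
    ((∃ l, l ≠ k ∧ Λ l = Λ k) → v k = fun i => (Φ : Matrix (Fin n) (Fin n) ℝ) i k)

/-- The nodal count of the eigenvector `v` of `A`: the number of pairs `i < j` with
`A i j * v i * v j > 0`. -/
def nodalCount {n : ℕ} (A : Matrix (Fin n) (Fin n) ℝ) (v : Fin n → ℝ) : ℕ :=
  Nat.card {e : Fin n × Fin n // e.1 < e.2 ∧ 0 < A e.1 e.2 * v e.1 * v e.2}

/-- The nodal surplus `φ(A, k) - (k - 1)`, `k` being counted from `1`; here the index `k` of the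
eigenvector `v` is counted from `0`. -/
def nodalSurplus {n : ℕ} (A : Matrix (Fin n) (Fin n) ℝ) (v : Fin n → ℝ) (k : Fin n) : ℤ :=
  (nodalCount A v : ℤ) - ((k : ℕ) : ℤ)

/-- The normalization `x ↦ (π ^ (3/2) / √2) (x / (n choose 2) - 1/2) n ^ (1/2)`. -/
def normalize (n : ℕ) (x : ℝ) : ℝ :=
  Real.pi ^ (3 / 2 : ℝ) / Real.sqrt 2 * (x / (n.choose 2 : ℝ) - 1 / 2) * Real.sqrt n

end NodalCount

end

/-! Fix `k`, let `u i` be the rows of `Φ` and `D = diag λ`. Up to a scalar the `k`-th eigenvector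
has coordinates `u i k`, and `A i j = ⟨D (u i), u j⟩`. So the nodal count is half the number of
pairs plus half the sum over pairs of `sgn (A i j * u i k * u j k)`, which is `signSum`. The core
claim is that the average sign equals `(2/π) λ_k √(2/(πn))` (`meanSign`) up to `o(n^(-1/2))`,
uniformly in `k`. The normalization sends this mean exactly to `λ_k`, so the normalized counts are
uniformly close to the eigenvalues and their empirical measures have the same limit. Passing to the
surplus moves every value by only `O(n^(-1/2))`.

Mean. Haar rows are Gram-Schmidt orthonormalized Gaussian vectors (`isHaarFrameLaw_map_rows`). Given
the rows before `j`, both `A i j` and `u j k` are positive multiples of linear functionals of one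
fresh Gaussian vector, with directions the residuals of `D (u i)` and of the basis vector `e_k`. The
mean product of two Gaussian signs is `2/π` times their correlation up to a quadratic error
(`abs_integral_sgn_inner_sub_le`). Both residuals have norm near `1`, and their inner product is
`λ_k u i k - ∑_{l<j} u l k * A i l`, where the sum is negligible on good frames. The conditional
mean of the pair sign is thus about `(2/π) λ_k |u i k|`, and the `|u i k|` average to about
`√(2/(πn))`.

Fluctuation. The centred row sums are martingale differences. By Bessel's inequality the conditional
second moment of the `j`-th one is of order `j^(3/2)`, up to powers of the eigenvalue bound, instead
of the trivial `j^2` (`integral_increment_sq_le`). An exponential martingale then controls the first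
`t` rows with error about `t^(5/4)`.

Choice of `t`. The drift estimate needs `t ≪ n`, so that residuals lose little norm. The fluctuation
relative to the `t^2/2` pairs, about `t^(-3/4)`, must be `≪ n^(-1/2)`, so `t ≫ n^(2/3)`. The proof
takes `t ≈ n^(4/5)` and recovers all `n` rows by exchangeability: the full average is the mean over
row permutations of the average over the first `t` rows
(`IsHaarFrameLaw.mul_measureReal_signSum_gt_le`).

Almost sure statement. With `L = n^(1/100)` bounding the eigenvalues, the exceptional probabilities
are polynomial in `n` times `exp (-L)`. They survive a union over `k` and are summable, so
Borel-Cantelli applies whatever the joint law for different `n`. -/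

noncomputable section

namespace NodalCount

/-! ### Exponential moments and tail bounds for functions of independent Gaussian variables. -/

section GaussianReal

/-- The standard Gaussian measure on `ℝ`. -/
abbrev stdGaussianReal : Measure ℝ := gaussianReal 0 1

lemma gaussianPDFReal_zero_one (x : ℝ) :
    gaussianPDFReal 0 1 x = (Real.sqrt (2 * Real.pi))⁻¹ * Real.exp (-(1 / 2) * x ^ 2) := by
  rw [gaussianPDFReal]
  simp only [NNReal.coe_one, mul_one, sub_zero]
  congr 2
  ring

lemma integrable_exp_mul_sq_stdGaussianReal {b : ℝ} (hb : b < 1 / 2) :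
    Integrable (fun x : ℝ => Real.exp (b * x ^ 2)) stdGaussianReal := by
  rw [stdGaussianReal, gaussianReal_of_var_ne_zero _ one_ne_zero]
  rw [integrable_withDensity_iff (measurable_gaussianPDF _ _)
    (Eventually.of_forall fun x => by simp [gaussianPDF])]
  have h := (integrable_exp_neg_mul_sq (b := 1 / 2 - b) (by linarith)).const_mul
    (Real.sqrt (2 * Real.pi))⁻¹
  refine h.congr (Eventually.of_forall fun x => ?_)
  simp only [toReal_gaussianPDF, gaussianPDFReal_zero_one]
  rw [mul_comm (Real.exp (b * x ^ 2)), mul_assoc, ← Real.exp_add]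
  congr 2
  ring

lemma integral_abs_stdGaussianReal :
    ∫ x, |x| ∂stdGaussianReal = Real.sqrt (2 / Real.pi) := by
  rw [stdGaussianReal, integral_gaussianReal_eq_integral_smul one_ne_zero]
  have h1 : ∀ x : ℝ, gaussianPDFReal 0 1 x • |x| =
      (fun y : ℝ => (Real.sqrt (2 * Real.pi))⁻¹ * (y * Real.exp (-(1 / 2) * y ^ 2))) |x| := by
    intro x
    simp only [gaussianPDFReal_zero_one, smul_eq_mul, sq_abs]
    ring
  simp_rw [h1]
  rw [integral_comp_abs (f := fun y : ℝ =>
    (Real.sqrt (2 * Real.pi))⁻¹ * (y * Real.exp (-(1 / 2) * y ^ 2)))]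
  rw [integral_const_mul]
  have h2 : ∫ x in Set.Ioi (0 : ℝ), x * Real.exp (-(1 / 2) * x ^ 2) = 1 := by
    have := integral_mul_cexp_neg_mul_sq (b := 1 / 2) (by norm_num)
    have h3 : ((∫ x in Set.Ioi (0 : ℝ), x * Real.exp (-(1 / 2) * x ^ 2) : ℝ) : ℂ) = 1 := by
      rw [← integral_complex_ofReal]
      push_cast
      rw [this]
      norm_num
    exact_mod_cast h3
  rw [h2, Real.sqrt_div (by norm_num), Real.sqrt_mul (by norm_num)]
  have : Real.sqrt 2 * Real.sqrt 2 = 2 := Real.mul_self_sqrt (by norm_num)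
  have hpi : 0 < Real.sqrt Real.pi := Real.sqrt_pos.2 Real.pi_pos
  have h2' : 0 < Real.sqrt 2 := Real.sqrt_pos.2 (by norm_num)
  field_simp
  linarith

lemma integral_sq_stdGaussianReal : ∫ x, x ^ 2 ∂stdGaussianReal = 1 := by
  have := variance_id_gaussianReal (μ := 0) (v := 1)
  rw [variance_eq_integral aemeasurable_id] at this
  simpa using this

lemma integrable_id_stdGaussianReal : Integrable (fun x : ℝ => x) stdGaussianReal :=
  IsGaussian.integrable_id

lemma integrable_sq_stdGaussianReal : Integrable (fun x : ℝ => x ^ 2) stdGaussianReal :=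
  (IsGaussian.memLp_two_id (μ := stdGaussianReal)).integrable_sq

/-- A constant bounding the growth of exponential moments of centred functions of a standard
Gaussian variable. -/
def expMomentConst : ℝ := ∫ x, 2 * Real.exp ((x ^ 2 + 1) / 8) ∂stdGaussianReal

lemma integrable_expMoment :
    Integrable (fun x : ℝ => 2 * Real.exp ((x ^ 2 + 1) / 8)) stdGaussianReal := by
  have h := (integrable_exp_mul_sq_stdGaussianReal (b := 1 / 8) (by norm_num)).const_mul
    (2 * Real.exp (1 / 8))
  refine h.congr (Eventually.of_forall fun x => ?_)
  simp only
  rw [mul_assoc, ← Real.exp_add]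
  congr 2
  ring

lemma expMomentConst_nonneg : 0 ≤ expMomentConst :=
  integral_nonneg fun x => by positivity

lemma exp_le_quadratic (x : ℝ) : Real.exp x ≤ 1 + x + x ^ 2 * Real.exp |x| := by
  have h := Complex.norm_exp_sub_sum_le_norm_mul_exp (x : ℂ) 2
  have h2 : Complex.exp (x : ℂ) - ∑ m ∈ Finset.range 2, (x : ℂ) ^ m / (m.factorial : ℂ) =
      ((Real.exp x - (1 + x) : ℝ) : ℂ) := by
    simp [Finset.sum_range_succ]
  rw [h2, Complex.norm_real, Complex.norm_real, Real.norm_eq_abs, Real.norm_eq_abs, sq_abs] at h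
  linarith [le_abs_self (Real.exp x - (1 + x))]

variable {h : ℝ → ℝ}

/-- The second-order Taylor remainder is at most `s^2 h^2 exp |h|`, and `h^2 exp |h| ≤ 2 exp
(2|h|)`. The growth constant `1/16` doubles to `1/8`, below the threshold `1/2` for Gaussian
integrability, so the quadratic coefficient is integrable uniformly in `|s| ≤ 1`. -/
lemma exp_mul_le_of_abs_le (hb : ∀ x, |h x| ≤ (x ^ 2 + 1) / 16) {s : ℝ} (hs : |s| ≤ 1) (x : ℝ) :
    Real.exp (s * h x) ≤ 1 + s * h x + s ^ 2 * (2 * Real.exp ((x ^ 2 + 1) / 8)) := by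
  have h1 := exp_le_quadratic (s * h x)
  have h2 : |s * h x| ≤ |h x| := by
    rw [abs_mul]
    exact mul_le_of_le_one_left (abs_nonneg _) hs
  have h3 : |h x| ^ 2 ≤ 2 * Real.exp |h x| := by
    have := Real.quadratic_le_exp_of_nonneg (abs_nonneg (h x))
    nlinarith [abs_nonneg (h x)]
  have h4 : h x ^ 2 * Real.exp |s * h x| ≤ 2 * Real.exp ((x ^ 2 + 1) / 8) := by
    calc h x ^ 2 * Real.exp |s * h x| ≤ (2 * Real.exp |h x|) * Real.exp |h x| := by
          rw [← sq_abs (h x)]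
          gcongr
      _ = 2 * Real.exp (|h x| + |h x|) := by rw [mul_assoc, ← Real.exp_add]
      _ ≤ _ := by
          gcongr
          linarith [hb x]
  calc Real.exp (s * h x) ≤ 1 + s * h x + s ^ 2 * (h x ^ 2 * Real.exp |s * h x|) := by
        rw [mul_pow] at h1
        linarith
    _ ≤ _ := by gcongr

lemma integrable_of_abs_le (hm : Measurable h) (hb : ∀ x, |h x| ≤ (x ^ 2 + 1) / 16) :
    Integrable h stdGaussianReal := by
  refine ((integrable_sq_stdGaussianReal.add (integrable_const 1)).div_const 16).mono'
    hm.aestronglyMeasurable (Eventually.of_forall fun x => ?_)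
  simpa using hb x

lemma integrable_exp_of_abs_le (hm : Measurable h) (hb : ∀ x, |h x| ≤ (x ^ 2 + 1) / 16) {s : ℝ}
    (hs : |s| ≤ 1) : Integrable (fun x => Real.exp (s * h x)) stdGaussianReal := by
  have hi := ((integrable_const (1 : ℝ)).add ((integrable_of_abs_le hm hb).const_mul s)).add
    (integrable_expMoment.const_mul (s ^ 2))
  refine hi.mono' (by fun_prop) (Eventually.of_forall fun x => ?_)
  rw [Real.norm_eq_abs, Real.abs_exp]
  exact exp_mul_le_of_abs_le hb hs x

/-- Centring kills the linear term, leaving `1 + O(s^2) ≤ exp (O(s^2))`: sub-Gaussian behaviour for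
small `s`, which multiplies over independent coordinates. -/
lemma integral_exp_le_of_abs_le (hm : Measurable h) (hb : ∀ x, |h x| ≤ (x ^ 2 + 1) / 16)
    (h0 : ∫ x, h x ∂stdGaussianReal = 0) {s : ℝ} (hs : |s| ≤ 1) :
    ∫ x, Real.exp (s * h x) ∂stdGaussianReal ≤ Real.exp (expMomentConst * s ^ 2) := by
  have hi := integrable_of_abs_le hm hb
  have h1 : Integrable (fun x => 1 + s * h x) stdGaussianReal :=
    (integrable_const (1 : ℝ)).add (hi.const_mul s)
  have h2 : Integrable (fun x : ℝ => s ^ 2 * (2 * Real.exp ((x ^ 2 + 1) / 8))) stdGaussianReal :=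
    integrable_expMoment.const_mul _
  calc ∫ x, Real.exp (s * h x) ∂stdGaussianReal
      ≤ ∫ x, (1 + s * h x + s ^ 2 * (2 * Real.exp ((x ^ 2 + 1) / 8))) ∂stdGaussianReal :=
        integral_mono (integrable_exp_of_abs_le hm hb hs) (h1.add h2)
          (exp_mul_le_of_abs_le hb hs)
    _ = 1 + expMomentConst * s ^ 2 := by
        rw [integral_add h1 h2, integral_add (integrable_const _) (hi.const_mul s),
          integral_const_mul, integral_const_mul, h0, expMomentConst]
        simp
        ring
    _ ≤ _ := by linarith [Real.add_one_le_exp (expMomentConst * s ^ 2)]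

/-- An exponential tail bound for weighted sums of a centred function of independent standard
Gaussian variables. -/
lemma measureReal_sum_ge_le {ι : Type*} [Fintype ι] (hm : Measurable h)
    (hb : ∀ x, |h x| ≤ (x ^ 2 + 1) / 16) (h0 : ∫ x, h x ∂stdGaussianReal = 0) {c : ι → ℝ} {R N : ℝ}
    (hR : 0 < R) (hc : ∀ i, |c i| ≤ R) (hN : 1 ≤ N) (hcard : (Fintype.card ι : ℝ) ≤ N) (L : ℝ) :
    (Measure.pi fun _ : ι => stdGaussianReal).real {x | R * Real.sqrt N * L ≤ ∑ i, c i * h (x i)} ≤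
      Real.exp (expMomentConst - L) := by
  have hN0 : 0 < Real.sqrt N := Real.sqrt_pos.2 (by linarith)
  have hN1 : 1 ≤ Real.sqrt N := Real.one_le_sqrt.2 hN
  -- Chernoff parameter: each `|s * c i|` is at most `1` and the squares sum to at most `1`, so the
  -- moment generating function stays bounded while the threshold contributes exactly `exp (-L)`.
  set s : ℝ := (R * Real.sqrt N)⁻¹ with hs
  have hs0 : 0 < s := by positivity
  have hsc : ∀ i, |s * c i| ≤ 1 := fun i => by
    rw [abs_mul, abs_of_pos hs0, hs, inv_mul_le_iff₀ (by positivity)]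
    nlinarith [hc i]
  have hprod : (fun x : ι → ℝ => Real.exp (s * ∑ i, c i * h (x i))) =
      fun x => ∏ i, Real.exp (s * c i * h (x i)) := by
    ext x
    rw [← Real.exp_sum, Finset.mul_sum]
    simp_rw [mul_assoc]
  have hint : Integrable (fun x : ι → ℝ => Real.exp (s * ∑ i, c i * h (x i)))
      (Measure.pi fun _ : ι => stdGaussianReal) := by
    rw [hprod]
    exact Integrable.fintype_prod (f := fun i x => Real.exp (s * c i * h x))
      fun i => integrable_exp_of_abs_le hm hb (hsc i)
  have key := measure_ge_le_exp_mul_mgf (μ := Measure.pi fun _ : ι => stdGaussianReal)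
    (X := fun x => ∑ i, c i * h (x i)) (R * Real.sqrt N * L) hs0.le hint
  refine key.trans ?_
  have hmgf : mgf (fun x : ι → ℝ => ∑ i, c i * h (x i)) (Measure.pi fun _ : ι => stdGaussianReal) s
      ≤ Real.exp expMomentConst := by
    rw [mgf, hprod, integral_fintype_prod_eq_prod (f := fun i x => Real.exp (s * c i * h x))]
    calc ∏ i, ∫ x, Real.exp (s * c i * h x) ∂stdGaussianReal
        ≤ ∏ i, Real.exp (expMomentConst * (s * c i) ^ 2) :=
          Finset.prod_le_prod (fun i _ => integral_nonneg fun x => (Real.exp_pos _).le)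
            fun i _ => integral_exp_le_of_abs_le hm hb h0 (hsc i)
      _ = Real.exp (expMomentConst * ∑ i, (s * c i) ^ 2) := by
          rw [← Real.exp_sum, Finset.mul_sum]
      _ ≤ Real.exp (expMomentConst * 1) := by
          gcongr
          · exact expMomentConst_nonneg
          calc ∑ i, (s * c i) ^ 2 ≤ ∑ _i : ι, N⁻¹ := by
                refine Finset.sum_le_sum fun i _ => ?_
                rw [mul_pow, hs, inv_pow, mul_pow, Real.sq_sqrt (by linarith), mul_inv,
                  mul_comm (R ^ 2)⁻¹, mul_assoc]
                refine mul_le_of_le_one_right (by positivity) ?_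
                rw [inv_mul_le_iff₀ (by positivity), mul_one, ← sq_abs]
                gcongr
                exact hc i
            _ ≤ 1 := by
                rw [Finset.sum_const, Finset.card_univ, nsmul_eq_mul, ← div_eq_mul_inv,
                  div_le_one (by linarith)]
                exact hcard
      _ = _ := by rw [mul_one]
  calc Real.exp (-s * (R * Real.sqrt N * L)) * mgf _ _ s
      ≤ Real.exp (-s * (R * Real.sqrt N * L)) * Real.exp expMomentConst := by gcongr
    _ = Real.exp (expMomentConst - L) := by
        rw [← Real.exp_add]
        congr 1
        rw [hs]
        field_simp
        ring

lemma measureReal_abs_sum_ge_le {ι : Type*} [Fintype ι] (hm : Measurable h)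
    (hb : ∀ x, |h x| ≤ (x ^ 2 + 1) / 16) (h0 : ∫ x, h x ∂stdGaussianReal = 0) {c : ι → ℝ} {R N : ℝ}
    (hR : 0 < R) (hc : ∀ i, |c i| ≤ R) (hN : 1 ≤ N) (hcard : (Fintype.card ι : ℝ) ≤ N) (L : ℝ) :
    (stdGaussian (EuclideanSpace ℝ ι)).real {y | R * Real.sqrt N * L ≤ |∑ i, c i * h (y i)|} ≤
      2 * Real.exp (expMomentConst - L) := by
  have hmeas : ∀ c : ι → ℝ, Measurable fun y : EuclideanSpace ℝ ι => ∑ i, c i * h (y i) := fun c =>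
    Finset.measurable_sum _ fun i _ => (hm.comp (by fun_prop)).const_mul _
  have h1 : ∀ c : ι → ℝ, (∀ i, |c i| ≤ R) →
      (stdGaussian (EuclideanSpace ℝ ι)).real {y | R * Real.sqrt N * L ≤ ∑ i, c i * h (y i)} ≤
        Real.exp (expMomentConst - L) := by
    intro c hc
    rw [← map_pi_eq_stdGaussian, map_measureReal_apply (by fun_prop)
      (measurableSet_le measurable_const (hmeas c))]
    exact measureReal_sum_ge_le hm hb h0 hR hc hN hcard L
  have hsub : {y : EuclideanSpace ℝ ι | R * Real.sqrt N * L ≤ |∑ i, c i * h (y i)|} ⊆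
      {y | R * Real.sqrt N * L ≤ ∑ i, c i * h (y i)} ∪
        {y | R * Real.sqrt N * L ≤ ∑ i, (-c i) * h (y i)} := by
    intro y hy
    change _ ≤ |(_ : ℝ)| at hy
    rcases le_abs.1 hy with hy | hy
    · exact Or.inl hy
    · right
      simpa [Finset.sum_neg_distrib] using hy
  have := (measureReal_mono (μ := stdGaussian (EuclideanSpace ℝ ι)) hsub).trans
      (measureReal_union_le _ _)
  have h2 := h1 (fun i => -c i) (fun i => by simpa using hc i)
  simp only at h2
  linarith [h1 c hc]

end GaussianReal
end NodalCount
end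

noncomputable section

namespace NodalCount

/-! ### Signs and the Gaussian mean of a shifted sign. -/

section Sign

/-- The sign function with values in `{1, -1}`. -/
def sgn (x : ℝ) : ℝ := if 0 < x then 1 else -1

lemma sgn_of_pos {x : ℝ} (hx : 0 < x) : sgn x = 1 := if_pos hx

lemma sgn_of_nonpos {x : ℝ} (hx : x ≤ 0) : sgn x = -1 := if_neg hx.not_gt

lemma sgn_eq_or (x : ℝ) : sgn x = 1 ∨ sgn x = -1 := by
  unfold sgn; split_ifs <;> simp

@[simp] lemma abs_sgn (x : ℝ) : |sgn x| = 1 := by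
  rcases sgn_eq_or x with h | h <;> simp [h]

@[simp] lemma sgn_mul_self (x : ℝ) : sgn x * sgn x = 1 := by
  rcases sgn_eq_or x with h | h <;> simp [h]

lemma sgn_mul_eq_abs (x : ℝ) : sgn x * x = |x| := by
  unfold sgn
  split_ifs with h
  · simp [abs_of_pos h]
  · simp [abs_of_nonpos (not_lt.1 h)]

lemma sgn_mul {x y : ℝ} (hx : x ≠ 0) (hy : y ≠ 0) : sgn (x * y) = sgn x * sgn y := by
  rcases lt_or_gt_of_ne hx with h | h <;> rcases lt_or_gt_of_ne hy with h' | h'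
  · rw [sgn_of_pos (mul_pos_of_neg_of_neg h h'), sgn_of_nonpos h.le, sgn_of_nonpos h'.le]; norm_num
  · rw [sgn_of_nonpos (mul_neg_of_neg_of_pos h h').le, sgn_of_nonpos h.le, sgn_of_pos h']; norm_num
  · rw [sgn_of_nonpos (mul_neg_of_pos_of_neg h h').le, sgn_of_nonpos h'.le, sgn_of_pos h]; norm_num
  · rw [sgn_of_pos (mul_pos h h'), sgn_of_pos h, sgn_of_pos h']; norm_num

lemma sgn_mul_of_pos_left {x y : ℝ} (hx : 0 < x) : sgn (x * y) = sgn y := by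
  unfold sgn
  simp [mul_pos_iff_of_pos_left hx]

@[fun_prop] lemma measurable_sgn : Measurable sgn :=
  Measurable.ite measurableSet_Ioi measurable_const measurable_const

lemma sgn_neg {x : ℝ} (hx : x ≠ 0) : sgn (-x) = -sgn x := by
  rcases lt_or_gt_of_ne hx with h | h
  · rw [sgn_of_pos (by linarith), sgn_of_nonpos h.le]; norm_num
  · rw [sgn_of_nonpos (by linarith), sgn_of_pos h]

lemma integrable_sgn_comp {α : Type*} [MeasurableSpace α] {μ : Measure α} [IsFiniteMeasure μ]
    {f : α → ℝ} (hf : Measurable f) : Integrable (fun x => sgn (f x)) μ :=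
  Integrable.of_bound (measurable_sgn.comp hf).aestronglyMeasurable 1
    (Eventually.of_forall fun x => by simp)

lemma integrable_sgn_mul_sgn {α : Type*} [MeasurableSpace α] {μ : Measure α} [IsFiniteMeasure μ]
    {f g : α → ℝ} (hf : Measurable f) (hg : Measurable g) :
    Integrable (fun x => sgn (f x) * sgn (g x)) μ :=
  Integrable.of_bound ((measurable_sgn.comp hf).mul (measurable_sgn.comp hg)).aestronglyMeasurable 1
    (Eventually.of_forall fun x => by simp)

lemma integral_sgn_stdGaussianReal : ∫ z, sgn z ∂stdGaussianReal = 0 := by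
  have h1 : ∫ z, sgn (-z) ∂stdGaussianReal = ∫ z, sgn z ∂stdGaussianReal := by
    have h := gaussianReal_map_neg (μ := 0) (v := 1)
    rw [neg_zero] at h
    conv_rhs => rw [stdGaussianReal, ← h]
    rw [integral_map (by fun_prop) (by fun_prop)]
  have h2 : ∫ z, sgn (-z) ∂stdGaussianReal = -∫ z, sgn z ∂stdGaussianReal := by
    rw [← integral_neg]
    refine integral_congr_ae ?_
    have : NullSingletonClass stdGaussianReal := nullSingletonClass_gaussianReal one_ne_zero
    filter_upwards [Measure.ae_ne stdGaussianReal 0] with z hz using sgn_neg hz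
  linarith

lemma stdGaussianReal_real_Ioc {a b : ℝ} (hab : a ≤ b) :
    stdGaussianReal.real (Set.Ioc a b) = ∫ z in a..b, gaussianPDFReal 0 1 z := by
  rw [Measure.real, gaussianReal_apply_eq_integral _ one_ne_zero, ENNReal.toReal_ofReal
    (integral_nonneg fun x => gaussianPDFReal_nonneg _ _ _), intervalIntegral.integral_of_le hab]

/-- By symmetry `sgn z` has mean zero, and `sgn (z + w) - sgn z` is `±2` on the interval between `0`
and `-w` and zero elsewhere. The oriented interval integral absorbs the sign of `w`. -/
lemma integral_sgn_add_eq (w : ℝ) :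
    ∫ z, sgn (z + w) ∂stdGaussianReal = 2 * ∫ z in (-w)..0, gaussianPDFReal 0 1 z := by
  have h0 : ∫ z, sgn (z + w) ∂stdGaussianReal =
      ∫ z, (sgn (z + w) - sgn z) ∂stdGaussianReal := by
    rw [integral_sub (integrable_sgn_comp (by fun_prop)) (integrable_sgn_comp (by fun_prop)),
      integral_sgn_stdGaussianReal, sub_zero]
  rw [h0]
  rcases le_total 0 w with hw | hw
  · have h1 : (fun z => sgn (z + w) - sgn z) =
        (Set.Ioc (-w) 0).indicator fun _ => (2 : ℝ) := by
      ext z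
      by_cases hz : z ∈ Set.Ioc (-w) 0
      · rw [Set.indicator_of_mem hz, sgn_of_pos (by linarith [hz.1]), sgn_of_nonpos hz.2]
        norm_num
      · rw [Set.indicator_of_notMem hz]
        by_cases h : -w < z
        · have : 0 < z := by
            by_contra h'
            exact hz ⟨h, not_lt.1 h'⟩
          rw [sgn_of_pos this, sgn_of_pos (by linarith)]; norm_num
        · rw [sgn_of_nonpos (by linarith), sgn_of_nonpos (by linarith)]; norm_num
    rw [h1, integral_indicator_const _ measurableSet_Ioc, stdGaussianReal_real_Ioc (by linarith)]
    simp [mul_comm]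
  · have h1 : (fun z => sgn (z + w) - sgn z) =
        (Set.Ioc 0 (-w)).indicator fun _ => (-2 : ℝ) := by
      ext z
      by_cases hz : z ∈ Set.Ioc 0 (-w)
      · rw [Set.indicator_of_mem hz, sgn_of_pos hz.1, sgn_of_nonpos (by linarith [hz.2])]
        norm_num
      · rw [Set.indicator_of_notMem hz]
        by_cases h : 0 < z
        · have : -w < z := by
            by_contra h'
            exact hz ⟨h, not_lt.1 h'⟩
          rw [sgn_of_pos h, sgn_of_pos (by linarith)]; norm_num
        · rw [sgn_of_nonpos (by linarith), sgn_of_nonpos (by linarith)]; norm_num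
    rw [h1, integral_indicator_const _ measurableSet_Ioc, stdGaussianReal_real_Ioc (by linarith),
      intervalIntegral.integral_symm 0 (-w)]
    simp [mul_comm]

/-- Replace the density by its value at `0`: between `0` and `-w` it varies by at most a multiple of
`|w|`, over a length `|w|`. -/
lemma abs_integral_sgn_add_sub_le (w : ℝ) :
    |∫ z, sgn (z + w) ∂stdGaussianReal - 2 * (Real.sqrt (2 * Real.pi))⁻¹ * w| ≤ w ^ 2 := by
  rw [integral_sgn_add_eq]
  set c := (Real.sqrt (2 * Real.pi))⁻¹ with hc
  have hc0 : 0 < c := by positivity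
  have hc1 : c ≤ 1 / 2 := by
    rw [hc, inv_le_comm₀ (by positivity) (by norm_num)]
    refine Real.le_sqrt_of_sq_le ?_
    nlinarith [Real.pi_gt_three]
  have hcw : 2 * c * w = 2 * ∫ _z in (-w)..0, c := by
    simp
    ring
  rw [hcw, ← mul_sub, ← intervalIntegral.integral_sub
    ((by
      have : Continuous (gaussianPDFReal 0 1) := by
        rw [funext gaussianPDFReal_zero_one]; fun_prop
      exact this.intervalIntegrable _ _)) (by simp)]
  have hbound : ∀ z ∈ Set.uIoc (-w) 0, ‖gaussianPDFReal 0 1 z - c‖ ≤ c * |w| := by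
    intro z hz
    have hzw : |z| ≤ |w| := by
      have := Set.uIoc_subset_uIcc hz
      rw [Set.mem_uIcc] at this
      rcases this with h | h
      · rw [abs_of_nonpos h.2]; exact (by linarith [h.1] : -z ≤ w).trans (le_abs_self w)
      · rw [abs_of_nonneg h.1]; exact (h.2).trans (neg_le_abs w)
    rw [gaussianPDFReal_zero_one, ← hc, Real.norm_eq_abs, abs_sub_comm]
    have h1 : Real.exp (-(1 / 2) * z ^ 2) ≤ 1 := Real.exp_le_one_iff.2 (by nlinarith [sq_nonneg z])
    have h2 : 1 - Real.exp (-(1 / 2) * z ^ 2) ≤ |z| := by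
      rcases le_total 1 |z| with h | h
      · linarith [Real.exp_pos (-(1 / 2) * z ^ 2)]
      · have := Real.add_one_le_exp (-(1 / 2) * z ^ 2)
        nlinarith [abs_nonneg z, sq_abs z]
    have h3 : c - c * Real.exp (-(1 / 2) * z ^ 2) = c * (1 - Real.exp (-(1 / 2) * z ^ 2)) := by ring
    rw [h3, abs_of_nonneg (mul_nonneg hc0.le (by linarith))]
    gcongr
    linarith
  have := intervalIntegral.norm_integral_le_of_norm_le_const hbound
  rw [Real.norm_eq_abs, sub_neg_eq_add, zero_add] at this
  rw [abs_mul, abs_two, ← sq_abs w]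
  nlinarith [abs_nonneg w, sq_nonneg |w|]

end Sign

/-! ### Linear functionals of a standard Gaussian vector and their sign correlations. -/

section Inner

variable {E : Type*} [NormedAddCommGroup E] [InnerProductSpace ℝ E]

lemma sgn_inner_inv_norm_smul {a : E} (ha : a ≠ 0) (y : E) :
    sgn (inner ℝ (‖a‖⁻¹ • a) y) = sgn (inner ℝ a y) := by
  rw [real_inner_smul_left]
  exact sgn_mul_of_pos_left (inv_pos.2 (norm_pos_iff.2 ha))

lemma inner_inv_norm_smul (a b : E) :
    inner ℝ (‖a‖⁻¹ • a) (‖b‖⁻¹ • b) = inner ℝ a b / (‖a‖ * ‖b‖) := by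
  rw [real_inner_smul_left, real_inner_smul_right, div_eq_mul_inv, mul_inv]
  ring

variable [FiniteDimensional ℝ E] [MeasurableSpace E] [BorelSpace E]

lemma stdGaussian_map_inner (a : E) :
    (stdGaussian E).map (fun y => inner ℝ a y) = gaussianReal 0 (‖a‖₊ ^ 2) := by
  have h := IsGaussian.map_eq_gaussianReal (μ := stdGaussian E) (innerSL ℝ a)
  rw [integral_strongDual_stdGaussian, variance_dual_stdGaussian, innerSL_apply_norm] at h
  have h2 : (‖a‖ ^ 2).toNNReal = ‖a‖₊ ^ 2 := by
    rw [Real.toNNReal_pow (norm_nonneg a), norm_toNNReal]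
  rw [h2] at h
  exact h

lemma measureReal_abs_inner_gt_le (a : E) {L : ℝ} (hL : 0 ≤ L) :
    (stdGaussian E).real {y | L * ‖a‖ < |inner ℝ a y|} ≤ 4 * Real.exp (-L) := by
  -- The strict inequality in the event makes it empty when `a = 0`, so no hypothesis on `a` is
  -- needed when residuals vanish.
  rcases eq_or_ne a 0 with rfl | ha
  · simp; positivity
  have ha' : 0 < ‖a‖ := norm_pos_iff.2 ha
  have h1 : ∀ a : E, a ≠ 0 → (stdGaussian E).real {y | L * ‖a‖ ≤ inner ℝ a y} ≤
      2 * Real.exp (-L) := by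
    intro a ha
    have ha' : 0 < ‖a‖ := norm_pos_iff.2 ha
    have hmgf := mgf_gaussianReal (stdGaussian_map_inner a) (L / ‖a‖)
    have hi : Integrable (fun y => Real.exp (L / ‖a‖ * inner ℝ a y)) (stdGaussian E) := by
      have : Integrable (fun x => Real.exp (L / ‖a‖ * x)) (gaussianReal 0 (‖a‖₊ ^ 2)) :=
        integrable_exp_mul_gaussianReal _
      rw [← stdGaussian_map_inner a] at this
      exact this.comp_measurable (by fun_prop)
    refine (measure_ge_le_exp_mul_mgf (L * ‖a‖) (by positivity) hi).trans ?_
    rw [hmgf, ← Real.exp_add]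
    have h2 : -(L / ‖a‖) * (L * ‖a‖) +
        (0 * (L / ‖a‖) + ((‖a‖₊ ^ 2 : NNReal) : ℝ) * (L / ‖a‖) ^ 2 / 2)
        = - L ^ 2 / 2 := by
      push_cast
      field_simp
      ring
    rw [h2]
    -- Gaussian decay is weakened to `exp (-L)` so that all exceptional events share one form of
    -- bound.
    calc Real.exp (-L ^ 2 / 2) ≤ Real.exp (1 / 2 + -L) := by
          gcongr
          nlinarith [sq_nonneg (L - 1)]
      _ = Real.exp (1 / 2) * Real.exp (-L) := Real.exp_add _ _
      _ ≤ 2 * Real.exp (-L) := by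
          gcongr
          have := Real.exp_bound_div_one_sub_of_interval (x := 1 / 2) (by norm_num) (by norm_num)
          norm_num at this ⊢
          exact this
  have hsub : {y : E | L * ‖a‖ < |inner ℝ a y|} ⊆
      {y | L * ‖a‖ ≤ inner ℝ a y} ∪ {y | L * ‖-a‖ ≤ inner ℝ (-a) y} := by
    intro y hy
    change _ < |(_ : ℝ)| at hy
    rcases lt_abs.1 hy with hy | hy
    · exact Or.inl hy.le
    · right
      simpa using hy.le
  have := (measureReal_mono (μ := stdGaussian E) hsub).trans
      (measureReal_union_le _ _)
  linarith [h1 a ha, h1 (-a) (neg_ne_zero.2 ha)]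

lemma ae_inner_ne_zero {a : E} (ha : a ≠ 0) : ∀ᵐ y ∂stdGaussian E, inner ℝ a y ≠ 0 := by
  have hv : ‖a‖₊ ^ 2 ≠ 0 := by simpa using ha
  have h : ∀ᵐ x ∂(gaussianReal 0 (‖a‖₊ ^ 2)), x ≠ 0 := by
    have := nullSingletonClass_gaussianReal (μ := 0) hv
    exact Measure.ae_ne _ 0
  rw [← stdGaussian_map_inner a] at h
  exact ae_of_ae_map (f := fun y => inner ℝ a y) (by fun_prop) h

/-- Orthogonality means zero covariance, and uncorrelated jointly Gaussian variables are
independent. -/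
lemma stdGaussian_map_inner_prod {a b : E} (ha : ‖a‖ = 1) (hb : ‖b‖ = 1) (hab : inner ℝ a b = 0) :
    (stdGaussian E).map (fun y => (inner ℝ a y, inner ℝ b y)) =
      stdGaussianReal.prod stdGaussianReal := by
  have hlaw : HasGaussianLaw (fun y : E => (inner ℝ a y, inner ℝ b y)) (stdGaussian E) :=
    (IsGaussian.hasGaussianLaw_id (μ := stdGaussian E)).map
      ((innerSL ℝ a).prod (innerSL ℝ b))
  have hind := hlaw.indepFun_of_covariance_eq_zero (by
    rw [← covarianceBilin_apply_eq_cov IsGaussian.memLp_two_id, covarianceBilin_stdGaussian]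
    exact hab)
  rw [(indepFun_iff_map_prod_eq_prod_map_map (by fun_prop) (by fun_prop)).1 hind,
    stdGaussian_map_inner, stdGaussian_map_inner]
  have ha' : ‖a‖₊ = 1 := by ext; exact ha
  have hb' : ‖b‖₊ = 1 := by ext; exact hb
  simp [ha', hb']

/-- Split `b = q a' + c a` with `a'` a unit vector orthogonal to `a`. The functionals of `a` and
`a'` are independent standard Gaussians `x` and `z`, and the second sign is that of `z + τ x` with
`τ = c / q`. Averaging over `z` first linearizes it as a multiple of `τ x` with error `(τ x)^2`.
Averaging against `sgn x` leaves `(2/π) τ` with error `τ^2`, and `τ` differs from `c` by at most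
`c^2`. -/
lemma abs_integral_sgn_inner_sub_le_of_unit {a b : E} (ha : ‖a‖ = 1) (hb : ‖b‖ = 1)
    (hc : |inner ℝ a b| ≤ 1 / 2) :
    |∫ y, sgn (inner ℝ a y) * sgn (inner ℝ b y) ∂stdGaussian E
      - 2 / Real.pi * inner ℝ a b| ≤ 3 * (inner ℝ a b) ^ 2 := by
  set c : ℝ := inner ℝ a b with hcdef
  have hc2 : c ^ 2 ≤ 1 / 4 := by rw [← sq_abs]; nlinarith [abs_nonneg c]
  set q : ℝ := Real.sqrt (1 - c ^ 2) with hq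
  have hq2 : q ^ 2 = 1 - c ^ 2 := Real.sq_sqrt (by linarith)
  have hq0 : 0 < q := Real.sqrt_pos.2 (by linarith)
  set a' : E := q⁻¹ • (b - c • a) with ha'
  have haa : inner ℝ a a = (1 : ℝ) := by rw [real_inner_self_eq_norm_sq, ha, one_pow]
  have hbb : inner ℝ b b = (1 : ℝ) := by rw [real_inner_self_eq_norm_sq, hb, one_pow]
  have haa' : inner ℝ a a' = (0 : ℝ) := by
    rw [ha', inner_smul_right, inner_sub_right, inner_smul_right, haa, ← hcdef]; ring
  have hna' : ‖a'‖ = 1 := by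
    have : ‖a'‖ ^ 2 = 1 := by
      have hba : inner ℝ b a = c := real_inner_comm a b
      rw [← real_inner_self_eq_norm_sq, ha', real_inner_smul_right, real_inner_smul_left,
        inner_sub_right, inner_sub_left, inner_sub_left, real_inner_smul_right,
        real_inner_smul_right, real_inner_smul_left, real_inner_smul_left, haa, hbb, hba, ← hcdef]
      field_simp
      rw [hq2]; ring
    nlinarith [norm_nonneg a']
  have hby : ∀ y : E, inner ℝ b y = q * (inner ℝ a' y + c / q * inner ℝ a y) := by
    intro y
    have : b = q • a' + c • a := by
      rw [ha', smul_smul, mul_inv_cancel₀ hq0.ne', one_smul]; abel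
    conv_lhs => rw [this]
    rw [inner_add_left, real_inner_smul_left a', real_inner_smul_left a, mul_add, ← mul_assoc,
      mul_div_cancel₀ _ hq0.ne']
  set τ : ℝ := c / q with hτ
  have hint : ∫ y, sgn (inner ℝ a y) * sgn (inner ℝ b y) ∂stdGaussian E =
      ∫ x, sgn x * ∫ z, sgn (z + τ * x) ∂stdGaussianReal ∂stdGaussianReal := by
    simp_rw [hby, sgn_mul_of_pos_left hq0]
    have h1 : ∫ y, sgn (inner ℝ a y) * sgn (inner ℝ a' y + τ * inner ℝ a y) ∂stdGaussian E =
        ∫ p : ℝ × ℝ, sgn p.1 * sgn (p.2 + τ * p.1) ∂(stdGaussianReal.prod stdGaussianReal) := by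
      rw [← stdGaussian_map_inner_prod ha hna' haa', integral_map (by fun_prop) (by fun_prop)]
    rw [h1, integral_prod _ (integrable_sgn_mul_sgn (by fun_prop) (by fun_prop))]
    simp_rw [integral_const_mul]
  rw [hint]
  -- `κ` is twice the Gaussian density at `0`; together with `E|x| = √(2/π)` it produces the
  -- constant `2/π`.
  set κ : ℝ := 2 * (Real.sqrt (2 * Real.pi))⁻¹ with hκ
  have hκe : κ * Real.sqrt (2 / Real.pi) = 2 / Real.pi := by
    rw [hκ, Real.sqrt_div (by norm_num), Real.sqrt_mul (by norm_num)]
    have h1 : Real.sqrt Real.pi * Real.sqrt Real.pi = Real.pi :=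
      Real.mul_self_sqrt Real.pi_pos.le
    have hpi : 0 < Real.sqrt Real.pi := Real.sqrt_pos.2 Real.pi_pos
    have h2' : 0 < Real.sqrt 2 := Real.sqrt_pos.2 (by norm_num)
    conv_rhs => rw [← h1]
    field_simp
  have hH : Measurable fun x => ∫ z, sgn (z + τ * x) ∂stdGaussianReal :=
    (StronglyMeasurable.integral_prod_right' (f := fun p : ℝ × ℝ => sgn (p.2 + τ * p.1))
      (Measurable.stronglyMeasurable (by fun_prop))).measurable
  have hHb : ∀ x, |∫ z, sgn (z + τ * x) ∂stdGaussianReal| ≤ 1 := fun x => by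
    refine (abs_integral_le_integral_abs).trans ?_
    simp
  have hi1 : Integrable (fun x => sgn x * ∫ z, sgn (z + τ * x) ∂stdGaussianReal)
      stdGaussianReal :=
    Integrable.of_bound (by fun_prop) 1 (Eventually.of_forall fun x => by
      simpa [abs_mul] using hHb x)
  have hi2 : Integrable (fun x => κ * τ * |x|) stdGaussianReal :=
    (integrable_id_stdGaussianReal.abs).const_mul _
  have hmain : |∫ x, sgn x * ∫ z, sgn (z + τ * x) ∂stdGaussianReal ∂stdGaussianReal
      - 2 / Real.pi * τ| ≤ τ ^ 2 := by
    have h1 : 2 / Real.pi * τ = ∫ x, κ * τ * |x| ∂stdGaussianReal := by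
      rw [integral_const_mul, integral_abs_stdGaussianReal, mul_right_comm, hκe]
    rw [h1, ← integral_sub hi1 hi2]
    calc _ ≤ ∫ x, τ ^ 2 * x ^ 2 ∂stdGaussianReal := by
          refine abs_integral_le_integral_abs.trans (integral_mono (hi1.sub hi2).abs
            (integrable_sq_stdGaussianReal.const_mul _) fun x => ?_)
          have h2 := abs_integral_sgn_add_sub_le (τ * x)
          have h3 : sgn x * (∫ z, sgn (z + τ * x) ∂stdGaussianReal) - κ * τ * |x| =
              sgn x * (∫ z, sgn (z + τ * x) ∂stdGaussianReal
                - 2 * (Real.sqrt (2 * Real.pi))⁻¹ * (τ * x)) := by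
            rw [mul_sub, ← sgn_mul_eq_abs]; ring
          simp only
          rw [h3, abs_mul, abs_sgn, one_mul, ← mul_pow]
          exact h2
      _ = τ ^ 2 := by rw [integral_const_mul, integral_sq_stdGaussianReal, mul_one]
  have hq3 : 3 / 4 ≤ q ^ 2 := by linarith
  have hq1 : q ≤ 1 := by nlinarith
  have hq4 : 3 / 4 ≤ q := by nlinarith
  have hτ2 : τ ^ 2 ≤ 4 / 3 * c ^ 2 := by
    rw [hτ, div_pow, div_le_iff₀ (by positivity)]
    nlinarith [sq_nonneg c]
  have hτc : |τ - c| ≤ c ^ 2 := by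
    have h1 : τ - c = c * ((1 - q) / q) := by rw [hτ]; field_simp
    have h2 : (1 - q) / q ≤ |c| := by
      rw [div_le_iff₀ hq0]
      have : (1 - q) * (1 + q) = |c| ^ 2 := by rw [sq_abs]; nlinarith
      nlinarith [abs_nonneg c]
    rw [h1, abs_mul, abs_of_nonneg (div_nonneg (by linarith) hq0.le), ← sq_abs, sq]
    gcongr
  have hpi : 2 / Real.pi ≤ 1 := by rw [div_le_one Real.pi_pos]; linarith [Real.pi_gt_three]
  have hpi0 : 0 < 2 / Real.pi := by positivity
  have h5 : |2 / Real.pi * τ - 2 / Real.pi * c| ≤ c ^ 2 := by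
    rw [← mul_sub, abs_mul, abs_of_pos hpi0]
    nlinarith [abs_nonneg (τ - c)]
  have := abs_sub_le (∫ x, sgn x * ∫ z, sgn (z + τ * x) ∂stdGaussianReal ∂stdGaussianReal)
    (2 / Real.pi * τ) (2 / Real.pi * c)
  nlinarith [sq_nonneg c]

/-- The expected product of the signs of two jointly Gaussian variables, to second order in their
correlation. -/
lemma abs_integral_sgn_inner_sub_le {a b : E} (ha : a ≠ 0) (hb : b ≠ 0)
    (hc : |inner ℝ a b / (‖a‖ * ‖b‖)| ≤ 1 / 2) :
    |∫ y, sgn (inner ℝ a y) * sgn (inner ℝ b y) ∂stdGaussian E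
      - 2 / Real.pi * (inner ℝ a b / (‖a‖ * ‖b‖))| ≤ 3 * (inner ℝ a b / (‖a‖ * ‖b‖)) ^ 2 := by
  have h := abs_integral_sgn_inner_sub_le_of_unit (a := ‖a‖⁻¹ • a) (b := ‖b‖⁻¹ • b)
    (by simp [norm_smul, ha]) (by simp [norm_smul, hb]) (by rwa [inner_inv_norm_smul])
  simpa only [inner_inv_norm_smul, sgn_inner_inv_norm_smul ha, sgn_inner_inv_norm_smul hb] using h

/-- For correlation at most `1/2` the expansion applies and its quadratic term is absorbed into the
linear one. Beyond that, three times the correlation already exceeds the trivial bound `1`. -/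
lemma abs_integral_sgn_inner_le {a b : E} (ha : a ≠ 0) (hb : b ≠ 0) :
    |∫ y, sgn (inner ℝ a y) * sgn (inner ℝ b y) ∂stdGaussian E|
      ≤ 3 * |inner ℝ a b / (‖a‖ * ‖b‖)| := by
  set c := inner ℝ a b / (‖a‖ * ‖b‖) with hcdef
  rcases le_total |c| (1 / 2) with hc | hc
  · have h1 := abs_integral_sgn_inner_sub_le ha hb hc
    rw [← hcdef] at h1
    have hpi : 2 / Real.pi ≤ 1 := by rw [div_le_one Real.pi_pos]; linarith [Real.pi_gt_three]
    have hpi0 : 0 < 2 / Real.pi := by positivity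
    have h2 : |2 / Real.pi * c| ≤ |c| := by
      rw [abs_mul, abs_of_pos hpi0]; exact mul_le_of_le_one_left (abs_nonneg c) hpi
    have h3 := abs_sub_abs_le_abs_sub (∫ y, sgn (inner ℝ a y) * sgn (inner ℝ b y) ∂stdGaussian E)
      (2 / Real.pi * c)
    rw [← sq_abs c] at h1
    nlinarith [abs_nonneg c]
  · refine abs_integral_le_integral_abs.trans ?_
    simp only [abs_mul, abs_sgn, mul_one, integral_const, probReal_univ, smul_eq_mul]
    linarith

end Inner
end NodalCount
end

noncomputable section

namespace NodalCount

/-! ### Gram-Schmidt frames and residuals. -/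

section GramSchmidt

variable {E : Type*} [NormedAddCommGroup E] [InnerProductSpace ℝ E] {n : ℕ}

open InnerProductSpace

/-- The component of `w` orthogonal to `u l` for `l < j`, for an orthonormal family `u`. -/
def residual (u : Fin n → E) (j : Fin n) (w : E) : E :=
  w - ∑ l ∈ Finset.Iio j, (inner ℝ (u l) w : ℝ) • u l

/-- Each vector has norm `0` or `1`, and the vectors are pairwise orthogonal. -/
structure IsPartialFrame (u : Fin n → E) : Prop where
  norm_eq : ∀ i, ‖u i‖ = 0 ∨ ‖u i‖ = 1
  inner_eq : ∀ i j, i ≠ j → inner ℝ (u i) (u j) = (0 : ℝ)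

/-- Linearly dependent inputs give zero vectors instead of breaking orthogonality. Allowing norm `0`
makes the residual identities valid for every `x`, so conditional estimates hold pointwise and not
just almost everywhere. -/
lemma isPartialFrame_gramSchmidtNormed (x : Fin n → E) :
    IsPartialFrame (gramSchmidtNormed ℝ x) where
  norm_eq i := by
    by_cases h : gramSchmidtNormed ℝ x i = 0
    · left; simp [h]
    · right; exact gramSchmidtNormed_unit_length' h
  inner_eq i j hij := by
    simp [gramSchmidtNormed, inner_smul_left, inner_smul_right, gramSchmidt_orthogonal ℝ x hij]

lemma _root_.Orthonormal.isPartialFrame {u : Fin n → E} (hu : Orthonormal ℝ u) :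
    IsPartialFrame u where
  norm_eq i := Or.inr (hu.1 i)
  inner_eq _ _ hij := hu.2 hij

namespace IsPartialFrame

variable {u : Fin n → E} (hu : IsPartialFrame u)
include hu

lemma norm_le (i : Fin n) : ‖u i‖ ≤ 1 := by
  rcases hu.norm_eq i with h | h <;> simp [h]

lemma inner_self_smul (i : Fin n) : (inner ℝ (u i) (u i) : ℝ) • u i = u i := by
  rw [real_inner_self_eq_norm_sq]
  rcases hu.norm_eq i with h | h
  · rw [norm_eq_zero.1 h]; simp
  · simp [h]

lemma inner_residual (j : Fin n) (w : E) {l : Fin n} (hl : l < j) :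
    inner ℝ (u l) (residual u j w) = (0 : ℝ) := by
  rw [residual, inner_sub_right, inner_sum, Finset.sum_eq_single l]
  · have h := congrArg (fun z => (inner ℝ z w : ℝ)) (hu.inner_self_smul l)
    simp only [real_inner_smul_left] at h
    rw [inner_smul_right]
    linarith
  · intro m _ hm
    rw [inner_smul_right, hu.inner_eq l m hm.symm, mul_zero]
  · intro h
    exact absurd (Finset.mem_Iio.2 hl) h

lemma inner_residual_residual (j : Fin n) (w y : E) :
    inner ℝ (residual u j w) (residual u j y) = (inner ℝ (residual u j w) y : ℝ) := by
  conv_lhs => rw [residual.eq_def u j y, inner_sub_right, inner_sum]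
  rw [sub_eq_self]
  refine Finset.sum_eq_zero fun l hl => ?_
  rw [inner_smul_right, real_inner_comm (u l), hu.inner_residual j w (Finset.mem_Iio.1 hl),
    mul_zero]

/-- The residual map is an orthogonal projection, hence self-adjoint. This moves the projection from
the random vector to the fixed one and exposes a linear functional of the Gaussian. -/
lemma inner_residual_comm (j : Fin n) (w y : E) :
    inner ℝ w (residual u j y) = (inner ℝ (residual u j w) y : ℝ) := by
  rw [real_inner_comm, ← hu.inner_residual_residual, real_inner_comm, hu.inner_residual_residual]

lemma inner_residual_eq (j : Fin n) (w y : E) :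
    (inner ℝ (residual u j w) (residual u j y) : ℝ) =
      inner ℝ w y - ∑ l ∈ Finset.Iio j, inner ℝ (u l) w * inner ℝ (u l) y := by
  rw [hu.inner_residual_residual, residual, inner_sub_left, sum_inner]
  congr 1
  refine Finset.sum_congr rfl fun l _ => ?_
  rw [real_inner_smul_left]

lemma norm_residual_sq (j : Fin n) (w : E) :
    ‖residual u j w‖ ^ 2 = ‖w‖ ^ 2 - ∑ l ∈ Finset.Iio j, (inner ℝ (u l) w) ^ 2 := by
  rw [← real_inner_self_eq_norm_sq, hu.inner_residual_eq, real_inner_self_eq_norm_sq]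
  simp_rw [sq]

lemma norm_residual_le (j : Fin n) (w : E) : ‖residual u j w‖ ≤ ‖w‖ := by
  have := hu.norm_residual_sq j w
  have h2 : 0 ≤ ∑ l ∈ Finset.Iio j, (inner ℝ (u l) w : ℝ) ^ 2 :=
    Finset.sum_nonneg fun _ _ => sq_nonneg _
  exact le_of_sq_le_sq (by linarith) (norm_nonneg _)

lemma sum_inner_sq_le (j : Fin n) (w : E) :
    ∑ l ∈ Finset.Iio j, (inner ℝ (u l) w : ℝ) ^ 2 ≤ ‖w‖ ^ 2 := by
  have := hu.norm_residual_sq j w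
  linarith [sq_nonneg ‖residual u j w‖]

end IsPartialFrame

lemma gramSchmidt_eq_residual (x : Fin n → E) (j : Fin n) :
    gramSchmidt ℝ x j = residual (gramSchmidtNormed ℝ x) j (x j) := by
  rw [gramSchmidt_def, residual]
  congr 1
  refine Finset.sum_congr rfl fun l _ => ?_
  rw [Submodule.starProjection_singleton, gramSchmidtNormed, real_inner_smul_left, smul_smul]
  congr 1
  simp only [RCLike.ofReal_real_eq_id, id_eq]
  rw [div_eq_mul_inv, sq, mul_inv]
  ring

lemma residual_congr {u u' : Fin n → E} {j : Fin n} (h : ∀ l < j, u l = u' l) (w : E) :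
    residual u j w = residual u' j w := by
  rw [residual, residual]
  congr 1
  exact Finset.sum_congr rfl fun l hl => by rw [h l (Finset.mem_Iio.1 hl)]

lemma gramSchmidtNormed_eq (x : Fin n → E) (j : Fin n) :
    gramSchmidtNormed ℝ x j = ‖gramSchmidt ℝ x j‖⁻¹ • gramSchmidt ℝ x j := rfl

lemma gramSchmidt_congr {x x' : Fin n → E} (j : Fin n) (h : ∀ l ≤ j, x l = x' l) :
    gramSchmidt ℝ x j = gramSchmidt ℝ x' j := by
  induction j using WellFoundedLT.induction with
  | ind j ih =>
    rw [gramSchmidt_eq_residual, gramSchmidt_eq_residual, h j le_rfl]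
    refine residual_congr (fun l hl => ?_) _
    rw [gramSchmidtNormed_eq, gramSchmidtNormed_eq, ih l hl fun m hm => h m (hm.trans hl.le)]

lemma gramSchmidtNormed_congr {x x' : Fin n → E} (j : Fin n) (h : ∀ l ≤ j, x l = x' l) :
    gramSchmidtNormed ℝ x j = gramSchmidtNormed ℝ x' j := by
  rw [gramSchmidtNormed_eq, gramSchmidtNormed_eq, gramSchmidt_congr j h]

lemma gramSchmidtNormed_update (x : Fin n → E) {l j : Fin n} (hl : l < j)
    (y : E) : gramSchmidtNormed ℝ (Function.update x j y) l = gramSchmidtNormed ℝ x l :=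
  gramSchmidtNormed_congr l fun _ hm => Function.update_of_ne (hm.trans_lt hl).ne _ _

lemma gramSchmidt_update_self (x : Fin n → E) (j : Fin n) (y : E) :
    gramSchmidt ℝ (Function.update x j y) j = residual (gramSchmidtNormed ℝ x) j y := by
  rw [gramSchmidt_eq_residual, Function.update_self]
  exact residual_congr (fun l hl => gramSchmidtNormed_update x hl y) y

/-- Gram-Schmidt uses only inner products and linear combinations, so it commutes with isometries.
-/
lemma gramSchmidt_map (f : E →ₗᵢ[ℝ] E) (x : Fin n → E) (j : Fin n) :
    gramSchmidt ℝ (fun i => f (x i)) j = f (gramSchmidt ℝ x j) := by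
  induction j using WellFoundedLT.induction with
  | ind j ih =>
    rw [gramSchmidt_eq_residual, gramSchmidt_eq_residual, residual, residual, map_sub, map_sum]
    congr 1
    refine Finset.sum_congr rfl fun l hl => ?_
    rw [gramSchmidtNormed_eq, gramSchmidtNormed_eq, ih l (Finset.mem_Iio.1 hl), f.norm_map,
      ← map_smul, f.inner_map_map, ← map_smul]

lemma gramSchmidtNormed_map (f : E →ₗᵢ[ℝ] E) (x : Fin n → E) (j : Fin n) :
    gramSchmidtNormed ℝ (fun i => f (x i)) j = f (gramSchmidtNormed ℝ x j) := by
  rw [gramSchmidtNormed_eq, gramSchmidtNormed_eq, gramSchmidt_map, f.norm_map, map_smul]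

variable [MeasurableSpace E] [BorelSpace E] [SecondCountableTopology E]

lemma measurable_gramSchmidt (j : Fin n) : Measurable fun x : Fin n → E => gramSchmidt ℝ x j := by
  induction j using WellFoundedLT.induction with
  | ind j ih =>
    simp_rw [gramSchmidt_eq_residual, residual]
    refine (measurable_pi_apply j).sub (Finset.measurable_sum _ fun l hl => ?_)
    have h1 : Measurable fun x : Fin n → E => gramSchmidtNormed ℝ x l := by
      have := ih l (Finset.mem_Iio.1 hl)
      simp_rw [gramSchmidtNormed_eq]
      exact (this.norm.inv).smul this
    exact (h1.inner (measurable_pi_apply j)).smul h1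

lemma measurable_gramSchmidtNormed :
    Measurable fun x : Fin n → E => gramSchmidtNormed ℝ x := by
  refine measurable_pi_lambda _ fun j => ?_
  have := measurable_gramSchmidt (E := E) j
  simp_rw [gramSchmidtNormed_eq]
  exact (this.norm.inv).smul this

lemma measurable_residual {α : Type*} [MeasurableSpace α] {u : α → Fin n → E} {w : α → E}
    (hu : Measurable u) (hw : Measurable w) (j : Fin n) :
    Measurable fun a => residual (u a) j (w a) := by
  simp_rw [residual]
  refine hw.sub (Finset.measurable_sum _ fun l _ => ?_)
  have := (measurable_pi_apply l).comp hu
  exact (this.inner hw).smul this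

end GramSchmidt

/-! ### Resampling one coordinate of a product measure, and the exponential supermartingale. -/

section Update

variable {n : ℕ} {X : Type*} [MeasurableSpace X] (γ : Measure X) [IsProbabilityMeasure γ]

lemma measurable_update_prod (j : Fin n) :
    Measurable fun p : (Fin n → X) × X => Function.update p.1 j p.2 := by
  refine measurable_pi_lambda _ fun i => ?_
  by_cases h : i = j
  · subst h; simpa using measurable_snd
  · simp only [Function.update_of_ne h]
    exact (measurable_pi_apply i).comp measurable_fst

/-- Resampling one coordinate preserves a product measure. -/
lemma measurePreserving_update (j : Fin n) :
    MeasurePreserving (fun p : (Fin n → X) × X => Function.update p.1 j p.2)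
      ((Measure.pi fun _ : Fin n => γ).prod γ) (Measure.pi fun _ : Fin n => γ) := by
  refine ⟨measurable_update_prod j, ?_⟩
  refine (Measure.pi_eq fun s hs => ?_).symm
  rw [Measure.map_apply (measurable_update_prod j) (MeasurableSet.univ_pi hs)]
  have h : (fun p : (Fin n → X) × X => Function.update p.1 j p.2) ⁻¹' (Set.univ.pi s) =
      (Set.univ.pi (Function.update s j Set.univ)) ×ˢ s j := by
    ext ⟨x, y⟩
    simp only [Set.mem_preimage, Set.mem_univ_pi, Set.mem_prod]
    constructor
    · intro h
      refine ⟨fun i => ?_, by simpa using h j⟩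
      by_cases hi : i = j
      · subst hi; simp
      · simpa [Function.update_of_ne hi] using h i
    · rintro ⟨h1, h2⟩ i
      by_cases hi : i = j
      · subst hi; simpa using h2
      · simpa [Function.update_of_ne hi] using h1 i
  rw [h, Measure.prod_prod, Measure.pi_pi, ← Finset.prod_erase_mul _ _ (Finset.mem_univ j),
    ← Finset.prod_erase_mul (a := j) Finset.univ (fun i => γ (s i)) (Finset.mem_univ j)]
  simp only [Function.update_self, measure_univ, mul_one]
  congr 1
  refine Finset.prod_congr rfl fun i hi => ?_
  rw [Function.update_of_ne (Finset.ne_of_mem_erase hi)]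

lemma lintegral_pi_eq_lintegral_update (j : Fin n) {f : (Fin n → X) → ℝ≥0∞} (hf : Measurable f) :
    ∫⁻ x, f x ∂(Measure.pi fun _ : Fin n => γ) =
      ∫⁻ x, ∫⁻ y, f (Function.update x j y) ∂γ ∂(Measure.pi fun _ : Fin n => γ) := by
  rw [← (measurePreserving_update γ j).lintegral_comp hf, lintegral_prod]
  exact (hf.comp (measurable_update_prod j)).aemeasurable

/-- A bound on the conditional probability of an event given all coordinates but one bounds its
probability. -/
lemma measureReal_pi_le_of_update (j : Fin n) {s : Set (Fin n → X)} (hs : MeasurableSet s) {c : ℝ}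
    (hc : 0 ≤ c) (h : ∀ x, γ.real {y | Function.update x j y ∈ s} ≤ c) :
    (Measure.pi fun _ : Fin n => γ).real s ≤ c := by
  refine ENNReal.toReal_le_of_le_ofReal hc ?_
  rw [← lintegral_indicator_one hs, lintegral_pi_eq_lintegral_update γ j
    (measurable_one.indicator hs)]
  calc _ ≤ ∫⁻ _x : Fin n → X, ENNReal.ofReal c ∂(Measure.pi fun _ : Fin n => γ) := by
        refine lintegral_mono fun x => ?_
        have h1 : (fun y => s.indicator (1 : (Fin n → X) → ℝ≥0∞) (Function.update x j y)) =
            {y | Function.update x j y ∈ s}.indicator 1 := by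
          ext y; rfl
        have hm : MeasurableSet {y | Function.update x j y ∈ s} :=
          (measurable_update_prod j).comp measurable_prodMk_left hs
        simp only
        rw [h1, lintegral_indicator_one hm]
        have := ENNReal.ofReal_le_ofReal (h x)
        rwa [Measure.real, ENNReal.ofReal_toReal (measure_ne_top _ _)] at this
    _ = ENNReal.ofReal c := by simp

/-- The exponential supermartingale inequality: if each increment `D j` depends only on the
coordinates up to `j` and its exponential moment given the coordinates before `j` is at most
`exp K`, then the sum over `t` increments has exponential moment at most `exp (t * K)`. -/
lemma lintegral_exp_sum_le (D : Fin n → (Fin n → X) → ℝ) (hD : ∀ j, Measurable (D j))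
    (hloc : ∀ i j : Fin n, i < j → ∀ x y, D i (Function.update x j y) = D i x) {K : ℝ}
    (hK : ∀ j x, ∫⁻ y, ENNReal.ofReal (Real.exp (D j (Function.update x j y))) ∂γ ≤
      ENNReal.ofReal (Real.exp K)) (t : ℕ) (ht : t ≤ n) :
    ∫⁻ x, ENNReal.ofReal (Real.exp (∑ j ∈ Finset.univ.filter (fun j : Fin n => (j : ℕ) < t), D j x))
      ∂(Measure.pi fun _ : Fin n => γ) ≤ ENNReal.ofReal (Real.exp (t * K)) := by
  induction t with
  | zero => simp
  | succ t ih =>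
    have hmeas : ∀ t : ℕ, Measurable fun x =>
        ENNReal.ofReal (Real.exp (∑ j ∈ Finset.univ.filter (fun j : Fin n => (j : ℕ) < t),
          D j x)) := fun t =>
      (Real.measurable_exp.comp (Finset.measurable_sum _ fun i _ => hD i)).ennreal_ofReal
    set j : Fin n := ⟨t, ht⟩
    have hset : (Finset.univ.filter fun i : Fin n => (i : ℕ) < t + 1) =
        insert j (Finset.univ.filter fun i : Fin n => (i : ℕ) < t) := by
      ext i
      simp only [Finset.mem_filter, Finset.mem_univ, true_and, Finset.mem_insert, Fin.ext_iff, j]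
      omega
    have hnot : j ∉ Finset.univ.filter fun i : Fin n => (i : ℕ) < t := by simp [j]
    rw [lintegral_pi_eq_lintegral_update γ j (hmeas (t + 1))]
    calc _ = ∫⁻ x, (ENNReal.ofReal (Real.exp (∑ i ∈ Finset.univ.filter
          (fun i : Fin n => (i : ℕ) < t), D i x)) *
          ∫⁻ y, ENNReal.ofReal (Real.exp (D j (Function.update x j y))) ∂γ)
            ∂(Measure.pi fun _ : Fin n => γ) := by
          refine lintegral_congr fun x => ?_
          have hmj : Measurable fun y => ENNReal.ofReal (Real.exp (D j (Function.update x j y))) :=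
            (Real.measurable_exp.comp ((hD j).comp
              ((measurable_update_prod j).comp measurable_prodMk_left))).ennreal_ofReal
          rw [← lintegral_const_mul _ hmj]
          refine lintegral_congr fun y => ?_
          rw [← ENNReal.ofReal_mul (Real.exp_pos _).le, ← Real.exp_add, hset,
            Finset.sum_insert hnot, add_comm]
          congr 3
          refine Finset.sum_congr rfl fun i hi => hloc i j ?_ x y
          simpa [Fin.lt_def, j] using hi
      _ ≤ ∫⁻ x, (ENNReal.ofReal (Real.exp (∑ i ∈ Finset.univ.filter
          (fun i : Fin n => (i : ℕ) < t), D i x)) *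
          ENNReal.ofReal (Real.exp K)) ∂(Measure.pi fun _ : Fin n => γ) := by
          refine lintegral_mono fun x => ?_
          gcongr
          exact hK j x
      _ = (∫⁻ x, ENNReal.ofReal (Real.exp (∑ i ∈ Finset.univ.filter
          (fun i : Fin n => (i : ℕ) < t), D i x))
            ∂(Measure.pi fun _ : Fin n => γ)) * ENNReal.ofReal (Real.exp K) := by
          rw [lintegral_mul_const _ (hmeas t)]
      _ ≤ ENNReal.ofReal (Real.exp (t * K)) * ENNReal.ofReal (Real.exp K) := by
          gcongr
          exact ih (by omega)
      _ = _ := by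
          rw [← ENNReal.ofReal_mul (Real.exp_pos _).le, ← Real.exp_add]
          push_cast
          ring_nf

end Update

end NodalCount
end

/-! ### Rows of a Haar orthogonal matrix as orthonormalized Gaussian vectors. -/

noncomputable section

namespace NodalCount

open InnerProductSpace

variable {n : ℕ}

/-- Euclidean space of dimension `n`. -/
abbrev Euc (n : ℕ) := EuclideanSpace ℝ (Fin n)

/-- The rows of a square matrix as Euclidean vectors. -/
def rows (A : Matrix (Fin n) (Fin n) ℝ) : Fin n → Euc n := fun i => WithLp.toLp 2 (A i)

/-- The product of the matrix with rows `u` and the matrix `A`. -/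
def mulFrame (u : Fin n → Euc n) (A : Matrix (Fin n) (Fin n) ℝ) : Fin n → Euc n :=
  fun i => WithLp.toLp 2 (Matrix.vecMul (u i) A)

@[simp] lemma rows_apply (A : Matrix (Fin n) (Fin n) ℝ) (i j : Fin n) : rows A i j = A i j := rfl

lemma rows_mul (A B : Matrix (Fin n) (Fin n) ℝ) : rows (A * B) = mulFrame (rows A) B := by
  ext i j
  simp [rows, mulFrame, Matrix.mul_apply_eq_vecMul]

lemma inner_rows (A : Matrix (Fin n) (Fin n) ℝ) (i j : Fin n) :
    inner ℝ (rows A i) (rows A j) = (A * A.transpose) i j := by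
  simp [PiLp.inner_apply, Matrix.mul_apply, mul_comm]

lemma exists_rows_eq {u : Fin n → Euc n} (hu : Orthonormal ℝ u) :
    ∃ Q : Matrix.orthogonalGroup (Fin n) ℝ, rows (Q : Matrix (Fin n) (Fin n) ℝ) = u := by
  refine ⟨⟨Matrix.of fun i j => u i j, ?_⟩, rfl⟩
  rw [Matrix.mem_orthogonalGroup_iff]
  ext i j
  rw [← inner_rows, Matrix.one_apply]
  exact (orthonormal_iff_ite.1 hu) i j

/-- Right multiplication of row vectors by an orthogonal matrix. -/
def mulRightIsometry (Q : Matrix.orthogonalGroup (Fin n) ℝ) : Euc n ≃ₗᵢ[ℝ] Euc n :=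
  LinearIsometry.toLinearIsometryEquiv (R₁ := ℝ)
    { toFun := fun x => WithLp.toLp 2 (Matrix.vecMul x (Q : Matrix (Fin n) (Fin n) ℝ))
      map_add' := fun x y => by ext i; simp [Matrix.add_vecMul]
      map_smul' := fun c x => by ext i; simp [Matrix.smul_vecMul]
      norm_map' := fun x => by
        have h := (Matrix.mem_orthogonalGroup_iff (Fin n) ℝ).1 Q.2
        have h2 : ∀ y : Euc n, ‖y‖ ^ 2 = dotProduct (y : Fin n → ℝ) y := fun y => by
          rw [EuclideanSpace.norm_sq_eq]
          simp [dotProduct, sq]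
        have h3 : ‖(WithLp.toLp 2 (Matrix.vecMul x (Q : Matrix (Fin n) (Fin n) ℝ)) : Euc n)‖ ^ 2
            = ‖x‖ ^ 2 := by
          rw [h2, h2]
          change dotProduct (Matrix.vecMul x (Q : Matrix (Fin n) (Fin n) ℝ))
            (Matrix.vecMul x (Q : Matrix (Fin n) (Fin n) ℝ)) = _
          rw [← Matrix.dotProduct_mulVec, ← Matrix.mulVec_transpose, Matrix.mulVec_mulVec, h,
            Matrix.one_mulVec]
        exact (sq_eq_sq₀ (norm_nonneg _) (norm_nonneg _)).1 h3 } rfl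

lemma mulFrame_eq (u : Fin n → Euc n) (Q : Matrix.orthogonalGroup (Fin n) ℝ) :
    mulFrame u (Q : Matrix (Fin n) (Fin n) ℝ) = fun i => mulRightIsometry Q (u i) := rfl

lemma gramSchmidtNormed_mulFrame (x : Fin n → Euc n) (Q : Matrix.orthogonalGroup (Fin n) ℝ) :
    gramSchmidtNormed ℝ (mulFrame x (Q : Matrix (Fin n) (Fin n) ℝ)) =
      mulFrame (gramSchmidtNormed ℝ x) (Q : Matrix (Fin n) (Fin n) ℝ) := by
  rw [mulFrame_eq, mulFrame_eq]
  ext1 j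
  exact gramSchmidtNormed_map (mulRightIsometry Q).toLinearIsometry x j

lemma measurable_rows :
    Measurable fun Q : Matrix.orthogonalGroup (Fin n) ℝ => rows (Q : Matrix (Fin n) (Fin n) ℝ) := by
  refine measurable_pi_lambda _ fun i => ?_
  refine (WithLp.measurable_toLp 2 _).comp (measurable_pi_lambda _ fun j => ?_)
  refine Continuous.measurable ?_
  exact (continuous_apply_apply i j).comp continuous_subtype_val

lemma measurable_mulFrame {α : Type*} [MeasurableSpace α] {u : α → Fin n → Euc n}
    {Q : α → Matrix.orthogonalGroup (Fin n) ℝ} (hu : Measurable u) (hQ : Measurable Q) :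
    Measurable fun a => mulFrame (u a) (Q a : Matrix (Fin n) (Fin n) ℝ) := by
  refine measurable_pi_lambda _ fun i => ?_
  refine (WithLp.measurable_toLp 2 _).comp (measurable_pi_lambda _ fun j => ?_)
  simp only [Matrix.vecMul, dotProduct]
  refine Finset.measurable_sum _ fun l _ => ?_
  have h1 : Measurable fun a => u a i l := by fun_prop
  have h2 : Measurable fun a => rows (Q a : Matrix (Fin n) (Fin n) ℝ) l j := by
    have h3 : Measurable fun u : Fin n → Euc n => u l j := by fun_prop
    exact h3.comp (measurable_rows.comp hQ)
  exact h1.mul h2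

/-- The law of `n` independent standard Gaussian vectors in dimension `n`. -/
abbrev gaussianRows (n : ℕ) : Measure (Fin n → Euc n) :=
  Measure.pi fun _ : Fin n => stdGaussian (Euc n)

lemma lintegral_gaussianRows_mulFrame (Q : Matrix.orthogonalGroup (Fin n) ℝ)
    {F : (Fin n → Euc n) → ℝ≥0∞} (hF : Measurable F) :
    ∫⁻ x, F (mulFrame x (Q : Matrix (Fin n) (Fin n) ℝ)) ∂gaussianRows n =
      ∫⁻ x, F x ∂gaussianRows n := by
  have h : MeasurePreserving (mulRightIsometry Q) (stdGaussian (Euc n)) (stdGaussian (Euc n)) :=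
    ⟨(mulRightIsometry Q).continuous.measurable, stdGaussian_map _⟩
  exact (measurePreserving_pi (fun _ : Fin n => stdGaussian (Euc n))
    (fun _ : Fin n => stdGaussian (Euc n)) (fun _ => h)).lintegral_comp hF

lemma exists_ne_zero_inner_eq_zero (u : Fin n → Euc n) (j : Fin n) :
    ∃ w : Euc n, w ≠ 0 ∧ ∀ l < j, inner ℝ (u l) w = (0 : ℝ) := by
  set K := Submodule.span ℝ (Set.range fun l : Finset.Iio j => u l) with hK
  have h1 : Module.finrank ℝ K ≤ j := by
    refine (finrank_range_le_card (R := ℝ) fun l : Finset.Iio j => u l).trans ?_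
    rw [Fintype.card_coe, Fin.card_Iio]
  have h2 : K ≠ ⊤ := by
    intro h
    rw [h, finrank_top, finrank_euclideanSpace, Fintype.card_fin] at h1
    exact absurd j.2 (by omega)
  have h3 : Kᗮ ≠ ⊥ := fun h => h2 (Submodule.orthogonal_eq_bot_iff.1 h)
  obtain ⟨w, hw, hw0⟩ := Submodule.exists_mem_ne_zero_of_ne_bot h3
  refine ⟨w, hw0, fun l hl => ?_⟩
  exact (Submodule.mem_orthogonal K w).1 hw (u l)
    (Submodule.subset_span ⟨⟨l, Finset.mem_Iio.2 hl⟩, rfl⟩)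

/-- There are fewer than `n` earlier rows, so some nonzero `w` is orthogonal to all of them. A
vanishing residual forces the fresh Gaussian vector to be orthogonal to `w`, a null event whatever
the other coordinates are. -/
lemma ae_gramSchmidt_ne_zero (j : Fin n) : ∀ᵐ x ∂gaussianRows n, gramSchmidt ℝ x j ≠ 0 := by
  have hs : MeasurableSet {x : Fin n → Euc n | gramSchmidt ℝ x j = 0} :=
    measurable_gramSchmidt j (measurableSet_singleton 0)
  have h := measureReal_pi_le_of_update (stdGaussian (Euc n)) j hs le_rfl fun x => by
    obtain ⟨w, hw0, hw⟩ := exists_ne_zero_inner_eq_zero (gramSchmidtNormed ℝ x) j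
    have hae := ae_inner_ne_zero hw0
    refine le_of_eq ?_
    rw [measureReal_eq_zero_iff]
    refine measure_mono_null (fun y hy => ?_) hae
    have h1 : residual (gramSchmidtNormed ℝ x) j y = 0 := by
      rw [← gramSchmidt_update_self]; exact hy
    have h2 : inner ℝ w (residual (gramSchmidtNormed ℝ x) j y) = (inner ℝ w y : ℝ) := by
      rw [residual, inner_sub_right, inner_sum, sub_eq_self]
      refine Finset.sum_eq_zero fun l hl => ?_
      rw [inner_smul_right, real_inner_comm (gramSchmidtNormed ℝ x l), hw l (Finset.mem_Iio.1 hl),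
        mul_zero]
    rw [h1, inner_zero_right] at h2
    simpa using h2.symm
  have h0 := le_antisymm h measureReal_nonneg
  rw [measureReal_eq_zero_iff] at h0
  exact measure_eq_zero_iff_ae_notMem.1 h0

lemma ae_orthonormal_gramSchmidtNormed :
    ∀ᵐ x ∂gaussianRows n, Orthonormal ℝ (gramSchmidtNormed ℝ x) := by
  filter_upwards [ae_all_iff.2 fun j : Fin n => ae_gramSchmidt_ne_zero j] with x hx
  refine ⟨fun i => ?_, fun i j hij => (isPartialFrame_gramSchmidtNormed x).inner_eq i j hij⟩
  rw [gramSchmidtNormed_eq, norm_smul, norm_inv, norm_norm,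
    inv_mul_cancel₀ (norm_ne_zero_iff.2 (hx i))]

/-- The `k`-th column of the matrix with rows `u`. -/
def column (u : Fin n → Euc n) (k : Fin n) : Euc n := WithLp.toLp 2 fun i => u i k

/-- The properties of the law of the rows of a Haar-distributed orthogonal matrix that determine
its finite-dimensional behaviour: it is the law of the Gram-Schmidt orthonormalization of
independent Gaussian vectors, it is exchangeable, and each column is uniform on the sphere. -/
structure IsHaarFrameLaw (ν : Measure (Fin n → Euc n)) : Prop where
  map_gramSchmidtNormed : (gaussianRows n).map (fun x => gramSchmidtNormed ℝ x) = ν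
  map_perm : ∀ π : Equiv.Perm (Fin n), ν.map (fun u => u ∘ π) = ν
  map_column : ∀ k, ν.map (fun u => column u k) =
    (stdGaussian (Euc n)).map (fun y => ‖y‖⁻¹ • y)
  map_row : ∀ k, ν.map (fun u => u k) = (stdGaussian (Euc n)).map (fun y => ‖y‖⁻¹ • y)

lemma rows_inv (R : Matrix.orthogonalGroup (Fin n) ℝ) :
    rows ((R⁻¹ : Matrix.orthogonalGroup (Fin n) ℝ) : Matrix (Fin n) (Fin n) ℝ) =
      fun k => column (rows (R : Matrix (Fin n) (Fin n) ℝ)) k := rfl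

lemma measurable_column (k : Fin n) : Measurable fun u : Fin n → Euc n => column u k :=
  (WithLp.measurable_toLp 2 _).comp (measurable_pi_lambda _ fun i => by fun_prop)

lemma map_eq_map_of_lintegral {α β γ : Type*} [MeasurableSpace α] [MeasurableSpace β]
    [MeasurableSpace γ] {μ : Measure α} {ν : Measure β} {f : α → γ} {g : β → γ}
    (hf : Measurable f) (hg : Measurable g)
    (h : ∀ F : γ → ℝ≥0∞, Measurable F → ∫⁻ a, F (f a) ∂μ = ∫⁻ b, F (g b) ∂ν) :
    μ.map f = ν.map g := by
  refine Measure.ext_of_lintegral _ fun F hF => ?_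
  rw [lintegral_map hF hf, lintegral_map hF hg, h F hF]

/-- A permutation matrix as an orthogonal matrix. -/
def permOrthogonal (π : Equiv.Perm (Fin n)) : Matrix.orthogonalGroup (Fin n) ℝ :=
  ⟨(1 : Matrix (Fin n) (Fin n) ℝ).submatrix π id, by
    rw [Matrix.mem_orthogonalGroup_iff]
    ext i j
    simp [Matrix.mul_apply, Matrix.one_apply]⟩

lemma rows_permOrthogonal_mul (π : Equiv.Perm (Fin n)) (A : Matrix (Fin n) (Fin n) ℝ) :
    mulFrame (rows (permOrthogonal π : Matrix (Fin n) (Fin n) ℝ)) A = rows A ∘ π := by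
  rw [← rows_mul]
  ext i j
  simp [permOrthogonal, Matrix.mul_apply, Matrix.one_apply]

section Haar

variable (μ : Measure (Matrix.orthogonalGroup (Fin n) ℝ))
  (hμ : ∀ Q : Matrix.orthogonalGroup (Fin n) ℝ, μ.map (fun R => Q * R) = μ)
include hμ

lemma lintegral_mul_left_orthogonalGroup (Q : Matrix.orthogonalGroup (Fin n) ℝ)
    {F : (Fin n → Euc n) → ℝ≥0∞} (hF : Measurable F) :
    ∫⁻ R, F (mulFrame (rows (Q : Matrix (Fin n) (Fin n) ℝ)) (R : Matrix (Fin n) (Fin n) ℝ)) ∂μ =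
      ∫⁻ R, F (rows (R : Matrix (Fin n) (Fin n) ℝ)) ∂μ := by
  conv_rhs => rw [← hμ Q]
  refine Eq.trans ?_ (lintegral_map (hF.comp measurable_rows) (measurable_const_mul Q)).symm
  simp_rw [← rows_mul]
  rfl

variable [IsProbabilityMeasure μ]

/-- Two invariances meet in a double integral. For almost every Gaussian `x` the orthonormalized
rows form an orthogonal matrix, which left invariance of `μ` can insert in front of `R`. After
exchanging the integrals, right multiplication by `R` commutes with Gram-Schmidt and is absorbed by
the rotation invariance of the Gaussian. -/
lemma lintegral_rows_eq_lintegral_gramSchmidtNormed {F : (Fin n → Euc n) → ℝ≥0∞}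
    (hF : Measurable F) :
    ∫⁻ R, F (rows (R : Matrix (Fin n) (Fin n) ℝ)) ∂μ =
      ∫⁻ x, F (gramSchmidtNormed ℝ x) ∂gaussianRows n := by
  calc ∫⁻ R, F (rows (R : Matrix (Fin n) (Fin n) ℝ)) ∂μ
      = ∫⁻ _x, ∫⁻ R, F (rows (R : Matrix (Fin n) (Fin n) ℝ)) ∂μ ∂gaussianRows n := by simp
    _ = ∫⁻ x, ∫⁻ R, F (mulFrame (gramSchmidtNormed ℝ x) (R : Matrix (Fin n) (Fin n) ℝ)) ∂μ
          ∂gaussianRows n := by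
        refine lintegral_congr_ae ?_
        filter_upwards [ae_orthonormal_gramSchmidtNormed] with x hx
        obtain ⟨Q, hQ⟩ := exists_rows_eq hx
        rw [← hQ, lintegral_mul_left_orthogonalGroup μ hμ Q hF]
    _ = ∫⁻ R, ∫⁻ x, F (mulFrame (gramSchmidtNormed ℝ x) (R : Matrix (Fin n) (Fin n) ℝ))
          ∂gaussianRows n ∂μ := by
        refine lintegral_lintegral_swap (Measurable.aemeasurable ?_)
        exact hF.comp (measurable_mulFrame (measurable_gramSchmidtNormed.comp measurable_fst)
          measurable_snd)
    _ = ∫⁻ _R, ∫⁻ x, F (gramSchmidtNormed ℝ x) ∂gaussianRows n ∂μ := by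
        refine lintegral_congr fun R => ?_
        simp_rw [← gramSchmidtNormed_mulFrame]
        exact lintegral_gaussianRows_mulFrame R (hF.comp measurable_gramSchmidtNormed)
    _ = _ := by simp

/-- Invariance under inversion follows from left invariance alone. Average over an independent `S`,
replace `R` by `S⁻¹ R`, whose inverse is `R⁻¹ S`, exchange the integrals, and let left invariance in
`S` absorb `R⁻¹`. -/
lemma lintegral_rows_inv {F : (Fin n → Euc n) → ℝ≥0∞} (hF : Measurable F) :
    ∫⁻ R, F (fun k => column (rows (R : Matrix (Fin n) (Fin n) ℝ)) k) ∂μ =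
      ∫⁻ R, F (rows (R : Matrix (Fin n) (Fin n) ℝ)) ∂μ := by
  have hcol : Measurable fun R : Matrix.orthogonalGroup (Fin n) ℝ =>
      fun k => column (rows (R : Matrix (Fin n) (Fin n) ℝ)) k :=
    measurable_pi_lambda _ fun k => (measurable_column k).comp measurable_rows
  calc ∫⁻ R, F (fun k => column (rows (R : Matrix (Fin n) (Fin n) ℝ)) k) ∂μ
      = ∫⁻ _S, ∫⁻ R, F (fun k => column (rows (R : Matrix (Fin n) (Fin n) ℝ)) k) ∂μ ∂μ := by simp
    _ = ∫⁻ S, ∫⁻ R, F (mulFrame (fun k => column (rows (R : Matrix (Fin n) (Fin n) ℝ)) k)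
          (S : Matrix (Fin n) (Fin n) ℝ)) ∂μ ∂μ := by
        refine lintegral_congr fun S => ?_
        conv_lhs => rw [← hμ S⁻¹]
        refine (lintegral_map (hF.comp hcol) (measurable_const_mul S⁻¹)).trans ?_
        refine lintegral_congr fun R => ?_
        change F (fun k => column (rows ((S⁻¹ * R : Matrix.orthogonalGroup (Fin n) ℝ) :
          Matrix (Fin n) (Fin n) ℝ)) k) = _
        rw [← rows_inv, ← rows_inv, ← rows_mul, mul_inv_rev, inv_inv]
        rfl
    _ = ∫⁻ R, ∫⁻ S, F (mulFrame (fun k => column (rows (R : Matrix (Fin n) (Fin n) ℝ)) k)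
          (S : Matrix (Fin n) (Fin n) ℝ)) ∂μ ∂μ := by
        refine lintegral_lintegral_swap (Measurable.aemeasurable ?_)
        exact hF.comp (measurable_mulFrame (hcol.comp measurable_snd) measurable_fst)
    _ = ∫⁻ _R, ∫⁻ S, F (rows (S : Matrix (Fin n) (Fin n) ℝ)) ∂μ ∂μ := by
        refine lintegral_congr fun R => ?_
        rw [← rows_inv]
        exact lintegral_mul_left_orthogonalGroup μ hμ R⁻¹ hF
    _ = _ := by simp

/-- Exchangeability is left multiplication by a permutation matrix. It reduces the law of any row to
that of row `0`, which Gram-Schmidt merely normalizes. Columns are rows of the inverse, hence have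
the same law. -/
lemma isHaarFrameLaw_map_rows :
    IsHaarFrameLaw (μ.map fun R : Matrix.orthogonalGroup (Fin n) ℝ =>
      rows (R : Matrix (Fin n) (Fin n) ℝ)) := by
  have hGS : (gaussianRows n).map (fun x => gramSchmidtNormed ℝ x) =
      μ.map fun R : Matrix.orthogonalGroup (Fin n) ℝ => rows (R : Matrix (Fin n) (Fin n) ℝ) :=
    map_eq_map_of_lintegral measurable_gramSchmidtNormed measurable_rows fun F hF =>
      (lintegral_rows_eq_lintegral_gramSchmidtNormed μ hμ hF).symm
  have hperm : ∀ π : Equiv.Perm (Fin n),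
      (μ.map fun R : Matrix.orthogonalGroup (Fin n) ℝ =>
        rows (R : Matrix (Fin n) (Fin n) ℝ)).map (fun u => u ∘ π) =
      μ.map fun R : Matrix.orthogonalGroup (Fin n) ℝ =>
        rows (R : Matrix (Fin n) (Fin n) ℝ) := fun π => by
    have hm : Measurable fun u : Fin n → Euc n => u ∘ π :=
      measurable_pi_lambda _ fun i => measurable_pi_apply _
    rw [Measure.map_map hm measurable_rows]
    refine map_eq_map_of_lintegral (hm.comp measurable_rows) measurable_rows fun F hF => ?_
    rw [← lintegral_mul_left_orthogonalGroup μ hμ (permOrthogonal π) hF]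
    simp_rw [rows_permOrthogonal_mul]
    rfl
  have hrow : ∀ k, (μ.map fun R : Matrix.orthogonalGroup (Fin n) ℝ =>
      rows (R : Matrix (Fin n) (Fin n) ℝ)).map (fun u => u k) =
      (stdGaussian (Euc n)).map (fun y => ‖y‖⁻¹ • y) := fun k => by
    have : NeZero n := ⟨(Fin.pos k).ne'⟩
    have hm : Measurable fun u : Fin n → Euc n => u ∘ (Equiv.swap 0 k) :=
      measurable_pi_lambda _ fun i => measurable_pi_apply _
    rw [← hperm (Equiv.swap 0 k), Measure.map_map (measurable_pi_apply k) hm]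
    have h1 : (fun u : Fin n → Euc n => u k) ∘ (fun u => u ∘ (Equiv.swap 0 k)) =
        fun u => u 0 := by ext1 u; simp
    have h0 : (fun u : Fin n → Euc n => u 0) ∘ (fun x => gramSchmidtNormed ℝ x) =
        (fun y => ‖y‖⁻¹ • y) ∘ (fun x => x 0) := by
      ext1 x
      have h2 : gramSchmidt ℝ x 0 = x 0 := by
        have : Finset.Iio (0 : Fin n) = ∅ := by
          ext i; simp
        rw [gramSchmidt_eq_residual, residual, this, Finset.sum_empty, sub_zero]
      simp only [Function.comp_apply, gramSchmidtNormed_eq, h2]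
    have hev := (measurePreserving_eval (fun _ : Fin n => stdGaussian (Euc n)) 0).map_eq
    conv_rhs => rw [← hev]
    rw [h1, ← hGS, Measure.map_map (measurable_pi_apply 0) measurable_gramSchmidtNormed, h0]
    exact (Measure.map_map (g := fun y : Euc n => ‖y‖⁻¹ • y) (by fun_prop)
      (measurable_pi_apply 0)).symm
  refine ⟨hGS, hperm, fun k => ?_, hrow⟩
  rw [← hrow k, Measure.map_map (measurable_column k) measurable_rows,
    Measure.map_map (measurable_pi_apply k) measurable_rows]
  refine map_eq_map_of_lintegral ((measurable_column k).comp measurable_rows)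
    ((measurable_pi_apply k).comp measurable_rows) fun F hF => ?_
  exact lintegral_rows_inv μ hμ (F := fun u => F (u k)) (hF.comp (measurable_pi_apply k))

end Haar

end NodalCount
end

/-! ### Diagonal multiplication and concentration for Gaussian vectors and Haar rows. -/

noncomputable section

namespace NodalCount

open InnerProductSpace

variable {n : ℕ}

/-- Multiplication by a diagonal matrix. -/
def diagMul (lam : Fin n → ℝ) (w : Euc n) : Euc n := WithLp.toLp 2 fun m => lam m * w m

@[simp] lemma diagMul_apply (lam : Fin n → ℝ) (w : Euc n) (m : Fin n) :
    diagMul lam w m = lam m * w m := rfl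

lemma inner_eq_sum (x y : Euc n) : (inner ℝ x y : ℝ) = ∑ m, x m * y m := by
  simp [PiLp.inner_apply, mul_comm]

lemma inner_diagMul (lam : Fin n → ℝ) (x y : Euc n) :
    (inner ℝ (diagMul lam x) y : ℝ) = ∑ m, lam m * x m * y m := by
  simp [inner_eq_sum]

lemma inner_diagMul_comm (lam : Fin n → ℝ) (x y : Euc n) :
    (inner ℝ (diagMul lam x) y : ℝ) = inner ℝ x (diagMul lam y) := by
  simp only [inner_eq_sum, diagMul_apply]
  exact Finset.sum_congr rfl fun m _ => by ring

lemma norm_diagMul_sq (lam : Fin n → ℝ) (x : Euc n) :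
    ‖diagMul lam x‖ ^ 2 = ∑ m, lam m ^ 2 * x m ^ 2 := by
  simp [EuclideanSpace.norm_sq_eq, mul_pow]

lemma norm_diagMul_le {lam : Fin n → ℝ} {L : ℝ} (hL : 0 ≤ L) (hlam : ∀ m, |lam m| ≤ L) (x : Euc n) :
    ‖diagMul lam x‖ ≤ L * ‖x‖ := by
  refine le_of_sq_le_sq ?_ (by positivity)
  rw [norm_diagMul_sq, mul_pow, EuclideanSpace.norm_sq_eq, Finset.mul_sum]
  refine Finset.sum_le_sum fun m _ => ?_
  rw [Real.norm_eq_abs, sq_abs, ← sq_abs (lam m)]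
  have := hlam m
  gcongr

lemma diagMul_smul (lam : Fin n → ℝ) (c : ℝ) (x : Euc n) :
    diagMul lam (c • x) = c • diagMul lam x := by
  ext m; simp; ring

@[fun_prop] lemma continuous_diagMul (lam : Fin n → ℝ) : Continuous (diagMul lam) := by
  unfold diagMul
  fun_prop

/-- The standard basis vectors. -/
abbrev basisVec (k : Fin n) : Euc n := EuclideanSpace.single k 1

lemma inner_basisVec (k : Fin n) (x : Euc n) : (inner ℝ (basisVec k) x : ℝ) = x k := by
  simp [basisVec, EuclideanSpace.inner_single_left]

section Gaussian

/-- The constant in the tail bounds below. -/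
def tailConst : ℝ := 4 + 2 * Real.exp expMomentConst

lemma tailConst_pos : 0 < tailConst := by unfold tailConst; positivity

/-- The common bound for the probability of a single exceptional event in dimension `n`. -/
def tailBound (n : ℕ) (L : ℝ) : ℝ := tailConst * (n + 1) * Real.exp (-L)

lemma tailBound_nonneg (n : ℕ) (L : ℝ) : 0 ≤ tailBound n L := by
  unfold tailBound; have := tailConst_pos; positivity

/-- Dividing `x^2 - 1` by `16` makes it fit the growth condition of the general tail bound; the
factor reappears in the threshold. -/
lemma measureReal_abs_weighted_sq_le {c : Fin n → ℝ} {R : ℝ} (hR : 0 < R) (hc : ∀ i, |c i| ≤ R)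
    (hn : 1 ≤ n) (L : ℝ) :
    (stdGaussian (Euc n)).real {y | 16 * (R * Real.sqrt n * L) ≤ |∑ i, c i * (y i ^ 2 - 1)|} ≤
      2 * Real.exp expMomentConst * Real.exp (-L) := by
  have h := measureReal_abs_sum_ge_le (ι := Fin n) (h := fun x => (x ^ 2 - 1) / 16) (by fun_prop)
    (fun x => by
      rw [abs_div, abs_of_pos (by norm_num : (0 : ℝ) < 16)]
      gcongr
      rw [abs_le]
      constructor <;> nlinarith [sq_nonneg x])
    (by
      rw [integral_div, integral_sub integrable_sq_stdGaussianReal (integrable_const _),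
        integral_sq_stdGaussianReal]
      simp) hR hc (N := n) (by exact_mod_cast hn) (by simp) L
  rw [sub_eq_add_neg, Real.exp_add, ← mul_assoc] at h
  refine (le_of_eq ?_).trans h
  congr 1
  ext y
  change _ ≤ |(_ : ℝ)| ↔ _ ≤ |(_ : ℝ)|
  have : ∑ i, c i * ((y i ^ 2 - 1) / 16) = (∑ i, c i * (y i ^ 2 - 1)) / 16 := by
    rw [Finset.sum_div]
    exact Finset.sum_congr rfl fun i _ => by ring
  rw [this, abs_div, abs_of_pos (by norm_num : (0 : ℝ) < 16), le_div_iff₀ (by norm_num)]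
  rw [mul_comm]

lemma sqrt_two_div_pi_le_one : Real.sqrt (2 / Real.pi) ≤ 1 := by
  refine Real.sqrt_le_one.2 ?_
  rw [div_le_one Real.pi_pos]
  linarith [Real.pi_gt_three]

lemma measureReal_abs_weighted_abs_le {c : Fin n → ℝ} (hc : ∀ i, |c i| ≤ 1)
    (hn : 1 ≤ n) (L : ℝ) :
    (stdGaussian (Euc n)).real
      {y | 16 * (Real.sqrt n * L) ≤ |∑ i, c i * (|y i| - Real.sqrt (2 / Real.pi))|} ≤
      2 * Real.exp expMomentConst * Real.exp (-L) := by
  have h1 := sqrt_two_div_pi_le_one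
  have h0 := Real.sqrt_nonneg (2 / Real.pi)
  have h := measureReal_abs_sum_ge_le (ι := Fin n)
    (h := fun x => (|x| - Real.sqrt (2 / Real.pi)) / 16) (by fun_prop)
    (fun x => by
      rw [abs_div, abs_of_pos (by norm_num : (0 : ℝ) < 16)]
      gcongr
      rw [abs_le, ← sq_abs]
      constructor <;> nlinarith [sq_nonneg (|x| - 1), abs_nonneg x])
    (by
      rw [integral_div, integral_sub integrable_id_stdGaussianReal.abs (integrable_const _),
        integral_abs_stdGaussianReal]
      simp) one_pos hc (N := n) (by exact_mod_cast hn) (by simp) L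
  rw [sub_eq_add_neg, Real.exp_add, ← mul_assoc] at h
  refine (le_of_eq ?_).trans h
  congr 1
  ext y
  change _ ≤ |(_ : ℝ)| ↔ _ ≤ |(_ : ℝ)|
  have : ∑ i, c i * ((|y i| - Real.sqrt (2 / Real.pi)) / 16) =
      (∑ i, c i * (|y i| - Real.sqrt (2 / Real.pi))) / 16 := by
    rw [Finset.sum_div]
    exact Finset.sum_congr rfl fun i _ => by ring
  rw [this, abs_div, abs_of_pos (by norm_num : (0 : ℝ) < 16), le_div_iff₀ (by norm_num), one_mul]
  rw [mul_comm]

lemma measureReal_abs_norm_sq_sub_le (hn : 1 ≤ n) (L : ℝ) :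
    (stdGaussian (Euc n)).real {y | 16 * (Real.sqrt n * L) ≤ |‖y‖ ^ 2 - n|} ≤
      2 * Real.exp expMomentConst * Real.exp (-L) := by
  have h := measureReal_abs_weighted_sq_le (n := n) (c := fun _ => 1) one_pos (by simp) hn L
  refine (le_of_eq ?_).trans h
  congr 1
  ext y
  change _ ≤ |(_ : ℝ)| ↔ _ ≤ |(_ : ℝ)|
  simp [EuclideanSpace.norm_sq_eq]

variable {ν : Measure (Fin n → Euc n)}

lemma IsHaarFrameLaw.isProbabilityMeasure (hν : IsHaarFrameLaw ν) : IsProbabilityMeasure ν := by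
  rw [← hν.map_gramSchmidtNormed]
  exact Measure.isProbabilityMeasure_map measurable_gramSchmidtNormed.aemeasurable

lemma measurableSet_orthonormal : MeasurableSet {u : Fin n → Euc n | Orthonormal ℝ u} := by
  have h : {u : Fin n → Euc n | Orthonormal ℝ u} =
      ⋂ i, ⋂ j, {u : Fin n → Euc n | (inner ℝ (u i) (u j) : ℝ) = if i = j then 1 else 0} := by
    ext u
    simp only [Set.mem_iInter]
    exact orthonormal_iff_ite
  rw [h]
  refine MeasurableSet.iInter fun i => MeasurableSet.iInter fun j => ?_
  exact measurableSet_eq_fun (by fun_prop) measurable_const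

lemma IsHaarFrameLaw.ae_orthonormal (hν : IsHaarFrameLaw ν) : ∀ᵐ u ∂ν, Orthonormal ℝ u := by
  rw [← hν.map_gramSchmidtNormed]
  refine (ae_map_iff measurable_gramSchmidtNormed.aemeasurable ?_).2
    ae_orthonormal_gramSchmidtNormed
  exact measurableSet_orthonormal

/-- With high probability a vector depending on the first rows of a Haar frame is nearly orthogonal
to the next row. -/
lemma IsHaarFrameLaw.measureReal_inner_gt_le (hν : IsHaarFrameLaw ν) {j : Fin n} {L : ℝ}
    (hL : 0 ≤ L) (hLn : 32 * L ≤ Real.sqrt n) (hj : (j : ℝ) * L ^ 2 ≤ n / 4)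
    {W : (Fin n → Euc n) → Euc n} (hW : Measurable W)
    (hloc : ∀ u u' : Fin n → Euc n, (∀ l < j, u l = u' l) → W u = W u') :
    ν.real {u | 2 * L / Real.sqrt n * ‖W u‖ < |inner ℝ (W u) (u j)|} ≤ tailBound n L := by
  have hn : 1 ≤ n := Fin.pos j
  have hn0 : (0 : ℝ) < n := by exact_mod_cast hn
  have hsn : 0 < Real.sqrt n := Real.sqrt_pos.2 hn0
  have hs : MeasurableSet {u : Fin n → Euc n |
      2 * L / Real.sqrt n * ‖W u‖ < |inner ℝ (W u) (u j)|} :=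
    measurableSet_lt (by fun_prop) (Measurable.abs (hW.inner (measurable_pi_apply j)))
  rw [← hν.map_gramSchmidtNormed, map_measureReal_apply measurable_gramSchmidtNormed hs]
  refine measureReal_pi_le_of_update (stdGaussian (Euc n)) j (measurable_gramSchmidtNormed hs)
    (tailBound_nonneg n L) fun x => ?_
  set u := gramSchmidtNormed ℝ x with hu
  have hfr : IsPartialFrame u := isPartialFrame_gramSchmidtNormed x
  set w := W u with hw
  -- With the other Gaussian vectors fixed, the new row is `r / ‖r‖` for `r` the residual of `y`,
  -- and `⟨w, r⟩ = ⟨residual w, y⟩`. The inner product can be large only if this numerator is large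
  -- or `‖r‖` is small. The latter requires an atypical `‖y‖` or a large component of `y` along an
  -- earlier row.
  have hsub : {y | Function.update x j y ∈ (fun x => gramSchmidtNormed ℝ x) ⁻¹'
      {u : Fin n → Euc n | 2 * L / Real.sqrt n * ‖W u‖ < |inner ℝ (W u) (u j)|}} ⊆
      ({y | L * ‖residual u j w‖ < |inner ℝ (residual u j w) y|} ∪
        {y | 16 * (Real.sqrt n * L) ≤ |‖y‖ ^ 2 - n|}) ∪
          ⋃ l ∈ Finset.Iio j, {y | L * ‖u l‖ < |inner ℝ (u l) y|} := by
    intro y hy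
    by_contra hcon
    simp only [Set.mem_union, Set.mem_iUnion, not_or, not_exists] at hcon
    obtain ⟨⟨h1, h2⟩, h3⟩ := hcon
    change ¬ _ < |(_ : ℝ)| at h1
    change ¬ _ ≤ |(_ : ℝ)| at h2
    have h3' : ∀ l < j, |inner ℝ (u l) y| ≤ L := fun l hl => by
      have := h3 l (Finset.mem_Iio.2 hl)
      change ¬ _ < |(_ : ℝ)| at this
      exact (not_lt.1 this).trans (mul_le_of_le_one_right hL (hfr.norm_le l))
    rw [not_lt] at h1
    rw [not_le] at h2
    change 2 * L / Real.sqrt n * ‖W (gramSchmidtNormed ℝ (Function.update x j y))‖ <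
      |inner ℝ (W (gramSchmidtNormed ℝ (Function.update x j y)))
        (gramSchmidtNormed ℝ (Function.update x j y) j)| at hy
    have hWe : W (gramSchmidtNormed ℝ (Function.update x j y)) = w :=
      hloc _ _ fun l hl => gramSchmidtNormed_update x hl y
    rw [hWe, gramSchmidtNormed_eq, gramSchmidt_update_self, ← hu, real_inner_smul_right,
      abs_mul, abs_inv, abs_norm, hfr.inner_residual_comm] at hy
    have hsq : Real.sqrt n * Real.sqrt n = n := Real.mul_self_sqrt hn0.le
    -- `‖r‖^2` is at least `n - 16 √n L - j L^2`. The hypotheses on `L` and `j` bound the two losses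
    -- by `n/2` and `n/4`.
    have hr : Real.sqrt n / 2 ≤ ‖residual u j y‖ := by
      refine le_of_sq_le_sq ?_ (norm_nonneg _)
      have h4 : ∑ l ∈ Finset.Iio j, (inner ℝ (u l) y : ℝ) ^ 2 ≤ j * L ^ 2 := by
        calc _ ≤ ∑ _l ∈ Finset.Iio j, L ^ 2 := Finset.sum_le_sum fun l hl => by
              rw [← sq_abs]
              have := h3' l (Finset.mem_Iio.1 hl)
              gcongr
          _ = _ := by simp
      rw [hfr.norm_residual_sq]
      have h5 := (abs_lt.1 h2).1
      nlinarith
    have hr0 : 0 < ‖residual u j y‖ := lt_of_lt_of_le (by positivity) hr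
    rw [← div_eq_inv_mul, lt_div_iff₀ hr0] at hy
    have h6 : 2 * L / Real.sqrt n * ‖w‖ * (Real.sqrt n / 2) = L * ‖w‖ := by field_simp
    have h7 : 2 * L / Real.sqrt n * ‖w‖ * (Real.sqrt n / 2) ≤
        2 * L / Real.sqrt n * ‖w‖ * ‖residual u j y‖ := by gcongr
    have h8 : L * ‖residual u j w‖ ≤ L * ‖w‖ := by
      have := hfr.norm_residual_le j w
      gcongr
    linarith
  refine (measureReal_mono hsub).trans ?_
  have hU : (stdGaussian (Euc n)).real
      (⋃ l ∈ Finset.Iio j, {y | L * ‖u l‖ < |inner ℝ (u l) y|}) ≤ j * (4 * Real.exp (-L)) := by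
    refine (measureReal_biUnion_finset_le _ _).trans ?_
    calc _ ≤ ∑ _l ∈ Finset.Iio j, 4 * Real.exp (-L) :=
          Finset.sum_le_sum fun l _ => measureReal_abs_inner_gt_le (u l) hL
      _ = _ := by simp
  have h1 := measureReal_union_le (μ := stdGaussian (Euc n))
    ({y | L * ‖residual u j w‖ < |inner ℝ (residual u j w) y|} ∪
        {y | 16 * (Real.sqrt n * L) ≤ |‖y‖ ^ 2 - n|})
    (⋃ l ∈ Finset.Iio j, {y | L * ‖u l‖ < |inner ℝ (u l) y|})
  have h2 := measureReal_union_le (μ := stdGaussian (Euc n))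
    {y | L * ‖residual u j w‖ < |inner ℝ (residual u j w) y|}
    {y | 16 * (Real.sqrt n * L) ≤ |‖y‖ ^ 2 - n|}
  have h3 := measureReal_abs_inner_gt_le (residual u j w) hL
  have h4 := measureReal_abs_norm_sq_sub_le hn L
  have hjn : (j : ℝ) ≤ n := by exact_mod_cast j.2.le
  have he := Real.exp_pos (-L)
  have hC := Real.exp_pos expMomentConst
  have h5 : tailBound n L = 4 * Real.exp (-L) + 2 * Real.exp expMomentConst * Real.exp (-L) +
      n * (4 * Real.exp (-L)) + n * (2 * Real.exp expMomentConst * Real.exp (-L)) := by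
    unfold tailBound tailConst; ring
  have h6 : (j : ℝ) * (4 * Real.exp (-L)) ≤ n * (4 * Real.exp (-L)) := by gcongr
  have h7 : 0 ≤ n * (2 * Real.exp expMomentConst * Real.exp (-L)) := by positivity
  linarith

lemma two_mul_le_tailBound (hn : 1 ≤ n) (L : ℝ) :
    2 * (2 * Real.exp expMomentConst * Real.exp (-L)) ≤ tailBound n L := by
  have he := Real.exp_pos (-L)
  have hC := Real.exp_pos expMomentConst
  have hn' : (1 : ℝ) ≤ n := by exact_mod_cast hn
  unfold tailBound tailConst
  have : 2 * (2 * Real.exp expMomentConst) ≤ (4 + 2 * Real.exp expMomentConst) * (n + 1) := by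
    nlinarith
  calc _ = 2 * (2 * Real.exp expMomentConst) * Real.exp (-L) := by ring
    _ ≤ _ := by gcongr

end Gaussian

/-! ### High-probability bounds for coordinates, entries, norms and column sums. -/

section Events

variable {ν : Measure (Fin n → Euc n)} {lam : Fin n → ℝ} {L : ℝ} {t : ℕ}

lemma IsHaarFrameLaw.measureReal_row (hν : IsHaarFrameLaw ν) (k : Fin n) {s : Set (Euc n)}
    (hs : MeasurableSet s) :
    ν.real {u | u k ∈ s} = (stdGaussian (Euc n)).real {y | ‖y‖⁻¹ • y ∈ s} := by
  have h1 := map_measureReal_apply (μ := ν) (measurable_pi_apply k) hs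
  have h2 := map_measureReal_apply (μ := stdGaussian (Euc n)) (f := fun y : Euc n => ‖y‖⁻¹ • y)
    (by fun_prop) hs
  rw [hν.map_row k] at h1
  exact h1.symm.trans h2

lemma IsHaarFrameLaw.measureReal_column (hν : IsHaarFrameLaw ν) (k : Fin n) {s : Set (Euc n)}
    (hs : MeasurableSet s) :
    ν.real {u | column u k ∈ s} = (stdGaussian (Euc n)).real {y | ‖y‖⁻¹ • y ∈ s} := by
  have h1 := map_measureReal_apply (μ := ν) (measurable_column k) hs
  have h2 := map_measureReal_apply (μ := stdGaussian (Euc n)) (f := fun y : Euc n => ‖y‖⁻¹ • y)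
    (by fun_prop) hs
  rw [hν.map_column k] at h1
  exact h1.symm.trans h2

lemma IsHaarFrameLaw.measureReal_perm (hν : IsHaarFrameLaw ν) (π : Equiv.Perm (Fin n))
    {s : Set (Fin n → Euc n)} (hs : MeasurableSet s) :
    ν.real {u | u ∘ π ∈ s} = ν.real s := by
  have h1 := map_measureReal_apply (μ := ν) (f := fun u => u ∘ π)
    (measurable_pi_lambda _ fun i => measurable_pi_apply _) hs
  rw [hν.map_perm π] at h1
  exact h1.symm

lemma IsHaarFrameLaw.ae_coord_ne_zero (hν : IsHaarFrameLaw ν) (k : Fin n) :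
    ∀ᵐ u ∂ν, ∀ i, u i k ≠ 0 := by
  have := hν.isProbabilityMeasure
  rw [ae_all_iff]
  intro i
  have hs : MeasurableSet {y : Euc n | y k = 0} :=
    measurableSet_eq_fun (by fun_prop) measurable_const
  have h := hν.measureReal_row i hs
  have h2 : (stdGaussian (Euc n)).real {y : Euc n | ‖y‖⁻¹ • y ∈ {y : Euc n | y k = 0}} = 0 := by
    rw [measureReal_eq_zero_iff]
    have hb : basisVec k ≠ (0 : Euc n) := by
      intro h
      have := congrArg (fun y : Euc n => y k) h
      simp [basisVec] at this
    refine measure_mono_null (fun y hy => ?_) (ae_inner_ne_zero hb)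
    have hy' : ‖y‖⁻¹ * y k = 0 := hy
    intro hne
    change inner ℝ (basisVec k) y ≠ (0 : ℝ) at hne
    rw [inner_basisVec] at hne
    rcases mul_eq_zero.1 hy' with h | h
    · rw [inv_eq_zero, norm_eq_zero] at h
      exact hne (by simp [h])
    · exact hne h
  rw [h2, measureReal_eq_zero_iff] at h
  exact measure_eq_zero_iff_ae_notMem.1 h

lemma IsHaarFrameLaw.measureReal_coord_gt_le (hν : IsHaarFrameLaw ν) {j : Fin n} (hL : 0 ≤ L)
    (hLn : 32 * L ≤ Real.sqrt n) (hj : (j : ℝ) * L ^ 2 ≤ n / 4) (k : Fin n) :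
    ν.real {u | 2 * L / Real.sqrt n < |u j k|} ≤ tailBound n L := by
  have h := hν.measureReal_inner_gt_le hL hLn hj (W := fun _ => basisVec k) measurable_const
    fun _ _ _ => rfl
  simpa [basisVec, EuclideanSpace.inner_single_left] using h

lemma measurable_entry (lam : Fin n → ℝ) (i j : Fin n) :
    Measurable fun u : Fin n → Euc n => (inner ℝ (diagMul lam (u i)) (u j) : ℝ) := by
  have := continuous_diagMul lam
  exact Continuous.measurable (by fun_prop)

lemma IsHaarFrameLaw.measureReal_entry_gt_le (hν : IsHaarFrameLaw ν) {l j : Fin n} (hlj : l < j)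
    (hL : 0 ≤ L) (hLn : 32 * L ≤ Real.sqrt n) (hj : (j : ℝ) * L ^ 2 ≤ n / 4)
    (hlam : ∀ m, |lam m| ≤ L) :
    ν.real {u | Orthonormal ℝ u ∧ 2 * L ^ 2 / Real.sqrt n < |inner ℝ (diagMul lam (u l)) (u j)|} ≤
      tailBound n L := by
  have := hν.isProbabilityMeasure
  have h := hν.measureReal_inner_gt_le hL hLn hj (W := fun u => diagMul lam (u l))
    ((continuous_diagMul lam).measurable.comp (measurable_pi_apply l))
    fun u u' h => by rw [h l hlj]
  refine (measureReal_mono ?_).trans h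
  rintro u ⟨hu, h1⟩
  refine lt_of_le_of_lt ?_ h1
  have h2 := norm_diagMul_le hL hlam (u l)
  rw [hu.1 l, mul_one] at h2
  calc 2 * L / Real.sqrt n * ‖diagMul lam (u l)‖ ≤ 2 * L / Real.sqrt n * L := by gcongr
    _ = _ := by ring

/-- A diagonal entry is `∑ λ_m y_m^2 / ‖y‖^2` for Gaussian `y`. Zero trace lets `y_m^2` be replaced
by `y_m^2 - 1`, so the numerator is a centred sum of order `√n`. -/
lemma IsHaarFrameLaw.measureReal_diag_gt_le (hν : IsHaarFrameLaw ν) (i : Fin n) (hL : 0 < L)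
    (hLn : 32 * L ≤ Real.sqrt n) (hlam : ∀ m, |lam m| ≤ L) (hsum : ∑ m, lam m = 0) :
    ν.real {u | 32 * L ^ 2 / Real.sqrt n < |inner ℝ (diagMul lam (u i)) (u i)|} ≤
      tailBound n L := by
  have hn : 1 ≤ n := Fin.pos i
  have hn0 : (0 : ℝ) < n := by exact_mod_cast hn
  have hsn : 0 < Real.sqrt n := Real.sqrt_pos.2 hn0
  have hsq : Real.sqrt n * Real.sqrt n = n := Real.mul_self_sqrt hn0.le
  have hs : MeasurableSet {y : Euc n | 32 * L ^ 2 / Real.sqrt n < |inner ℝ (diagMul lam y) y|} := by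
    refine measurableSet_lt measurable_const (Continuous.measurable ?_)
    have := continuous_diagMul lam
    fun_prop
  refine (hν.measureReal_row i hs).le.trans ?_
  refine le_trans ?_ (two_mul_le_tailBound hn L)
  have h1 := measureReal_abs_norm_sq_sub_le hn L
  have h2 := measureReal_abs_weighted_sq_le hL hlam hn L
  have hsub : {y : Euc n | ‖y‖⁻¹ • y ∈
      {y : Euc n | 32 * L ^ 2 / Real.sqrt n < |inner ℝ (diagMul lam y) y|}} ⊆
      {y | 16 * (Real.sqrt n * L) ≤ |‖y‖ ^ 2 - n|} ∪
        {y | 16 * (L * Real.sqrt n * L) ≤ |∑ i, lam i * (y i ^ 2 - 1)|} := by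
    intro y hy
    by_contra hcon
    simp only [Set.mem_union, not_or] at hcon
    obtain ⟨h3, h4⟩ := hcon
    change ¬ _ ≤ |(_ : ℝ)| at h3
    change ¬ _ ≤ |(_ : ℝ)| at h4
    rw [not_le] at h3 h4
    change 32 * L ^ 2 / Real.sqrt n < |inner ℝ (diagMul lam (‖y‖⁻¹ • y)) (‖y‖⁻¹ • y)| at hy
    have h5 : ∑ i, lam i * (y i ^ 2 - 1) = inner ℝ (diagMul lam y) y := by
      rw [inner_diagMul]
      simp_rw [mul_sub, mul_one]
      rw [Finset.sum_sub_distrib, hsum, sub_zero]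
      exact Finset.sum_congr rfl fun m _ => by ring
    rw [h5] at h4
    have h6 : n / 2 ≤ ‖y‖ ^ 2 := by
      have := (abs_lt.1 h3).1
      nlinarith
    have h7 : 0 < ‖y‖ ^ 2 := by linarith [half_pos hn0]
    rw [diagMul_smul, real_inner_smul_left, real_inner_smul_right, ← mul_assoc, abs_mul,
      abs_of_nonneg (by positivity), ← sq, inv_pow, ← div_eq_inv_mul, lt_div_iff₀ h7,
      div_mul_eq_mul_div, div_lt_iff₀ hsn] at hy
    have h8 : |inner ℝ (diagMul lam y) y| * Real.sqrt n ≤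
        16 * (L * Real.sqrt n * L) * Real.sqrt n := by gcongr
    have h9 : 32 * L ^ 2 * (n / 2) ≤ 32 * L ^ 2 * ‖y‖ ^ 2 := by gcongr
    have h10 : 16 * (L * Real.sqrt n * L) * Real.sqrt n = 32 * L ^ 2 * (n / 2) := by
      linear_combination 16 * L ^ 2 * hsq
    linarith
  have h3 := (measureReal_mono (μ := stdGaussian (Euc n)) hsub).trans
      (measureReal_union_le _ _)
  linarith

/-- Here the numerator `∑ λ_m^2 y_m^2` and the denominator `‖y‖^2` both concentrate at `n`, the
first because `∑ λ_m^2 = n`. -/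
lemma IsHaarFrameLaw.measureReal_norm_gt_le (hν : IsHaarFrameLaw ν) (i : Fin n) (hL : 1 ≤ L)
    (hLn : 32 * L ≤ Real.sqrt n) (hlam : ∀ m, |lam m| ≤ L) (hsum : ∑ m, lam m ^ 2 = n) :
    ν.real {u | 64 * L ^ 3 / Real.sqrt n < |‖diagMul lam (u i)‖ ^ 2 - 1|} ≤
      tailBound n L := by
  have hn : 1 ≤ n := Fin.pos i
  have hn0 : (0 : ℝ) < n := by exact_mod_cast hn
  have hsn : 0 < Real.sqrt n := Real.sqrt_pos.2 hn0
  have hsq : Real.sqrt n * Real.sqrt n = n := Real.mul_self_sqrt hn0.le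
  have hs : MeasurableSet {y : Euc n | 64 * L ^ 3 / Real.sqrt n < |‖diagMul lam y‖ ^ 2 - 1|} := by
    refine measurableSet_lt measurable_const (Continuous.measurable ?_)
    have := continuous_diagMul lam
    fun_prop
  refine (hν.measureReal_row i hs).le.trans ?_
  refine le_trans ?_ (two_mul_le_tailBound hn L)
  have h1 := measureReal_abs_norm_sq_sub_le hn L
  have h2 := measureReal_abs_weighted_sq_le (c := fun m => lam m ^ 2) (R := L ^ 2)
    (by positivity) (fun m => by rw [abs_pow]; have := hlam m; gcongr) hn L
  have hsub : {y : Euc n | ‖y‖⁻¹ • y ∈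
      {y : Euc n | 64 * L ^ 3 / Real.sqrt n < |‖diagMul lam y‖ ^ 2 - 1|}} ⊆
      {y | 16 * (Real.sqrt n * L) ≤ |‖y‖ ^ 2 - n|} ∪
        {y | 16 * (L ^ 2 * Real.sqrt n * L) ≤ |∑ i, lam i ^ 2 * (y i ^ 2 - 1)|} := by
    intro y hy
    by_contra hcon
    simp only [Set.mem_union, not_or] at hcon
    obtain ⟨h3, h4⟩ := hcon
    change ¬ _ ≤ |(_ : ℝ)| at h3
    change ¬ _ ≤ |(_ : ℝ)| at h4
    rw [not_le] at h3 h4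
    change 64 * L ^ 3 / Real.sqrt n < |‖diagMul lam (‖y‖⁻¹ • y)‖ ^ 2 - 1| at hy
    have h5 : ∑ i, lam i ^ 2 * (y i ^ 2 - 1) = ‖diagMul lam y‖ ^ 2 - n := by
      rw [norm_diagMul_sq]
      simp_rw [mul_sub, mul_one]
      rw [Finset.sum_sub_distrib, hsum]
    rw [h5] at h4
    have h6 : n / 2 ≤ ‖y‖ ^ 2 := by
      have := (abs_lt.1 h3).1
      nlinarith
    have h7 : 0 < ‖y‖ ^ 2 := by linarith [half_pos hn0]
    have h8 : ‖diagMul lam (‖y‖⁻¹ • y)‖ ^ 2 - 1 = (‖diagMul lam y‖ ^ 2 - ‖y‖ ^ 2) / ‖y‖ ^ 2 := by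
      rw [diagMul_smul, norm_smul, norm_inv, norm_norm, mul_pow, sub_div, div_self h7.ne', inv_pow,
        div_eq_inv_mul]
    rw [h8, abs_div, abs_of_pos h7, lt_div_iff₀ h7, div_mul_eq_mul_div, div_lt_iff₀ hsn] at hy
    have h9 : |‖diagMul lam y‖ ^ 2 - ‖y‖ ^ 2| ≤ 32 * L ^ 3 * Real.sqrt n := by
      have h10 := abs_sub_le (‖diagMul lam y‖ ^ 2) n (‖y‖ ^ 2)
      rw [abs_sub_comm (n : ℝ)] at h10
      have h11 : Real.sqrt n * L ≤ L ^ 3 * Real.sqrt n := by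
        have : L ≤ L ^ 3 := le_self_pow₀ hL (by norm_num)
        nlinarith
      nlinarith
    have h12 : |‖diagMul lam y‖ ^ 2 - ‖y‖ ^ 2| * Real.sqrt n ≤
        32 * L ^ 3 * Real.sqrt n * Real.sqrt n := by gcongr
    have h13 : 64 * L ^ 3 * (n / 2) ≤ 64 * L ^ 3 * ‖y‖ ^ 2 := by gcongr
    have h14 : 32 * L ^ 3 * Real.sqrt n * Real.sqrt n = 64 * L ^ 3 * (n / 2) := by
      linear_combination 32 * L ^ 3 * hsq
    linarith
  have h3 := (measureReal_mono (μ := stdGaussian (Euc n)) hsub).trans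
      (measureReal_union_le _ _)
  linarith

/-- A column is a normalized Gaussian vector: the partial sums of `|y i|` concentrate around `j
√(2/π)` and `‖y‖` is within `16 L` of `√n`. -/
lemma IsHaarFrameLaw.measureReal_sum_abs_gt_le (hν : IsHaarFrameLaw ν) (j k : Fin n) (hL : 1 ≤ L)
    (hLn : 32 * L ≤ Real.sqrt n) :
    ν.real {u | 64 * L < |∑ i ∈ Finset.Iio j, |u i k| -
      j * (Real.sqrt (2 / Real.pi) / Real.sqrt n)|} ≤ tailBound n L := by
  have hn : 1 ≤ n := Fin.pos j
  have hn0 : (0 : ℝ) < n := by exact_mod_cast hn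
  have hsn : 0 < Real.sqrt n := Real.sqrt_pos.2 hn0
  have hsq : Real.sqrt n * Real.sqrt n = n := Real.mul_self_sqrt hn0.le
  set a := Real.sqrt (2 / Real.pi) with ha
  have ha0 : 0 ≤ a := Real.sqrt_nonneg _
  have ha1 : a ≤ 1 := sqrt_two_div_pi_le_one
  have hs : MeasurableSet {y : Euc n | 64 * L < |∑ i ∈ Finset.Iio j, |y i| -
      j * (a / Real.sqrt n)|} := by
    refine measurableSet_lt measurable_const (Continuous.measurable ?_)
    fun_prop
  refine (hν.measureReal_column k hs).le.trans ?_
  refine le_trans ?_ (two_mul_le_tailBound hn L)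
  have h1 := measureReal_abs_norm_sq_sub_le hn L
  have h2 := measureReal_abs_weighted_abs_le (c := fun i => if i < j then 1 else 0)
    (fun i => by split_ifs <;> simp) hn L
  have hsub : {y : Euc n | ‖y‖⁻¹ • y ∈ {y : Euc n | 64 * L < |∑ i ∈ Finset.Iio j, |y i| -
      j * (a / Real.sqrt n)|}} ⊆
      {y | 16 * (Real.sqrt n * L) ≤ |‖y‖ ^ 2 - n|} ∪
        {y | 16 * (Real.sqrt n * L) ≤ |∑ i, (if i < j then 1 else 0) * (|y i| - a)|} := by
    intro y hy
    by_contra hcon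
    simp only [Set.mem_union, not_or] at hcon
    obtain ⟨h3, h4⟩ := hcon
    change ¬ _ ≤ |(_ : ℝ)| at h3
    change ¬ _ ≤ |(_ : ℝ)| at h4
    rw [not_le] at h3 h4
    change 64 * L < |∑ i ∈ Finset.Iio j, |‖y‖⁻¹ * y i| - j * (a / Real.sqrt n)| at hy
    set S := ∑ i ∈ Finset.Iio j, |y i| with hS
    have h5 : ∑ i, (if i < j then 1 else 0) * (|y i| - a) = S - j * a := by
      simp_rw [ite_mul, one_mul, zero_mul]
      rw [← Finset.sum_filter]
      have : Finset.univ.filter (fun i : Fin n => i < j) = Finset.Iio j := by ext; simp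
      rw [this, Finset.sum_sub_distrib]
      simp [hS]
    rw [h5] at h4
    have h6 : n / 2 ≤ ‖y‖ ^ 2 := by
      have := (abs_lt.1 h3).1
      nlinarith
    have h7 : Real.sqrt n / 2 ≤ ‖y‖ := by
      refine le_of_sq_le_sq ?_ (norm_nonneg _)
      nlinarith
    have h8 : 0 < ‖y‖ := lt_of_lt_of_le (by positivity) h7
    have h9 : |‖y‖ - Real.sqrt n| ≤ 16 * L := by
      have e1 : ‖y‖ ^ 2 - n = (‖y‖ - Real.sqrt n) * (‖y‖ + Real.sqrt n) := by
        linear_combination hsq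
      rw [e1, abs_mul, abs_of_pos (by positivity : 0 < ‖y‖ + Real.sqrt n)] at h3
      have e2 : |‖y‖ - Real.sqrt n| * Real.sqrt n ≤ 16 * L * Real.sqrt n := by
        nlinarith [abs_nonneg (‖y‖ - Real.sqrt n)]
      exact le_of_mul_le_mul_right e2 hsn
    have h10 : ∑ i ∈ Finset.Iio j, |‖y‖⁻¹ * y i| = S / ‖y‖ := by
      rw [hS, Finset.sum_div]
      refine Finset.sum_congr rfl fun i _ => ?_
      rw [abs_mul, abs_inv, abs_norm]
      ring
    have h11 : S / ‖y‖ - j * (a / Real.sqrt n) =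
        ((S - j * a) * Real.sqrt n - j * a * (‖y‖ - Real.sqrt n)) / (‖y‖ * Real.sqrt n) := by
      field_simp
      ring
    rw [h10, h11, abs_div, abs_of_pos (by positivity : 0 < ‖y‖ * Real.sqrt n),
      lt_div_iff₀ (by positivity)] at hy
    have hjn : (j : ℝ) ≤ n := by exact_mod_cast j.2.le
    have h12 : |(S - j * a) * Real.sqrt n - j * a * (‖y‖ - Real.sqrt n)| ≤
        16 * (Real.sqrt n * L) * Real.sqrt n + n * 1 * (16 * L) := by
      refine (abs_sub _ _).trans ?_
      rw [abs_mul, abs_mul, abs_of_pos hsn, abs_of_nonneg (by positivity : 0 ≤ (j : ℝ) * a)]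
      gcongr
    have h13 : 64 * L * (Real.sqrt n / 2 * Real.sqrt n) ≤ 64 * L * (‖y‖ * Real.sqrt n) := by gcongr
    have h14 : 16 * (Real.sqrt n * L) * Real.sqrt n = n * 1 * (16 * L) := by
      linear_combination 16 * L * hsq
    have h15 : 64 * L * (Real.sqrt n / 2 * Real.sqrt n) = 32 * L * n := by
      linear_combination 32 * L * hsq
    linarith
  have h3 := (measureReal_mono (μ := stdGaussian (Euc n)) hsub).trans
      (measureReal_union_le _ _)
  linarith

end Events

end NodalCount
end

/-! ### Good frames: all deterministic inputs hold simultaneously with high probability. -/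

noncomputable section

namespace NodalCount

open InnerProductSpace

variable {n : ℕ}

/-- The `(i, j)` entry of the matrix with eigenvalues `lam` whose eigenvectors are the columns of
the matrix with rows `u`. -/
def entry (lam : Fin n → ℝ) (u : Fin n → Euc n) (i j : Fin n) : ℝ :=
  inner ℝ (diagMul lam (u i)) (u j)

lemma entry_comm (lam : Fin n → ℝ) (u : Fin n → Euc n) (i j : Fin n) :
    entry lam u i j = entry lam u j i := by
  rw [entry, entry, inner_diagMul_comm, real_inner_comm]

/-- The deterministic properties of the first `t` rows of a Haar frame used below. -/
structure IsGoodFrame (lam : Fin n → ℝ) (k : Fin n) (L : ℝ) (t : ℕ) (u : Fin n → Euc n) :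
    Prop where
  orthonormal : Orthonormal ℝ u
  coord_ne_zero : ∀ i, u i k ≠ 0
  coord_le : ∀ i : Fin n, (i : ℕ) < t → |u i k| ≤ 2 * L / Real.sqrt n
  entry_le : ∀ i l : Fin n, (i : ℕ) < t → (l : ℕ) < t → |entry lam u i l| ≤ 32 * L ^ 2 / Real.sqrt n
  norm_le : ∀ i : Fin n, (i : ℕ) < t → |‖diagMul lam (u i)‖ ^ 2 - 1| ≤ 64 * L ^ 3 / Real.sqrt n
  cross_le : ∀ i a : Fin n, i ≤ a → (a : ℕ) < t →
    |∑ l ∈ (Finset.Iic a).erase i, u l k * entry lam u i l| ≤ 4 * L ^ 3 * Real.sqrt t / n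
  sum_le : ∀ j : Fin n, (j : ℕ) < t → |∑ i ∈ Finset.Iio j, |u i k| -
    j * (Real.sqrt (2 / Real.pi) / Real.sqrt n)| ≤ 64 * L

variable {ν : Measure (Fin n → Euc n)} {lam : Fin n → ℝ} {L : ℝ} {t : ℕ} {k : Fin n}

/-- The combination of the rows before `a` weighted by their `k`-th coordinates. -/
def partialColumn (k a : Fin n) (u : Fin n → Euc n) : Euc n := ∑ l ∈ Finset.Iio a, u l k • u l

lemma norm_partialColumn_sq {u : Fin n → Euc n} (hu : Orthonormal ℝ u) (a : Fin n) :
    ‖partialColumn k a u‖ ^ 2 = ∑ l ∈ Finset.Iio a, (u l k) ^ 2 := by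
  rw [← real_inner_self_eq_norm_sq, partialColumn, hu.inner_sum]
  simp [sq]

/-- The exceptional event that the `a`-th row correlates with the image of the earlier rows. -/
def crossEvent (lam : Fin n → ℝ) (k a : Fin n) (L : ℝ) : Set (Fin n → Euc n) :=
  {u | 2 * L / Real.sqrt n * ‖diagMul lam (partialColumn k a u)‖ <
    |inner ℝ (diagMul lam (partialColumn k a u)) (u a)|}

lemma measurable_partialColumn (k a : Fin n) :
    Measurable fun u : Fin n → Euc n => diagMul lam (partialColumn k a u) := by
  have := continuous_diagMul lam
  refine Continuous.measurable ?_
  unfold partialColumn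
  fun_prop

lemma measurableSet_crossEvent (k a : Fin n) : MeasurableSet (crossEvent lam k a L) := by
  have := measurable_partialColumn (lam := lam) k a
  exact measurableSet_lt (by fun_prop) (Measurable.abs (this.inner (measurable_pi_apply a)))

lemma IsHaarFrameLaw.measureReal_crossEvent_le (hν : IsHaarFrameLaw ν) {a : Fin n} (hL : 0 ≤ L)
    (hLn : 32 * L ≤ Real.sqrt n) (ha : (a : ℝ) * L ^ 2 ≤ n / 4) :
    ν.real (crossEvent lam k a L) ≤ tailBound n L := by
  refine hν.measureReal_inner_gt_le hL hLn ha (measurable_partialColumn k a) fun u u' h => ?_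
  unfold partialColumn
  congr 1
  exact Finset.sum_congr rfl fun l hl => by rw [h l (Finset.mem_Iio.1 hl)]

/-- The cross sum for row `i` involves rows on both sides of `i`, so it is not adapted to the order
of construction. Swapping `i` with `a` puts row `i` last, after every row it is tested against. The
near-orthogonality of a new row to a vector built from earlier rows then applies. -/
lemma inner_diagMul_partialColumn_swap (u : Fin n → Euc n) {i a : Fin n} (hia : i ≤ a) :
    (inner ℝ (diagMul lam (partialColumn k a (u ∘ Equiv.swap i a))) ((u ∘ Equiv.swap i a) a) : ℝ) =
      ∑ l ∈ (Finset.Iic a).erase i, u l k * entry lam u i l := by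
  rw [inner_diagMul_comm, partialColumn, sum_inner]
  refine Finset.sum_bij' (fun l _ => Equiv.swap i a l) (fun l _ => Equiv.swap i a l) ?_ ?_ ?_ ?_ ?_
  · intro l hl
    rw [Finset.mem_Iio] at hl
    rw [Finset.mem_erase, Finset.mem_Iic]
    by_cases h : l = i
    · subst h
      rw [Equiv.swap_apply_left]
      exact ⟨hl.ne', le_rfl⟩
    · rw [Equiv.swap_apply_of_ne_of_ne h hl.ne]
      exact ⟨h, hl.le⟩
  · intro l hl
    rw [Finset.mem_erase, Finset.mem_Iic] at hl
    rw [Finset.mem_Iio]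
    by_cases h : l = a
    · subst h
      rw [Equiv.swap_apply_right]
      exact lt_of_le_of_ne hia hl.1.symm
    · rw [Equiv.swap_apply_of_ne_of_ne hl.1 h]
      exact lt_of_le_of_ne hl.2 h
  · intro l _; simp
  · intro l _; simp
  · intro l _
    simp only [Function.comp_apply, Equiv.swap_apply_right]
    rw [real_inner_smul_left, entry, real_inner_comm]

/-- By orthonormality the partial column has squared norm at most `t (2L/√n)^2`; `D` costs a factor
`L` and the near-orthogonality a factor `2L/√n`. -/
lemma abs_cross_le_of_notMem {u : Fin n → Euc n} (hu : Orthonormal ℝ u) (hL : 0 < L)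
    (hlam : ∀ m, |lam m| ≤ L)
    (hc : ∀ i : Fin n, (i : ℕ) < t → |u i k| ≤ 2 * L / Real.sqrt n) {i a : Fin n} (hia : i ≤ a)
    (ha : (a : ℕ) < t) (h : u ∘ Equiv.swap i a ∉ crossEvent lam k a L) :
    |∑ l ∈ (Finset.Iic a).erase i, u l k * entry lam u i l| ≤ 4 * L ^ 3 * Real.sqrt t / n := by
  have hn0 : (0 : ℝ) < n := by exact_mod_cast Fin.pos a
  have hsn : 0 < Real.sqrt n := Real.sqrt_pos.2 hn0
  have hsq : Real.sqrt n * Real.sqrt n = n := Real.mul_self_sqrt hn0.le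
  have h1 : ¬ _ < |(_ : ℝ)| := h
  rw [not_lt, inner_diagMul_partialColumn_swap u hia] at h1
  refine h1.trans ?_
  have hu' : Orthonormal ℝ (u ∘ Equiv.swap i a) := hu.comp _ (Equiv.injective _)
  have h2 : ‖partialColumn k a (u ∘ Equiv.swap i a)‖ ≤ Real.sqrt t * (2 * L / Real.sqrt n) := by
    refine le_of_sq_le_sq ?_ (by positivity)
    rw [norm_partialColumn_sq hu', mul_pow, Real.sq_sqrt (by positivity)]
    calc ∑ l ∈ Finset.Iio a, ((u ∘ Equiv.swap i a) l k) ^ 2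
        ≤ ∑ _l ∈ Finset.Iio a, (2 * L / Real.sqrt n) ^ 2 := by
          refine Finset.sum_le_sum fun l hl => ?_
          rw [Finset.mem_Iio] at hl
          rw [← sq_abs]
          have h3 : |(u ∘ Equiv.swap i a) l k| ≤ 2 * L / Real.sqrt n := by
            refine hc _ ?_
            by_cases h : l = i
            · subst h; rwa [Equiv.swap_apply_left]
            · rw [Equiv.swap_apply_of_ne_of_ne h hl.ne]
              exact lt_trans hl ha
          gcongr
      _ = (a : ℝ) * (2 * L / Real.sqrt n) ^ 2 := by simp
      _ ≤ _ := by
          gcongr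
  calc 2 * L / Real.sqrt n * ‖diagMul lam (partialColumn k a (u ∘ Equiv.swap i a))‖
      ≤ 2 * L / Real.sqrt n * (L * (Real.sqrt t * (2 * L / Real.sqrt n))) := by
        have := norm_diagMul_le hL.le hlam (partialColumn k a (u ∘ Equiv.swap i a))
        gcongr
        exact this.trans (by gcongr)
    _ = 4 * L ^ 3 * Real.sqrt t / (Real.sqrt n * Real.sqrt n) := by
        field_simp
        ring
    _ = _ := by rw [hsq]

lemma measureReal_iUnion_fin_le {α : Type*} [MeasurableSpace α] {μ : Measure α}
    [IsFiniteMeasure μ] {s : Fin n → Set α} {c : ℝ} (h : ∀ i, μ.real (s i) ≤ c) :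
    μ.real (⋃ i, s i) ≤ n * c := by
  have h1 : (⋃ i, s i) = ⋃ i ∈ (Finset.univ : Finset (Fin n)), s i := by simp
  rw [h1]
  refine (measureReal_biUnion_finset_le _ _).trans ?_
  calc _ ≤ ∑ _i : Fin n, c := Finset.sum_le_sum fun i _ => h i
    _ = _ := by simp

lemma measureReal_setOf_and_le {α : Type*} [MeasurableSpace α] {μ : Measure α}
    [IsFiniteMeasure μ] {p : Prop} {q : α → Prop} {c : ℝ} (hc : 0 ≤ c)
    (h : p → μ.real {a | q a} ≤ c) : μ.real {a | p ∧ q a} ≤ c := by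
  by_cases hp : p
  · simpa [hp] using h hp
  · simpa [hp] using hc

/-- The first rows of a Haar frame are good with high probability. -/
lemma IsHaarFrameLaw.measureReal_not_isGoodFrame_le (hν : IsHaarFrameLaw ν) (hL : 1 ≤ L)
    (hLn : 32 * L ≤ Real.sqrt n) (ht : (t : ℝ) * L ^ 2 ≤ n / 4)
    (hlam : ∀ m, |lam m| ≤ L) (hsum : ∑ m, lam m = 0) (hsum2 : ∑ m, lam m ^ 2 = n) (k : Fin n) :
    ν.real {u | ¬ IsGoodFrame lam k L t u} ≤ 6 * n ^ 2 * tailBound n L := by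
  have := hν.isProbabilityMeasure
  have hL0 : 0 < L := by linarith
  have hn : 1 ≤ n := Fin.pos k
  have hn1 : (1 : ℝ) ≤ n := by exact_mod_cast hn
  have hsn : 0 < Real.sqrt n := Real.sqrt_pos.2 (by linarith)
  set β := tailBound n L with hβ
  have hβ0 : 0 ≤ β := tailBound_nonneg n L
  have hjt : ∀ j : Fin n, (j : ℕ) < t → (j : ℝ) * L ^ 2 ≤ n / 4 := fun j hj => by
    refine le_trans ?_ ht
    gcongr
  set N : Set (Fin n → Euc n) := {u | ¬ (Orthonormal ℝ u ∧ ∀ i, u i k ≠ 0)} with hN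
  set B1 : Fin n → Set (Fin n → Euc n) :=
    fun i => {u | (i : ℕ) < t ∧ 2 * L / Real.sqrt n < |u i k|} with hB1
  set B2 : Fin n → Fin n → Set (Fin n → Euc n) := fun i l => {u | ((i : ℕ) < t ∧ l < i) ∧
    (Orthonormal ℝ u ∧ 2 * L ^ 2 / Real.sqrt n < |inner ℝ (diagMul lam (u l)) (u i)|)} with hB2
  set B3 : Fin n → Set (Fin n → Euc n) := fun i =>
    {u | 32 * L ^ 2 / Real.sqrt n < |inner ℝ (diagMul lam (u i)) (u i)|} with hB3
  set B4 : Fin n → Set (Fin n → Euc n) := fun i =>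
    {u | 64 * L ^ 3 / Real.sqrt n < |‖diagMul lam (u i)‖ ^ 2 - 1|} with hB4
  set B5 : Fin n → Fin n → Set (Fin n → Euc n) := fun i a =>
    {u | (a : ℕ) < t ∧ u ∘ Equiv.swap i a ∈ crossEvent lam k a L} with hB5
  set B6 : Fin n → Set (Fin n → Euc n) := fun j =>
    {u | 64 * L < |∑ i ∈ Finset.Iio j, |u i k| -
      j * (Real.sqrt (2 / Real.pi) / Real.sqrt n)|} with hB6
  have m0 : ν.real N = 0 := by
    rw [measureReal_eq_zero_iff]
    exact (hν.ae_orthonormal.and (hν.ae_coord_ne_zero k))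
  have m1 : ν.real (⋃ i, B1 i) ≤ n * β := measureReal_iUnion_fin_le fun i =>
    measureReal_setOf_and_le hβ0 fun hi => hν.measureReal_coord_gt_le hL0.le hLn (hjt i hi) k
  have m2 : ν.real (⋃ i, ⋃ l, B2 i l) ≤ n * (n * β) := measureReal_iUnion_fin_le fun i =>
    measureReal_iUnion_fin_le fun l => measureReal_setOf_and_le hβ0 fun hi =>
      hν.measureReal_entry_gt_le hi.2 hL0.le hLn (hjt i hi.1) hlam
  have m3 : ν.real (⋃ i, B3 i) ≤ n * β := measureReal_iUnion_fin_le fun i =>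
    hν.measureReal_diag_gt_le i hL0 hLn hlam hsum
  have m4 : ν.real (⋃ i, B4 i) ≤ n * β := measureReal_iUnion_fin_le fun i =>
    hν.measureReal_norm_gt_le i hL hLn hlam hsum2
  have m5 : ν.real (⋃ i, ⋃ a, B5 i a) ≤ n * (n * β) := measureReal_iUnion_fin_le fun i =>
    measureReal_iUnion_fin_le fun a => measureReal_setOf_and_le hβ0 fun ha => by
      -- Exchangeability gives the event for the swapped frame the same probability as for the
      -- original one.
      have h1 := hν.measureReal_perm (Equiv.swap i a)
        (measurableSet_crossEvent (lam := lam) (L := L) k a)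
      exact h1.le.trans (hν.measureReal_crossEvent_le hL0.le hLn (hjt a ha))
  have m6 : ν.real (⋃ j, B6 j) ≤ n * β := measureReal_iUnion_fin_le fun j =>
    hν.measureReal_sum_abs_gt_le j k hL hLn
  have hsub : {u | ¬ IsGoodFrame lam k L t u} ⊆ N ∪ ((⋃ i, B1 i) ∪ ((⋃ i, ⋃ l, B2 i l) ∪
      ((⋃ i, B3 i) ∪ ((⋃ i, B4 i) ∪ ((⋃ i, ⋃ a, B5 i a) ∪ ⋃ j, B6 j))))) := by
    intro u hu
    by_contra hcon
    simp only [Set.mem_union, Set.mem_iUnion, not_or, not_exists] at hcon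
    obtain ⟨c0, c1, c2, c3, c4, c5, c6⟩ := hcon
    have c0' : Orthonormal ℝ u ∧ ∀ i, u i k ≠ 0 := not_not.1 c0
    obtain ⟨ho, hne⟩ := c0'
    have c1' : ∀ i : Fin n, (i : ℕ) < t → |u i k| ≤ 2 * L / Real.sqrt n := fun i hi =>
      not_lt.1 fun h => c1 i ⟨hi, h⟩
    have c2' : ∀ i l : Fin n, (i : ℕ) < t → l < i → |entry lam u l i| ≤ 32 * L ^ 2 / Real.sqrt n :=
      fun i l hi hl => by
        have : |entry lam u l i| ≤ 2 * L ^ 2 / Real.sqrt n :=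
          not_lt.1 fun h => c2 i l ⟨⟨hi, hl⟩, ho, h⟩
        refine this.trans ?_
        gcongr
        norm_num
    refine hu ⟨ho, hne, c1', fun i l hi hl => ?_, fun i _ => not_lt.1 (c4 i), fun i a hia ha => ?_,
      fun j _ => not_lt.1 (c6 j)⟩
    · rcases lt_trichotomy i l with h | h | h
      · exact c2' l i hl h
      · subst h; exact not_lt.1 (c3 i)
      · rw [entry_comm]; exact c2' i l hi h
    · exact abs_cross_le_of_notMem ho hL0 hlam c1' hia ha fun h => c5 i a ⟨ha, h⟩
  have h := measureReal_mono (μ := ν) hsub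
  have u0 := measureReal_union_le (μ := ν) N ((⋃ i, B1 i) ∪ ((⋃ i, ⋃ l, B2 i l) ∪
      ((⋃ i, B3 i) ∪ ((⋃ i, B4 i) ∪ ((⋃ i, ⋃ a, B5 i a) ∪ ⋃ j, B6 j)))))
  have u1 := measureReal_union_le (μ := ν) (⋃ i, B1 i) ((⋃ i, ⋃ l, B2 i l) ∪
      ((⋃ i, B3 i) ∪ ((⋃ i, B4 i) ∪ ((⋃ i, ⋃ a, B5 i a) ∪ ⋃ j, B6 j))))
  have u2 := measureReal_union_le (μ := ν) (⋃ i, ⋃ l, B2 i l)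
      ((⋃ i, B3 i) ∪ ((⋃ i, B4 i) ∪ ((⋃ i, ⋃ a, B5 i a) ∪ ⋃ j, B6 j)))
  have u3 := measureReal_union_le (μ := ν) (⋃ i, B3 i)
      ((⋃ i, B4 i) ∪ ((⋃ i, ⋃ a, B5 i a) ∪ ⋃ j, B6 j))
  have u4 := measureReal_union_le (μ := ν) (⋃ i, B4 i) ((⋃ i, ⋃ a, B5 i a) ∪ ⋃ j, B6 j)
  have u5 := measureReal_union_le (μ := ν) (⋃ i, ⋃ a, B5 i a) (⋃ j, B6 j)
  have h7 : n * β ≤ n * (n * β) := by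
    have : β ≤ n * β := le_mul_of_one_le_left hβ0 hn1
    gcongr
  have h8 : 6 * (n : ℝ) ^ 2 * β = 6 * (n * (n * β)) := by ring
  linarith

end NodalCount
end

/-! ### Row sums of pair signs: conditional second moments and the martingale part. -/

noncomputable section

namespace NodalCount

open InnerProductSpace

variable {n : ℕ} {lam : Fin n → ℝ} {L : ℝ} {t : ℕ} {k : Fin n}

/-- The sign attached to the pair `(i, j)` by the `k`-th eigenvector. -/
def pairSign (lam : Fin n → ℝ) (k : Fin n) (u : Fin n → Euc n) (i j : Fin n) : ℝ :=
  sgn (entry lam u i j * u i k * u j k)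

lemma pairSign_comm (lam : Fin n → ℝ) (k : Fin n) (u : Fin n → Euc n) (i j : Fin n) :
    pairSign lam k u i j = pairSign lam k u j i := by
  rw [pairSign, pairSign, entry_comm]
  congr 1
  ring

lemma measurable_pairSign (lam : Fin n → ℝ) (k i j : Fin n) :
    Measurable fun u : Fin n → Euc n => pairSign lam k u i j := by
  have h := measurable_entry lam i j
  exact measurable_sgn.comp ((h.mul (by fun_prop)).mul (by fun_prop))

/-- The rows before `j` leave enough room for the signs of the pairs `(i, j)` to be
nondegenerate. -/
def IsRegularAt (lam : Fin n → ℝ) (k : Fin n) (u : Fin n → Euc n) (j : Fin n) : Prop :=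
  (∀ i < j, 1 / 2 ≤ ‖residual u j (diagMul lam (u i))‖ ^ 2 ∧ u i k ≠ 0) ∧
    residual u j (basisVec k) ≠ 0

/-- The cutoff is predictable: the rows before `j` decide it, so conditionally the row sum is either
kept whole or set to zero. This makes the second-moment bound below hold for every `x`; on good
frames the cutoff is inactive. -/
lemma isRegularAt_congr {u u' : Fin n → Euc n} {j : Fin n} (h : ∀ l < j, u l = u' l) :
    IsRegularAt lam k u j ↔ IsRegularAt lam k u' j := by
  unfold IsRegularAt
  rw [residual_congr h]
  refine and_congr (forall_congr' fun i => forall_congr' fun hi => ?_) Iff.rfl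
  rw [residual_congr h, h i hi]

lemma measurableSet_isRegularAt (lam : Fin n → ℝ) (k j : Fin n) :
    MeasurableSet {u : Fin n → Euc n | IsRegularAt lam k u j} := by
  have h : {u : Fin n → Euc n | IsRegularAt lam k u j} =
      (⋂ i, ⋂ (_ : i < j), ({u : Fin n → Euc n | 1 / 2 ≤ ‖residual u j (diagMul lam (u i))‖ ^ 2} ∩
        {u : Fin n → Euc n | u i k = 0}ᶜ)) ∩
      {u : Fin n → Euc n | residual u j (basisVec k) = 0}ᶜ := by
    ext u
    simp only [Set.mem_inter_iff, Set.mem_iInter]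
    exact Iff.rfl
  rw [h]
  have hd := continuous_diagMul lam
  refine MeasurableSet.inter (MeasurableSet.iInter fun i => MeasurableSet.iInter fun _ =>
    MeasurableSet.inter ?_ (MeasurableSet.compl ?_)) (MeasurableSet.compl ?_)
  · exact measurableSet_le measurable_const ((measurable_residual measurable_id
      (hd.measurable.comp (measurable_pi_apply i)) j).norm.pow_const 2)
  · exact measurableSet_eq_fun (by fun_prop) measurable_const
  · exact measurableSet_eq_fun (measurable_residual measurable_id measurable_const j)
      measurable_const

open Classical in
/-- The sum of the signs of the pairs `(i, j)` with `i < j`, cut off where it is degenerate. -/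
def rowSum (lam : Fin n → ℝ) (k : Fin n) (u : Fin n → Euc n) (j : Fin n) : ℝ :=
  if IsRegularAt lam k u j then ∑ i ∈ Finset.Iio j, pairSign lam k u i j else 0

lemma measurable_rowSum (lam : Fin n → ℝ) (k j : Fin n) :
    Measurable fun u : Fin n → Euc n => rowSum lam k u j := by
  classical
  exact Measurable.ite (measurableSet_isRegularAt lam k j)
    (Finset.measurable_sum _ fun i _ => measurable_pairSign lam k i j) measurable_const

lemma abs_rowSum_le (lam : Fin n → ℝ) (k : Fin n) (u : Fin n → Euc n) (j : Fin n) :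
    |rowSum lam k u j| ≤ j := by
  unfold rowSum
  split_ifs
  · refine (Finset.abs_sum_le_sum_abs _ _).trans ?_
    simp [pairSign]
  · simp

/-- `rowSum` as a function of independent Gaussian vectors. -/
def increment (lam : Fin n → ℝ) (k j : Fin n) (x : Fin n → Euc n) : ℝ :=
  rowSum lam k (gramSchmidtNormed ℝ x) j

/-- The conditional mean of `increment` given the vectors before `j`. -/
def condMean (lam : Fin n → ℝ) (k j : Fin n) (x : Fin n → Euc n) : ℝ :=
  ∫ y, increment lam k j (Function.update x j y) ∂stdGaussian (Euc n)

lemma measurable_increment (lam : Fin n → ℝ) (k j : Fin n) : Measurable (increment lam k j) :=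
  (measurable_rowSum lam k j).comp measurable_gramSchmidtNormed

lemma measurable_increment_update (lam : Fin n → ℝ) (k j : Fin n) (x : Fin n → Euc n) :
    Measurable fun y => increment lam k j (Function.update x j y) :=
  (measurable_increment lam k j).comp ((measurable_update_prod j).comp measurable_prodMk_left)

lemma measurable_condMean (lam : Fin n → ℝ) (k j : Fin n) : Measurable (condMean lam k j) :=
  (StronglyMeasurable.integral_prod_right' (f := fun p : (Fin n → Euc n) × Euc n =>
    increment lam k j (Function.update p.1 j p.2))
    ((measurable_increment lam k j).comp (measurable_update_prod j)).stronglyMeasurable).measurable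

lemma abs_increment_le (lam : Fin n → ℝ) (k j : Fin n) (x : Fin n → Euc n) :
    |increment lam k j x| ≤ j := abs_rowSum_le _ _ _ _

lemma integrable_increment_update (lam : Fin n → ℝ) (k j : Fin n) (x : Fin n → Euc n) :
    Integrable (fun y => increment lam k j (Function.update x j y)) (stdGaussian (Euc n)) :=
  Integrable.of_bound (measurable_increment_update lam k j x).aestronglyMeasurable j
    (Eventually.of_forall fun _ => abs_increment_le _ _ _ _)

lemma abs_condMean_le (lam : Fin n → ℝ) (k j : Fin n) (x : Fin n → Euc n) :
    |condMean lam k j x| ≤ j := by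
  refine abs_integral_le_integral_abs.trans ?_
  calc _ ≤ ∫ _y, (j : ℝ) ∂stdGaussian (Euc n) :=
        integral_mono (integrable_increment_update lam k j x).abs (integrable_const _)
          fun y => abs_increment_le _ _ _ _
    _ = _ := by simp

lemma condMean_update (lam : Fin n → ℝ) (k j : Fin n) (x : Fin n → Euc n) (y : Euc n) :
    condMean lam k j (Function.update x j y) = condMean lam k j x := by
  unfold condMean
  simp

lemma increment_congr (lam : Fin n → ℝ) (k j : Fin n) {x x' : Fin n → Euc n}
    (h : ∀ l ≤ j, x l = x' l) : increment lam k j x = increment lam k j x' := by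
  have hg : ∀ l ≤ j, gramSchmidtNormed ℝ x l = gramSchmidtNormed ℝ x' l := fun l hl =>
    gramSchmidtNormed_congr l fun m hm => h m (hm.trans hl)
  unfold increment rowSum
  rw [isRegularAt_congr fun l hl => hg l hl.le]
  congr 1
  refine Finset.sum_congr rfl fun i hi => ?_
  rw [pairSign, pairSign, entry, entry, hg i (Finset.mem_Iio.1 hi).le, hg j le_rfl]

lemma increment_update_of_lt (lam : Fin n → ℝ) (k : Fin n) {i j : Fin n} (hij : i < j)
    (x : Fin n → Euc n) (y : Euc n) :
    increment lam k i (Function.update x j y) = increment lam k i x :=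
  increment_congr lam k i fun _ hl => Function.update_of_ne (hl.trans_lt hij).ne _ _

lemma condMean_update_of_lt (lam : Fin n → ℝ) (k : Fin n) {i j : Fin n} (hij : i < j)
    (x : Fin n → Euc n) (y : Euc n) :
    condMean lam k i (Function.update x j y) = condMean lam k i x := by
  unfold condMean
  congr 1
  ext z
  refine increment_congr lam k i fun l hl => ?_
  by_cases h : l = i
  · subst h; simp
  · rw [Function.update_of_ne h, Function.update_of_ne h,
      Function.update_of_ne (hl.trans_lt hij).ne]

/-- Given the vectors before `j`, the signs of the pairs `(i, j)` are signs of linear functionals of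
the `j`-th Gaussian vector. -/
lemma ae_pairSign_update (x : Fin n → Euc n) {j : Fin n}
    (h : IsRegularAt lam k (gramSchmidtNormed ℝ x) j) :
    ∀ᵐ y ∂stdGaussian (Euc n), ∀ i < j,
      pairSign lam k (gramSchmidtNormed ℝ (Function.update x j y)) i j =
        sgn (gramSchmidtNormed ℝ x i k) *
          (sgn (inner ℝ (residual (gramSchmidtNormed ℝ x) j
              (diagMul lam (gramSchmidtNormed ℝ x i))) y) *
            sgn (inner ℝ (residual (gramSchmidtNormed ℝ x) j (basisVec k)) y)) := by
  set u := gramSchmidtNormed ℝ x with hu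
  have hfr : IsPartialFrame u := isPartialFrame_gramSchmidtNormed x
  have h1 : ∀ i, ∀ᵐ y ∂stdGaussian (Euc n), i < j →
      (inner ℝ (residual u j (diagMul lam (u i))) y : ℝ) ≠ 0 := fun i => by
    by_cases hi : i < j
    · have h2 : residual u j (diagMul lam (u i)) ≠ 0 := by
        intro h3
        have := (h.1 i hi).1
        rw [h3] at this
        norm_num at this
      filter_upwards [ae_inner_ne_zero h2] with y hy _ using hy
    · exact Eventually.of_forall fun y h => absurd h hi
  filter_upwards [ae_all_iff.2 h1, ae_inner_ne_zero h.2] with y hy1 hy2 i hi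
  set r := residual u j y with hr
  have hb : (inner ℝ (basisVec k) r : ℝ) = inner ℝ (residual u j (basisVec k)) y :=
    hfr.inner_residual_comm j _ y
  have hr0 : r ≠ 0 := by
    intro h3
    rw [h3, inner_zero_right] at hb
    exact hy2 hb.symm
  have hrn : 0 < ‖r‖⁻¹ := inv_pos.2 (norm_pos_iff.2 hr0)
  have huj : gramSchmidtNormed ℝ (Function.update x j y) j = ‖r‖⁻¹ • r := by
    rw [gramSchmidtNormed_eq, gramSchmidt_update_self]
  have hui : gramSchmidtNormed ℝ (Function.update x j y) i = u i := gramSchmidtNormed_update x hi y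
  rw [pairSign, entry, huj, hui, ← inner_basisVec k (‖r‖⁻¹ • r), real_inner_smul_right,
    real_inner_smul_right, hb, hfr.inner_residual_comm]
  set α := (inner ℝ (residual u j (diagMul lam (u i))) y : ℝ) with hα
  set b := (inner ℝ (residual u j (basisVec k)) y : ℝ) with hbdef
  have h4 : ‖r‖⁻¹ * α * u i k * (‖r‖⁻¹ * b) = ‖r‖⁻¹ * ‖r‖⁻¹ * (u i k * (α * b)) := by ring
  have hα0 : α ≠ 0 := hy1 i hi
  rw [h4, sgn_mul_of_pos_left (mul_pos hrn hrn), sgn_mul (h.1 i hi).2 (mul_ne_zero hα0 hy2),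
    sgn_mul hα0 hy2]

lemma ae_increment_update (x : Fin n → Euc n) {j : Fin n}
    (h : IsRegularAt lam k (gramSchmidtNormed ℝ x) j) :
    ∀ᵐ y ∂stdGaussian (Euc n), increment lam k j (Function.update x j y) =
      ∑ i ∈ Finset.Iio j, sgn (gramSchmidtNormed ℝ x i k) *
          (sgn (inner ℝ (residual (gramSchmidtNormed ℝ x) j
              (diagMul lam (gramSchmidtNormed ℝ x i))) y) *
            sgn (inner ℝ (residual (gramSchmidtNormed ℝ x) j (basisVec k)) y)) := by
  filter_upwards [ae_pairSign_update x h] with y hy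
  have hreg : IsRegularAt lam k (gramSchmidtNormed ℝ (Function.update x j y)) j :=
    (isRegularAt_congr fun l hl => gramSchmidtNormed_update x hl y).2 h
  rw [increment, rowSum, if_pos hreg]
  exact Finset.sum_congr rfl fun i hi => hy i (Finset.mem_Iio.1 hi)

lemma increment_update_of_not_isRegularAt (x : Fin n → Euc n) {j : Fin n}
    (h : ¬ IsRegularAt lam k (gramSchmidtNormed ℝ x) j) (y : Euc n) :
    increment lam k j (Function.update x j y) = 0 := by
  rw [increment, rowSum, if_neg]
  rwa [isRegularAt_congr fun l hl => gramSchmidtNormed_update x hl y]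

/-- For `a` the residual of `D (u i)`, self-adjointness turns its inner products with the other
residuals into the coefficients `⟨u l, D a⟩`. Bessel's inequality bounds their squares by `‖D a‖^2`,
independently of `j`. -/
lemma sum_inner_residual_sq_le {u : Fin n → Euc n} (hu : IsPartialFrame u) (hL : 0 ≤ L)
    (hlam : ∀ m, |lam m| ≤ L) (j i : Fin n) :
    ∑ l ∈ Finset.Iio j, (inner ℝ (residual u j (diagMul lam (u i)))
      (residual u j (diagMul lam (u l))) : ℝ) ^ 2 ≤ L ^ 4 := by
  set a := residual u j (diagMul lam (u i)) with ha
  have h1 : ∀ l, (inner ℝ a (residual u j (diagMul lam (u l))) : ℝ) =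
      inner ℝ (u l) (diagMul lam a) := fun l => by
    rw [ha, hu.inner_residual_residual, ← ha, ← inner_diagMul_comm, real_inner_comm]
  simp_rw [h1]
  have h2 : ‖a‖ ≤ L := by
    calc ‖a‖ ≤ ‖diagMul lam (u i)‖ := hu.norm_residual_le j _
      _ ≤ L * ‖u i‖ := norm_diagMul_le hL hlam _
      _ ≤ L * 1 := by gcongr; exact hu.norm_le i
      _ = L := mul_one L
  calc _ ≤ ‖diagMul lam a‖ ^ 2 := hu.sum_inner_sq_le j _
    _ ≤ (L * L) ^ 2 := by
        have := norm_diagMul_le hL hlam a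
        gcongr
        exact this.trans (by gcongr)
    _ = L ^ 4 := by ring

/-- On expanding the square, the sign coming from `e_k` occurs twice and disappears. What remains
are correlations of the signs for rows `i` and `l`, at most `6 |⟨a i, a l⟩|`: the factor `3` of the
sign estimate over the product of norms, which is at least `1/2`. Cauchy-Schwarz and the Bessel
bound give `√j L^2` per row `i`, hence `j^(3/2)` in total. -/
lemma integral_increment_sq_le (hL : 0 ≤ L) (hlam : ∀ m, |lam m| ≤ L) (x : Fin n → Euc n)
    (j : Fin n) :
    ∫ y, increment lam k j (Function.update x j y) ^ 2 ∂stdGaussian (Euc n) ≤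
      6 * (j * Real.sqrt j * L ^ 2) := by
  by_cases h : IsRegularAt lam k (gramSchmidtNormed ℝ x) j
  swap
  · simp_rw [increment_update_of_not_isRegularAt x h]
    simp
    positivity
  set u := gramSchmidtNormed ℝ x with hu
  have hfr : IsPartialFrame u := isPartialFrame_gramSchmidtNormed x
  set a : Fin n → Euc n := fun i => residual u j (diagMul lam (u i)) with ha
  have hint : ∀ i l, Integrable (fun y => sgn (inner ℝ (a i) y) * sgn (inner ℝ (a l) y))
      (stdGaussian (Euc n)) := fun i l => integrable_sgn_mul_sgn (by fun_prop) (by fun_prop)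
  have h1 : ∫ y, increment lam k j (Function.update x j y) ^ 2 ∂stdGaussian (Euc n) =
      ∑ i ∈ Finset.Iio j, ∑ l ∈ Finset.Iio j, sgn (u i k) * sgn (u l k) *
        ∫ y, sgn (inner ℝ (a i) y) * sgn (inner ℝ (a l) y) ∂stdGaussian (Euc n) := by
    calc _ = ∫ y, ∑ i ∈ Finset.Iio j, ∑ l ∈ Finset.Iio j, sgn (u i k) * sgn (u l k) *
        (sgn (inner ℝ (a i) y) * sgn (inner ℝ (a l) y)) ∂stdGaussian (Euc n) := by
          refine integral_congr_ae ?_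
          filter_upwards [ae_increment_update x h] with y hy
          rw [hy, sq, Finset.sum_mul_sum]
          refine Finset.sum_congr rfl fun i _ => Finset.sum_congr rfl fun l _ => ?_
          have := sgn_mul_self (inner ℝ (residual u j (basisVec k)) y)
          calc _ = sgn (u i k) * sgn (u l k) * (sgn (inner ℝ (a i) y) * sgn (inner ℝ (a l) y)) *
                (sgn (inner ℝ (residual u j (basisVec k)) y) *
                  sgn (inner ℝ (residual u j (basisVec k)) y)) := by ring
            _ = _ := by rw [this, mul_one]
      _ = _ := by
          rw [integral_finsetSum _ fun i _ => integrable_finsetSum _ fun l _ =>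
            (hint i l).const_mul _]
          refine Finset.sum_congr rfl fun i _ => ?_
          rw [integral_finsetSum _ fun l _ => (hint i l).const_mul _]
          exact Finset.sum_congr rfl fun l _ => integral_const_mul _ _
  rw [h1]
  have h2 : ∀ i ∈ Finset.Iio j, ∀ l ∈ Finset.Iio j, sgn (u i k) * sgn (u l k) *
      ∫ y, sgn (inner ℝ (a i) y) * sgn (inner ℝ (a l) y) ∂stdGaussian (Euc n) ≤
        6 * |inner ℝ (a i) (a l)| := by
    intro i hi l hl
    have hi' := (h.1 i (Finset.mem_Iio.1 hi)).1
    have hl' := (h.1 l (Finset.mem_Iio.1 hl)).1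
    have hi0 : 0 < ‖a i‖ := by
      rcases (norm_nonneg (a i)).eq_or_lt with h | h
      · change 1 / 2 ≤ ‖a i‖ ^ 2 at hi'
        rw [← h] at hi'; norm_num at hi'
      · exact h
    have hl0 : 0 < ‖a l‖ := by
      rcases (norm_nonneg (a l)).eq_or_lt with h | h
      · change 1 / 2 ≤ ‖a l‖ ^ 2 at hl'
        rw [← h] at hl'; norm_num at hl'
      · exact h
    have hprod : 1 / 2 ≤ ‖a i‖ * ‖a l‖ := by
      refine le_of_sq_le_sq ?_ (by positivity)
      rw [mul_pow]
      change 1 / 2 ≤ ‖a i‖ ^ 2 at hi'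
      change 1 / 2 ≤ ‖a l‖ ^ 2 at hl'
      nlinarith
    refine (le_abs_self _).trans ?_
    rw [abs_mul, abs_mul, abs_sgn, abs_sgn, one_mul, one_mul]
    refine (abs_integral_sgn_inner_le (norm_pos_iff.1 hi0) (norm_pos_iff.1 hl0)).trans ?_
    rw [abs_div, abs_of_pos (by positivity : 0 < ‖a i‖ * ‖a l‖), mul_div_assoc',
      div_le_iff₀ (by positivity)]
    nlinarith [abs_nonneg (inner ℝ (a i) (a l) : ℝ)]
  have h3 : ∀ i, ∑ l ∈ Finset.Iio j, |(inner ℝ (a i) (a l) : ℝ)| ≤ Real.sqrt j * L ^ 2 := by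
    intro i
    refine le_of_sq_le_sq ?_ (by positivity)
    refine sq_sum_le_card_mul_sum_sq.trans ?_
    simp_rw [sq_abs]
    rw [mul_pow, Real.sq_sqrt (by positivity), Fin.card_Iio, ← pow_mul]
    have := sum_inner_residual_sq_le hfr hL hlam j i
    gcongr
  calc _ ≤ ∑ i ∈ Finset.Iio j, ∑ l ∈ Finset.Iio j, 6 * |(inner ℝ (a i) (a l) : ℝ)| :=
        Finset.sum_le_sum fun i hi => Finset.sum_le_sum fun l hl => h2 i hi l hl
    _ ≤ ∑ _i ∈ Finset.Iio j, 6 * (Real.sqrt j * L ^ 2) := by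
        refine Finset.sum_le_sum fun i _ => ?_
        rw [← Finset.mul_sum]
        have := h3 i
        gcongr
    _ = _ := by
        simp
        ring

/-- Increment and conditional mean are at most `t`, so the exponent has modulus at most `1` and `exp
z ≤ 1 + z + z^2` applies. The linear term has mean zero, and the variance is at most the second
moment. -/
lemma integral_exp_centered_le (hL : 0 ≤ L) (hlam : ∀ m, |lam m| ≤ L) (x : Fin n → Euc n)
    {j : Fin n} (hj : (j : ℕ) < t) {s : ℝ} (hs : |s| * (2 * t) ≤ 1) :
    ∫⁻ y, ENNReal.ofReal (Real.exp (s * (increment lam k j (Function.update x j y) -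
      condMean lam k j (Function.update x j y)))) ∂stdGaussian (Euc n) ≤
      ENNReal.ofReal (Real.exp (s ^ 2 * (6 * (t * Real.sqrt t * L ^ 2)))) := by
  simp_rw [condMean_update]
  set c := condMean lam k j x with hc
  set f : Euc n → ℝ := fun y => increment lam k j (Function.update x j y) with hf
  have hfi : Integrable f (stdGaussian (Euc n)) := integrable_increment_update lam k j x
  have hfm : Measurable f := measurable_increment_update lam k j x
  have hjt : (j : ℝ) ≤ t := by exact_mod_cast hj.le
  have hfb : ∀ y, |f y| ≤ t := fun y => (abs_increment_le _ _ _ _).trans hjt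
  have hcb : |c| ≤ t := (abs_condMean_le _ _ _ _).trans hjt
  have hzb : ∀ y, |s * (f y - c)| ≤ 1 := fun y => by
    rw [abs_mul]
    refine le_trans ?_ hs
    have := abs_sub (f y) c
    gcongr
    linarith [hfb y]
  have hf2 : Integrable (fun y => f y ^ 2) (stdGaussian (Euc n)) :=
    Integrable.of_bound (hfm.pow_const 2).aestronglyMeasurable ((t : ℝ) ^ 2)
      (Eventually.of_forall fun y => by
        rw [Real.norm_eq_abs, abs_pow]
        have := hfb y
        gcongr)
  have hexp : Integrable (fun y => Real.exp (s * (f y - c))) (stdGaussian (Euc n)) :=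
    Integrable.of_bound (by fun_prop) (Real.exp 1) (Eventually.of_forall fun y => by
      rw [Real.norm_eq_abs, Real.abs_exp]
      exact Real.exp_le_exp.2 ((le_abs_self _).trans (hzb y)))
  rw [← ofReal_integral_eq_lintegral_ofReal hexp
    (Eventually.of_forall fun y => (Real.exp_pos _).le)]
  refine ENNReal.ofReal_le_ofReal ?_
  have hpt : ∀ y, Real.exp (s * (f y - c)) ≤ 1 + s * (f y - c) +
      s ^ 2 * (f y ^ 2 - 2 * c * f y + c ^ 2) := by
    intro y
    have := Real.abs_exp_sub_one_sub_id_le (hzb y)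
    have h2 := (abs_le.1 this).2
    nlinarith
  have hi1 : Integrable (fun y => s * (f y - c)) (stdGaussian (Euc n)) :=
    (hfi.sub (integrable_const c)).const_mul s
  have hi2 : Integrable (fun y => f y ^ 2 - 2 * c * f y + c ^ 2) (stdGaussian (Euc n)) :=
    (hf2.sub (hfi.const_mul _)).add (integrable_const _)
  have hmean : ∫ y, f y ∂stdGaussian (Euc n) = c := rfl
  have hsq := integral_increment_sq_le (k := k) hL hlam x j
  change ∫ y, f y ^ 2 ∂stdGaussian (Euc n) ≤ _ at hsq
  calc ∫ y, Real.exp (s * (f y - c)) ∂stdGaussian (Euc n)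
      ≤ ∫ y, (1 + s * (f y - c) + s ^ 2 * (f y ^ 2 - 2 * c * f y + c ^ 2)) ∂stdGaussian (Euc n) :=
        integral_mono hexp (((integrable_const _).add hi1).add (hi2.const_mul _)) hpt
    _ = 1 + s ^ 2 * (∫ y, f y ^ 2 ∂stdGaussian (Euc n) - c ^ 2) := by
        have e1 : ∫ y, s * (f y - c) ∂stdGaussian (Euc n) = 0 := by
          rw [integral_const_mul, integral_sub hfi (integrable_const c), hmean]
          simp
        have e2 : ∫ y, (f y ^ 2 - 2 * c * f y + c ^ 2) ∂stdGaussian (Euc n) =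
            ∫ y, f y ^ 2 ∂stdGaussian (Euc n) - c ^ 2 := by
          have e3 : Integrable (fun y => f y ^ 2 - 2 * c * f y) (stdGaussian (Euc n)) :=
            hf2.sub (hfi.const_mul _)
          rw [integral_add e3 (integrable_const _), integral_sub hf2 (hfi.const_mul _),
            integral_const_mul, hmean]
          simp
          ring
        have e3 : Integrable (fun y => 1 + s * (f y - c)) (stdGaussian (Euc n)) :=
          (integrable_const _).add hi1
        rw [integral_add e3 (hi2.const_mul _),
          integral_add (integrable_const _) hi1, e1, integral_const_mul, e2]
        simp
    _ ≤ 1 + s ^ 2 * (6 * (t * Real.sqrt t * L ^ 2)) := by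
        have : 6 * ((j : ℝ) * Real.sqrt j * L ^ 2) ≤ 6 * (t * Real.sqrt t * L ^ 2) := by gcongr
        have h3 : ∫ y, f y ^ 2 ∂stdGaussian (Euc n) - c ^ 2 ≤ 6 * (t * Real.sqrt t * L ^ 2) := by
          nlinarith [sq_nonneg c]
        gcongr
    _ ≤ _ := by linarith [Real.add_one_le_exp (s ^ 2 * (6 * (t * Real.sqrt t * L ^ 2)))]

/-- The centred part of the sum of the increments. -/
def martingalePart (lam : Fin n → ℝ) (k : Fin n) (t : ℕ) (x : Fin n → Euc n) : ℝ :=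
  ∑ j ∈ Finset.univ.filter (fun j : Fin n => (j : ℕ) < t),
    (increment lam k j x - condMean lam k j x)

lemma measurable_martingalePart (lam : Fin n → ℝ) (k : Fin n) (t : ℕ) :
    Measurable (martingalePart lam k t) :=
  Finset.measurable_sum _ fun j _ => (measurable_increment lam k j).sub
    (measurable_condMean lam k j)

/-- Markov's inequality for the exponential supermartingale with `|s| = 1/(L τ)`. The threshold `L^2
τ` then becomes `L`, and `ε` selects the tail. -/
lemma measureReal_mul_martingalePart_ge_le (hL : 1 ≤ L) (hlam : ∀ m, |lam m| ≤ L) (htn : t ≤ n)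
    {τ : ℝ} (hτ0 : 0 < τ) (hτ : 2 * t ≤ τ) (hτ2 : (t : ℝ) ^ 2 * Real.sqrt t ≤ τ ^ 2) {ε : ℝ}
    (hε : |ε| = 1) :
    (gaussianRows n).real {x | L ^ 2 * τ ≤ ε * martingalePart lam k t x} ≤ Real.exp (6 - L) := by
  have hL0 : 0 < L := by linarith
  set s : ℝ := ε * (L * τ)⁻¹ with hs
  have hsabs : |s| = (L * τ)⁻¹ := by
    rw [hs, abs_mul, hε, one_mul, abs_of_pos (by positivity)]
  have hs1 : |s| * (2 * t) ≤ 1 := by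
    rw [hsabs, inv_mul_le_iff₀ (by positivity), mul_one]
    nlinarith
  -- Increments from index `t` on are set to zero because the supermartingale inequality requires
  -- its moment bound at every index.
  set D : Fin n → (Fin n → Euc n) → ℝ := fun j x =>
    if (j : ℕ) < t then s * (increment lam k j x - condMean lam k j x) else 0 with hD
  set K : ℝ := s ^ 2 * (6 * (t * Real.sqrt t * L ^ 2)) with hK
  have hK0 : 0 ≤ K := by positivity
  have hDm : ∀ j, Measurable (D j) := fun j => by
    simp only [hD]
    split_ifs
    · exact ((measurable_increment lam k j).sub
    (measurable_condMean lam k j)).const_mul s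
    · exact measurable_const
  have hmain := lintegral_exp_sum_le (stdGaussian (Euc n)) D hDm
    (fun i j hij x y => by
      simp only [hD]
      rw [increment_update_of_lt lam k hij, condMean_update_of_lt lam k hij])
    (K := K) (fun j x => by
      by_cases hj : (j : ℕ) < t
      · simp only [hD, hj, if_true]
        exact integral_exp_centered_le hL0.le hlam x hj hs1
      · simp only [hD, hj, if_false]
        simp only [Real.exp_zero, ENNReal.ofReal_one, lintegral_const, measure_univ, mul_one]
        rw [← ENNReal.ofReal_one]
        exact ENNReal.ofReal_le_ofReal (Real.one_le_exp hK0)) t htn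
  have hsum : ∀ x, ∑ j ∈ Finset.univ.filter (fun j : Fin n => (j : ℕ) < t), D j x =
      s * martingalePart lam k t x := fun x => by
    rw [martingalePart, Finset.mul_sum]
    refine Finset.sum_congr rfl fun j hj => ?_
    simp only [hD, (Finset.mem_filter.1 hj).2, if_true]
  simp_rw [hsum] at hmain
  -- The total exponent is `6 t^(5/2) / τ^2`, which is where the condition on `τ^2` is used.
  have htK : t * K ≤ 6 := by
    have e1 : s ^ 2 = (L ^ 2 * τ ^ 2)⁻¹ := by rw [← sq_abs, hsabs, inv_pow, mul_pow]
    rw [hK, e1]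
    have e2 : (t : ℝ) * ((L ^ 2 * τ ^ 2)⁻¹ * (6 * (t * Real.sqrt t * L ^ 2))) =
        6 * ((t : ℝ) ^ 2 * Real.sqrt t / τ ^ 2) := by
      field_simp
    rw [e2]
    have : (t : ℝ) ^ 2 * Real.sqrt t / τ ^ 2 ≤ 1 := by
      rw [div_le_one (by positivity)]; exact hτ2
    linarith
  have hM := measurable_martingalePart lam k t
  have hmark := mul_meas_ge_le_lintegral₀ (μ := gaussianRows n)
    (f := fun x => ENNReal.ofReal (Real.exp (s * martingalePart lam k t x)))
    (by fun_prop) (ENNReal.ofReal (Real.exp L))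
  have hsub : {x | L ^ 2 * τ ≤ ε * martingalePart lam k t x} ⊆
      {x | ENNReal.ofReal (Real.exp L) ≤
        ENNReal.ofReal (Real.exp (s * martingalePart lam k t x))} := by
    intro x hx
    refine ENNReal.ofReal_le_ofReal (Real.exp_le_exp.2 ?_)
    have hx' : L ^ 2 * τ ≤ ε * martingalePart lam k t x := hx
    have e3 : s * martingalePart lam k t x = (L * τ)⁻¹ * (ε * martingalePart lam k t x) := by
      rw [hs]; ring
    rw [e3, le_inv_mul_iff₀ (by positivity)]
    calc _ = L ^ 2 * τ := by ring
      _ ≤ _ := hx'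
  refine ENNReal.toReal_le_of_le_ofReal (Real.exp_pos _).le ?_
  have h5 : ENNReal.ofReal (Real.exp L) *
      (gaussianRows n) {x | L ^ 2 * τ ≤ ε * martingalePart lam k t x} ≤
      ENNReal.ofReal (Real.exp 6) := by
    calc _ ≤ ENNReal.ofReal (Real.exp L) * (gaussianRows n)
          {x | ENNReal.ofReal (Real.exp L) ≤
            ENNReal.ofReal (Real.exp (s * martingalePart lam k t x))} := by
          gcongr
      _ ≤ _ := hmark
      _ ≤ _ := hmain
      _ ≤ _ := ENNReal.ofReal_le_ofReal (Real.exp_le_exp.2 htK)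
  rw [Real.exp_sub, ENNReal.ofReal_div_of_pos (Real.exp_pos _)]
  rw [ENNReal.le_div_iff_mul_le (Or.inl (by positivity)) (Or.inl ENNReal.ofReal_ne_top), mul_comm]
  exact h5

lemma measureReal_abs_martingalePart_ge_le (hL : 1 ≤ L) (hlam : ∀ m, |lam m| ≤ L) (htn : t ≤ n)
    {τ : ℝ} (hτ0 : 0 < τ) (hτ : 2 * t ≤ τ) (hτ2 : (t : ℝ) ^ 2 * Real.sqrt t ≤ τ ^ 2) :
    (gaussianRows n).real {x | L ^ 2 * τ ≤ |martingalePart lam k t x|} ≤ 2 * Real.exp (6 - L) := by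
  have h1 := measureReal_mul_martingalePart_ge_le (k := k) hL hlam htn hτ0 hτ hτ2 (ε := 1) (by simp)
  have h2 := measureReal_mul_martingalePart_ge_le (k := k) hL hlam htn hτ0 hτ hτ2 (ε := -1)
    (by simp)
  have hsub : {x | L ^ 2 * τ ≤ |martingalePart lam k t x|} ⊆
      {x | L ^ 2 * τ ≤ 1 * martingalePart lam k t x} ∪
        {x | L ^ 2 * τ ≤ -1 * martingalePart lam k t x} := by
    intro x hx
    change _ ≤ |(_ : ℝ)| at hx
    rcases le_abs.1 hx with hx | hx
    · left
      change _ ≤ 1 * martingalePart lam k t x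
      rwa [one_mul]
    · right
      change _ ≤ -1 * martingalePart lam k t x
      rwa [neg_one_mul]
  have := (measureReal_mono (μ := gaussianRows n) hsub).trans
      (measureReal_union_le _ _)
  linarith

end NodalCount
end

/-! ### Drift: conditional means of the pair signs on a good frame. -/

noncomputable section

namespace NodalCount

open InnerProductSpace

variable {n : ℕ} {lam : Fin n → ℝ} {L : ℝ} {t : ℕ} {k : Fin n}

/-- The relative error in the variances of the linear functionals attached to a good frame. -/
def frameError (n t : ℕ) (L : ℝ) : ℝ := 64 * L ^ 3 / Real.sqrt n + 1024 * t * L ^ 4 / n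

/-- The error in the conditional mean of a pair sign attached to a good frame. -/
def driftError (n t : ℕ) (L : ℝ) : ℝ :=
  140 * frameError n t L * L ^ 3 / Real.sqrt n + 68 * L ^ 3 * Real.sqrt t / n + 58800 * L ^ 6 / n

lemma abs_inv_sub_one_le {p θ : ℝ} (hp : |p - 1| ≤ θ) (hθ : θ ≤ 1 / 2) : |1 / p - 1| ≤ 2 * θ := by
  have h := abs_le.1 hp
  have hp0 : 1 / 2 ≤ p := by linarith
  have h1 : 1 / p - 1 = (1 - p) / p := by field_simp
  rw [h1, abs_div, abs_of_pos (by linarith : 0 < p), div_le_iff₀ (by linarith), abs_sub_comm]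
  nlinarith [abs_nonneg (p - 1)]

lemma abs_mul_sub_one_le {a b θ : ℝ} (ha : 0 ≤ a) (hb : 0 ≤ b) (ha2 : |a ^ 2 - 1| ≤ θ)
    (hb2 : |b ^ 2 - 1| ≤ θ) (hθ : θ ≤ 1) : |a * b - 1| ≤ θ := by
  have h1 := abs_le.1 ha2
  have h2 := abs_le.1 hb2
  have hab : 0 ≤ a * b := by positivity
  have hθ0 : 0 ≤ θ := (abs_nonneg _).trans ha2
  rw [abs_le]
  constructor
  · have : (1 - θ) ^ 2 ≤ (a * b) ^ 2 := by
      rw [mul_pow, sq (1 - θ)]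
      have : 0 ≤ 1 - θ := by linarith
      nlinarith
    have := le_of_sq_le_sq this hab
    linarith
  · have : (a * b) ^ 2 ≤ (1 + θ) ^ 2 := by
      rw [mul_pow, sq (1 + θ)]
      nlinarith [sq_nonneg a, sq_nonneg b]
    have := le_of_sq_le_sq this (by linarith)
    linarith

namespace IsGoodFrame

variable {u : Fin n → Euc n} (hu : IsGoodFrame lam k L t u)
include hu

/-- Projecting off the earlier rows removes the squares of fewer than `t` entries of `A`, each of
order `L^4 / n`. This loss is negligible only because `t` is much smaller than `n`. -/
lemma abs_norm_residual_diagMul_sq_sub_le {i j : Fin n} (hi : i < j) (hj : (j : ℕ) < t) :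
    |‖residual u j (diagMul lam (u i))‖ ^ 2 - 1| ≤ frameError n t L := by
  have hn0 : (0 : ℝ) < n := by exact_mod_cast Fin.pos j
  have hsq : Real.sqrt n * Real.sqrt n = n := Real.mul_self_sqrt hn0.le
  rw [hu.orthonormal.isPartialFrame.norm_residual_sq]
  have hit : (i : ℕ) < t := lt_trans hi hj
  have h1 := abs_le.1 (hu.norm_le i hit)
  have h2 : ∑ l ∈ Finset.Iio j, (inner ℝ (u l) (diagMul lam (u i)) : ℝ) ^ 2 ≤
      1024 * t * L ^ 4 / n := by
    calc _ ≤ ∑ _l ∈ Finset.Iio j, (32 * L ^ 2 / Real.sqrt n) ^ 2 := by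
          refine Finset.sum_le_sum fun l hl => ?_
          have := hu.entry_le i l hit (lt_trans (Fin.lt_def.1 (Finset.mem_Iio.1 hl)) hj)
          rw [entry, real_inner_comm] at this
          rw [← sq_abs]
          gcongr
      _ = j * (32 * L ^ 2 / Real.sqrt n) ^ 2 := by simp
      _ ≤ t * (32 * L ^ 2 / Real.sqrt n) ^ 2 := by gcongr
      _ = t * (1024 * L ^ 4 / (Real.sqrt n * Real.sqrt n)) := by
          rw [div_pow]; ring
      _ = _ := by rw [hsq]; ring
  have h3 : 0 ≤ ∑ l ∈ Finset.Iio j, (inner ℝ (u l) (diagMul lam (u i)) : ℝ) ^ 2 :=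
    Finset.sum_nonneg fun _ _ => sq_nonneg _
  have h4 : 0 ≤ 1024 * t * L ^ 4 / n := by positivity
  unfold frameError
  rw [abs_le]
  constructor <;> linarith

lemma abs_norm_residual_basisVec_sq_sub_le {j : Fin n} (hL : 1 ≤ L) (hj : (j : ℕ) < t) :
    |‖residual u j (basisVec k)‖ ^ 2 - 1| ≤ frameError n t L := by
  have hn0 : (0 : ℝ) < n := by exact_mod_cast Fin.pos j
  have hsq : Real.sqrt n * Real.sqrt n = n := Real.mul_self_sqrt hn0.le
  rw [hu.orthonormal.isPartialFrame.norm_residual_sq]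
  have h2 : ∑ l ∈ Finset.Iio j, (inner ℝ (u l) (basisVec k) : ℝ) ^ 2 ≤
      1024 * t * L ^ 4 / n := by
    calc _ ≤ ∑ _l ∈ Finset.Iio j, (2 * L / Real.sqrt n) ^ 2 := by
          refine Finset.sum_le_sum fun l hl => ?_
          have := hu.coord_le l (lt_trans (Fin.lt_def.1 (Finset.mem_Iio.1 hl)) hj)
          rw [real_inner_comm, inner_basisVec, ← sq_abs]
          gcongr
      _ = j * (2 * L / Real.sqrt n) ^ 2 := by simp
      _ ≤ t * (2 * L / Real.sqrt n) ^ 2 := by gcongr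
      _ = t * (4 * L ^ 2 / (Real.sqrt n * Real.sqrt n)) := by
          rw [div_pow]; ring
      _ = 4 * t * L ^ 2 / n := by rw [hsq]; ring
      _ ≤ _ := by
          have : L ^ 2 ≤ L ^ 4 := pow_le_pow_right₀ hL (by norm_num)
          gcongr
          norm_num
  have h3 : 0 ≤ ∑ l ∈ Finset.Iio j, (inner ℝ (u l) (basisVec k) : ℝ) ^ 2 :=
    Finset.sum_nonneg fun _ _ => sq_nonneg _
  have h4 : 0 ≤ 64 * L ^ 3 / Real.sqrt n := by positivity
  have h5 : ‖(basisVec k : Euc n)‖ = 1 := by simp [basisVec]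
  unfold frameError
  rw [h5, abs_le]
  constructor <;> linarith

lemma isRegularAt {j : Fin n} (hL : 1 ≤ L) (hj : (j : ℕ) < t) (hθ : frameError n t L ≤ 1 / 8) :
    IsRegularAt lam k u j := by
  refine ⟨fun i hi => ⟨?_, hu.coord_ne_zero i⟩, fun h => ?_⟩
  · have := (abs_le.1 (hu.abs_norm_residual_diagMul_sq_sub_le hi hj)).1
    linarith
  · have := (abs_le.1 (hu.abs_norm_residual_basisVec_sq_sub_le hL hj)).1
    rw [h, norm_zero] at this
    linarith

/-- Before projection the inner product of `D (u i)` with `e_k` is exactly `λ_k u i k`. Projecting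
subtracts `∑_{l<j} u l k * A i l`. Its term `l = i` is bounded by the sizes of a coordinate and a
diagonal entry, and the rest is the cross sum of a good frame. -/
lemma abs_inner_residual_sub_le {i j : Fin n} (hL : 1 ≤ L) (hi : i < j) (hj : (j : ℕ) < t) :
    |(inner ℝ (residual u j (diagMul lam (u i))) (residual u j (basisVec k)) : ℝ) -
      lam k * u i k| ≤ 68 * L ^ 3 * Real.sqrt t / n := by
  have hn0 : (0 : ℝ) < n := by exact_mod_cast Fin.pos j
  have hsn : 0 < Real.sqrt n := Real.sqrt_pos.2 hn0
  have hsq : Real.sqrt n * Real.sqrt n = n := Real.mul_self_sqrt hn0.le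
  have hit : (i : ℕ) < t := lt_trans hi hj
  rw [hu.orthonormal.isPartialFrame.inner_residual_eq, real_inner_comm, inner_basisVec,
    diagMul_apply, sub_sub_cancel_left, abs_neg]
  have hj0 : 0 < (j : ℕ) := lt_of_le_of_lt (Nat.zero_le _) hi
  -- The cross bound is indexed by the last row included, hence the predecessor of `j`; it exists
  -- because `i < j`.
  set a : Fin n := ⟨(j : ℕ) - 1, by omega⟩ with ha
  have hset : Finset.Iio j = Finset.Iic a := by
    ext l
    simp only [Finset.mem_Iio, Finset.mem_Iic, Fin.lt_def, Fin.le_def, ha]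
    omega
  have hia : i ≤ a := by
    simp only [Fin.lt_def, Fin.le_def, ha] at hi ⊢
    omega
  have hat : (a : ℕ) < t := by simp only [ha]; omega
  have h1 : ∑ l ∈ Finset.Iio j, (inner ℝ (u l) (diagMul lam (u i)) : ℝ) *
      inner ℝ (u l) (basisVec k) = u i k * entry lam u i i +
        ∑ l ∈ (Finset.Iic a).erase i, u l k * entry lam u i l := by
    rw [hset, Finset.add_sum_erase _ (fun l => u l k * entry lam u i l) (Finset.mem_Iic.2 hia)]
    refine Finset.sum_congr rfl fun l _ => ?_
    rw [real_inner_comm (basisVec k), inner_basisVec, entry, real_inner_comm (diagMul lam (u i)),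
      mul_comm]
  rw [h1]
  have h2 := hu.cross_le i a hia hat
  have h3 : |u i k * entry lam u i i| ≤ 2 * L / Real.sqrt n * (32 * L ^ 2 / Real.sqrt n) := by
    rw [abs_mul]
    have e1 := hu.coord_le i hit
    have e2 := hu.entry_le i i hit hit
    gcongr
  have h4 : 2 * L / Real.sqrt n * (32 * L ^ 2 / Real.sqrt n) = 64 * L ^ 3 / n := by
    rw [div_mul_div_comm, hsq]; ring
  have ht1 : 1 ≤ Real.sqrt t := by
    rw [Real.one_le_sqrt]
    exact_mod_cast (by omega : 1 ≤ t)
  have h5 : 64 * L ^ 3 / n ≤ 64 * L ^ 3 * Real.sqrt t / n := by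
    exact div_le_div_of_nonneg_right (le_mul_of_one_le_right (by positivity) ht1) hn0.le
  have h6 : 68 * L ^ 3 * Real.sqrt t / n = 64 * L ^ 3 * Real.sqrt t / n +
      4 * L ^ 3 * Real.sqrt t / n := by ring
  exact (abs_add_le _ _).trans (by linarith)

/-- The correlation deciding the conditional mean of the pair sign `(i, j)`. -/
lemma abs_integral_sgn_sub_le {i j : Fin n} (hL : 1 ≤ L) (hlam : ∀ m, |lam m| ≤ L) (hi : i < j)
    (hj : (j : ℕ) < t) (htn : t ≤ n) (hθ : frameError n t L ≤ 1 / 8) :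
    |sgn (u i k) * (∫ y, sgn (inner ℝ (residual u j (diagMul lam (u i))) y) *
      sgn (inner ℝ (residual u j (basisVec k)) y) ∂stdGaussian (Euc n)) -
      (2 / Real.pi * lam k * |u i k|)| ≤ driftError n t L := by
  have hn0 : (0 : ℝ) < n := by exact_mod_cast Fin.pos j
  have hsn : 0 < Real.sqrt n := Real.sqrt_pos.2 hn0
  have hsq : Real.sqrt n * Real.sqrt n = n := Real.mul_self_sqrt hn0.le
  have hit : (i : ℕ) < t := lt_trans hi hj
  have hreg := hu.isRegularAt hL hj hθ
  set a := residual u j (diagMul lam (u i)) with ha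
  set b := residual u j (basisVec k) with hb
  set θ := frameError n t L with hθdef
  have hθ0 : 0 ≤ θ := (abs_nonneg _).trans (hu.abs_norm_residual_basisVec_sq_sub_le hL hj)
  have hp : |‖a‖ * ‖b‖ - 1| ≤ θ := abs_mul_sub_one_le (norm_nonneg _) (norm_nonneg _)
    (hu.abs_norm_residual_diagMul_sq_sub_le hi hj) (hu.abs_norm_residual_basisVec_sq_sub_le hL hj)
    (by linarith)
  have hpinv := abs_inv_sub_one_le hp (by linarith)
  set N : ℝ := inner ℝ a b with hN
  have hNl : |N - lam k * u i k| ≤ 68 * L ^ 3 * Real.sqrt t / n :=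
    hu.abs_inner_residual_sub_le hL hi hj
  have hts : Real.sqrt t ≤ Real.sqrt n := Real.sqrt_le_sqrt (by exact_mod_cast htn)
  have hNabs : |N| ≤ 70 * L ^ 3 / Real.sqrt n := by
    have e1 : |lam k * u i k| ≤ 2 * L ^ 3 / Real.sqrt n := by
      rw [abs_mul]
      calc |lam k| * |u i k| ≤ L * (2 * L / Real.sqrt n) := by
            have := hlam k
            have := hu.coord_le i hit
            gcongr
        _ = 2 * L ^ 2 / Real.sqrt n := by ring
        _ ≤ _ := by
            have : L ^ 2 ≤ L ^ 3 := pow_le_pow_right₀ hL (by norm_num)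
            gcongr
    have e2 : 68 * L ^ 3 * Real.sqrt t / n ≤ 68 * L ^ 3 / Real.sqrt n := by
      rw [div_le_div_iff₀ hn0 hsn]
      calc 68 * L ^ 3 * Real.sqrt t * Real.sqrt n ≤ 68 * L ^ 3 * Real.sqrt n * Real.sqrt n := by
            gcongr
        _ = _ := by rw [mul_assoc, hsq]
    have e3 := abs_sub_abs_le_abs_sub N (lam k * u i k)
    have e4 : 70 * L ^ 3 / Real.sqrt n = 68 * L ^ 3 / Real.sqrt n + 2 * L ^ 3 / Real.sqrt n := by
      ring
    linarith
  set c : ℝ := N / (‖a‖ * ‖b‖) with hc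
  have hcN : c - N = N * (1 / (‖a‖ * ‖b‖) - 1) := by rw [hc]; ring
  have hcN' : |c - N| ≤ 140 * θ * L ^ 3 / Real.sqrt n := by
    rw [hcN, abs_mul]
    calc _ ≤ 70 * L ^ 3 / Real.sqrt n * (2 * θ) := by gcongr
      _ = _ := by ring
  have hcabs : |c| ≤ 140 * L ^ 3 / Real.sqrt n := by
    have e3 := abs_sub_abs_le_abs_sub c N
    have e4 : 140 * θ * L ^ 3 / Real.sqrt n ≤ 70 * L ^ 3 / Real.sqrt n := by
      gcongr
      linarith
    have e5 : 140 * L ^ 3 / Real.sqrt n = 70 * L ^ 3 / Real.sqrt n + 70 * L ^ 3 / Real.sqrt n := by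
      ring
    linarith
  have hL3 : L ^ 3 / Real.sqrt n ≤ 1 / 512 := by
    have e1 : 0 ≤ 1024 * t * L ^ 4 / n := by positivity
    have e2 : 64 * L ^ 3 / Real.sqrt n = 64 * (L ^ 3 / Real.sqrt n) := by ring
    have e3 : θ = 64 * L ^ 3 / Real.sqrt n + 1024 * t * L ^ 4 / n := rfl
    linarith
  have hchalf : |c| ≤ 1 / 2 := by
    have e1 : 140 * L ^ 3 / Real.sqrt n = 140 * (L ^ 3 / Real.sqrt n) := by ring
    linarith
  have ha0 : a ≠ 0 := by
    intro h0
    have := (hreg.1 i hi).1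
    rw [← ha, h0] at this
    norm_num at this
  have hshep := abs_integral_sgn_inner_sub_le ha0 hreg.2 hchalf
  rw [← hb, ← hN, ← hc] at hshep
  set I := ∫ y, sgn (inner ℝ a y) * sgn (inner ℝ b y) ∂stdGaussian (Euc n) with hI
  -- Three errors: the quadratic term of the sign expansion, the normalization of the residuals (`c
  -- - N`), and the cross sum (`N - lam k * u i k`). The constant `58800` in `driftError` is `3 *
  -- 140^2`.
  have hsplit : sgn (u i k) * I - 2 / Real.pi * lam k * |u i k| =
      sgn (u i k) * (I - 2 / Real.pi * c) + sgn (u i k) * (2 / Real.pi) * ((c - N) +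
        (N - lam k * u i k)) := by
    rw [← sgn_mul_eq_abs]; ring
  have hpi : 2 / Real.pi ≤ 1 := by rw [div_le_one Real.pi_pos]; linarith [Real.pi_gt_three]
  have hpi0 : 0 < 2 / Real.pi := by positivity
  have hc2 : 3 * c ^ 2 ≤ 58800 * L ^ 6 / n := by
    calc 3 * c ^ 2 ≤ 3 * (140 * L ^ 3 / Real.sqrt n) ^ 2 := by
          rw [← sq_abs c]
          gcongr
      _ = 58800 * L ^ 6 / (Real.sqrt n * Real.sqrt n) := by rw [div_pow]; ring
      _ = _ := by rw [hsq]
  rw [hsplit]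
  refine (abs_add_le _ _).trans ?_
  rw [abs_mul, abs_mul, abs_mul, abs_sgn, one_mul, one_mul, abs_of_pos hpi0]
  have e1 := abs_add_le (c - N) (N - lam k * u i k)
  have e2 : 2 / Real.pi * |c - N + (N - lam k * u i k)| ≤ |c - N + (N - lam k * u i k)| :=
    mul_le_of_le_one_left (abs_nonneg _) hpi
  unfold driftError
  linarith

end IsGoodFrame

lemma abs_condMean_sub_le {x : Fin n → Euc n} (hx : IsGoodFrame lam k L t (gramSchmidtNormed ℝ x))
    (hL : 1 ≤ L) (hlam : ∀ m, |lam m| ≤ L) {j : Fin n} (hj : (j : ℕ) < t) (htn : t ≤ n)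
    (hθ : frameError n t L ≤ 1 / 8) :
    |condMean lam k j x - 2 / Real.pi * lam k *
      (∑ i ∈ Finset.Iio j, |gramSchmidtNormed ℝ x i k|)| ≤ j * driftError n t L := by
  have hreg := hx.isRegularAt hL hj hθ
  set u := gramSchmidtNormed ℝ x with hu
  have h1 : condMean lam k j x = ∑ i ∈ Finset.Iio j, sgn (u i k) *
      ∫ y, sgn (inner ℝ (residual u j (diagMul lam (u i))) y) *
        sgn (inner ℝ (residual u j (basisVec k)) y) ∂stdGaussian (Euc n) := by
    rw [condMean, integral_congr_ae (ae_increment_update x hreg), integral_finsetSum]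
    · exact Finset.sum_congr rfl fun i _ => integral_const_mul _ _
    · intro i _
      exact (integrable_sgn_mul_sgn (by fun_prop) (by fun_prop)).const_mul _
  rw [h1, Finset.mul_sum, ← Finset.sum_sub_distrib]
  refine (Finset.abs_sum_le_sum_abs _ _).trans ?_
  calc _ ≤ ∑ _i ∈ Finset.Iio j, driftError n t L := Finset.sum_le_sum fun i hi =>
        hx.abs_integral_sgn_sub_le hL hlam (Finset.mem_Iio.1 hi) hj htn hθ
    _ = _ := by simp

/-- The sum of the pair signs over the pairs among the first `t` rows. -/
def signSum (lam : Fin n → ℝ) (k : Fin n) (t : ℕ) (u : Fin n → Euc n) : ℝ :=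
  ∑ j ∈ Finset.univ.filter (fun j : Fin n => (j : ℕ) < t), ∑ i ∈ Finset.Iio j, pairSign lam k u i j

lemma measurable_signSum (lam : Fin n → ℝ) (k : Fin n) (t : ℕ) :
    Measurable (signSum lam k t) :=
  Finset.measurable_sum _ fun j _ => Finset.measurable_sum _ fun i _ =>
    measurable_pairSign lam k i j

/-- The expected average pair sign for the eigenvalue `l`. -/
def meanSign (n : ℕ) (l : ℝ) : ℝ := 2 / Real.pi * l * (Real.sqrt (2 / Real.pi) / Real.sqrt n)

lemma sum_filter_lt_eq (htn : t ≤ n) (f : ℕ → ℝ) :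
    ∑ j ∈ Finset.univ.filter (fun j : Fin n => (j : ℕ) < t), f j = ∑ j ∈ Finset.range t, f j := by
  rw [Finset.sum_filter, Fin.sum_univ_eq_sum_range (fun j => if j < t then f j else 0) n,
    ← Finset.sum_filter]
  congr 1
  ext j
  simp only [Finset.mem_filter, Finset.mem_range]
  omega

lemma sum_range_cast (t : ℕ) : ∑ j ∈ Finset.range t, (j : ℝ) = t * (t - 1) / 2 := by
  induction t with
  | zero => simp
  | succ t ih => rw [Finset.sum_range_succ, ih]; push_cast; ring

/-- The error in the sum of the pair signs over the first `t` rows. -/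
def signError (n t : ℕ) (L τ : ℝ) : ℝ := L ^ 2 * τ + t ^ 2 * driftError n t L + 64 * L ^ 2 * t

lemma driftError_nonneg (n t : ℕ) (hL : 0 ≤ L) : 0 ≤ driftError n t L := by
  unfold driftError frameError; positivity

/-- The deviation splits into the martingale part, the error of the conditional means given the rows
before `j`, and the deviation of the partial column sums of `|u i k|` from `j √(2/π)/√n`; these are
the three terms of `signError`. -/
lemma abs_signSum_sub_le {x : Fin n → Euc n} (hx : IsGoodFrame lam k L t (gramSchmidtNormed ℝ x))
    (hL : 1 ≤ L) (hlam : ∀ m, |lam m| ≤ L) (htn : t ≤ n) (hθ : frameError n t L ≤ 1 / 8) {τ : ℝ}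
    (hM : |martingalePart lam k t x| ≤ L ^ 2 * τ) :
    |signSum lam k t (gramSchmidtNormed ℝ x) - t * (t - 1) / 2 * meanSign n (lam k)| ≤
      signError n t L τ := by
  set u := gramSchmidtNormed ℝ x with hu
  set F := Finset.univ.filter (fun j : Fin n => (j : ℕ) < t) with hF
  have hmem : ∀ j ∈ F, (j : ℕ) < t := fun j hj => (Finset.mem_filter.1 hj).2
  set r := Real.sqrt (2 / Real.pi) / Real.sqrt n with hr
  have h1 : signSum lam k t u = martingalePart lam k t x + ∑ j ∈ F, condMean lam k j x := by
    rw [martingalePart, signSum, Finset.sum_sub_distrib, sub_add_cancel]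
    refine Finset.sum_congr rfl fun j hj => ?_
    -- Every row below `t` of a good frame is regular, so the cut-off sum is the true one.
    rw [increment, rowSum, if_pos (hx.isRegularAt hL (hmem j hj) hθ)]
  have h2 : (t : ℝ) * (t - 1) / 2 * meanSign n (lam k) =
      ∑ j ∈ F, 2 / Real.pi * lam k * (j * r) := by
    rw [← sum_range_cast, ← sum_filter_lt_eq htn (fun j => (j : ℝ)), Finset.sum_mul, meanSign]
    exact Finset.sum_congr rfl fun j _ => by rw [hr]; ring
  have h3 : signSum lam k t u - t * (t - 1) / 2 * meanSign n (lam k) =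
      martingalePart lam k t x + ∑ j ∈ F, ((condMean lam k j x - 2 / Real.pi * lam k *
        ∑ i ∈ Finset.Iio j, |u i k|) + 2 / Real.pi * lam k *
          (∑ i ∈ Finset.Iio j, |u i k| - j * r)) := by
    rw [h1, h2, add_sub_assoc, ← Finset.sum_sub_distrib]
    congr 1
    exact Finset.sum_congr rfl fun j _ => by ring
  have hpi : 2 / Real.pi ≤ 1 := by rw [div_le_one Real.pi_pos]; linarith [Real.pi_gt_three]
  have hpi0 : 0 < 2 / Real.pi := by positivity
  have hd := driftError_nonneg n t (by linarith : 0 ≤ L)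
  have h4 : ∀ j ∈ F, |(condMean lam k j x - 2 / Real.pi * lam k *
        ∑ i ∈ Finset.Iio j, |u i k|) + 2 / Real.pi * lam k *
          (∑ i ∈ Finset.Iio j, |u i k| - j * r)| ≤ t * driftError n t L + 64 * L ^ 2 := by
    intro j hj
    refine (abs_add_le _ _).trans (add_le_add ?_ ?_)
    · refine (abs_condMean_sub_le hx hL hlam (hmem j hj) htn hθ).trans ?_
      have := (hmem j hj).le
      gcongr
    · rw [abs_mul, abs_mul, abs_of_pos hpi0]
      have e1 := hx.sum_le j (hmem j hj)
      have e2 := hlam k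
      calc _ ≤ 1 * L * (64 * L) := by gcongr
        _ = _ := by ring
  have hcard : (F.card : ℝ) = t := by
    have := sum_filter_lt_eq htn (fun _ => (1 : ℝ))
    simpa using this
  rw [h3, signError, add_assoc]
  refine (abs_add_le _ _).trans (add_le_add hM ?_)
  refine (Finset.abs_sum_le_sum_abs _ _).trans ((Finset.sum_le_sum h4).trans ?_)
  rw [Finset.sum_const, nsmul_eq_mul, hcard]
  exact le_of_eq (by ring)

/-- Concentration of the sum of the pair signs over the first `t` rows. -/
lemma IsHaarFrameLaw.measureReal_abs_signSum_gt_le {ν : Measure (Fin n → Euc n)}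
    (hν : IsHaarFrameLaw ν) (hL : 1 ≤ L) (hLn : 32 * L ≤ Real.sqrt n)
    (ht : (t : ℝ) * L ^ 2 ≤ n / 4) (htn : t ≤ n) (hθ : frameError n t L ≤ 1 / 8)
    (hlam : ∀ m, |lam m| ≤ L) (hsum : ∑ m, lam m = 0) (hsum2 : ∑ m, lam m ^ 2 = n) (k : Fin n)
    {τ : ℝ} (hτ0 : 0 < τ) (hτ : 2 * t ≤ τ) (hτ2 : (t : ℝ) ^ 2 * Real.sqrt t ≤ τ ^ 2) :
    ν.real {u | signError n t L τ < |signSum lam k t u - t * (t - 1) / 2 * meanSign n (lam k)|} ≤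
      6 * n ^ 2 * tailBound n L + 2 * Real.exp (6 - L) := by
  have hs : MeasurableSet {u : Fin n → Euc n | signError n t L τ <
      |signSum lam k t u - t * (t - 1) / 2 * meanSign n (lam k)|} := by
    have := measurable_signSum lam k t
    exact measurableSet_lt measurable_const (Measurable.abs (this.sub_const _))
  have h1 := hν.measureReal_not_isGoodFrame_le hL hLn ht hlam hsum hsum2 k
  have h2 := measureReal_abs_martingalePart_ge_le (k := k) hL hlam htn hτ0 hτ hτ2
  have h3 : (gaussianRows n).real {x | ¬ IsGoodFrame lam k L t (gramSchmidtNormed ℝ x)} ≤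
      ν.real {u | ¬ IsGoodFrame lam k L t u} := by
    rw [← hν.map_gramSchmidtNormed]
    refine ENNReal.toReal_mono ?_ ?_
    · have : IsProbabilityMeasure ((gaussianRows n).map fun x => gramSchmidtNormed ℝ x) :=
        Measure.isProbabilityMeasure_map measurable_gramSchmidtNormed.aemeasurable
      exact measure_ne_top _ _
    · exact Measure.le_map_apply measurable_gramSchmidtNormed.aemeasurable _
  rw [← hν.map_gramSchmidtNormed, map_measureReal_apply measurable_gramSchmidtNormed hs]
  have hsub : (fun x => gramSchmidtNormed ℝ x) ⁻¹' {u : Fin n → Euc n | signError n t L τ <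
      |signSum lam k t u - t * (t - 1) / 2 * meanSign n (lam k)|} ⊆
      {x | ¬ IsGoodFrame lam k L t (gramSchmidtNormed ℝ x)} ∪
        {x | L ^ 2 * τ ≤ |martingalePart lam k t x|} := by
    intro x hx
    by_contra hcon
    simp only [Set.mem_union, not_or] at hcon
    obtain ⟨c1, c2⟩ := hcon
    have c1' : IsGoodFrame lam k L t (gramSchmidtNormed ℝ x) := not_not.1 c1
    have c2' : ¬ L ^ 2 * τ ≤ |martingalePart lam k t x| := c2
    have hx' : signError n t L τ < |signSum lam k t (gramSchmidtNormed ℝ x) -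
      t * (t - 1) / 2 * meanSign n (lam k)| := hx
    exact absurd (abs_signSum_sub_le c1' hL hlam htn hθ (not_le.1 c2').le) (not_le.2 hx')
  have h4 := (measureReal_mono (μ := gaussianRows n) hsub).trans
      (measureReal_union_le _ _)
  linarith

end NodalCount
end

/-! ### From the first `t` rows to all rows, by permutation averaging. -/

noncomputable section

namespace NodalCount

variable {n : ℕ} {lam : Fin n → ℝ} {t : ℕ} {k : Fin n}

lemma exists_perm_apply_pair {α : Type*} [DecidableEq α] {i j i' j' : α} (h : i ≠ j)
    (h' : i' ≠ j') : ∃ σ : Equiv.Perm α, σ i = i' ∧ σ j = j' := by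
  have h1 : Equiv.swap i i' j ≠ i' := fun e => h
    ((Equiv.swap i i').injective (e.trans (Equiv.swap_apply_left i i').symm)).symm
  refine ⟨Equiv.swap (Equiv.swap i i' j) j' * Equiv.swap i i', ?_, ?_⟩
  · rw [Equiv.Perm.mul_apply, Equiv.swap_apply_left, Equiv.swap_apply_of_ne_of_ne h1.symm h']
  · rw [Equiv.Perm.mul_apply, Equiv.swap_apply_left]

lemma sum_perm_apply_pair {α : Type*} [DecidableEq α] [Fintype α] (f : α → α → ℝ) {i j i' j' : α}
    (h : i ≠ j) (h' : i' ≠ j') :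
    ∑ π : Equiv.Perm α, f (π i) (π j) = ∑ π : Equiv.Perm α, f (π i') (π j') := by
  obtain ⟨σ, rfl, rfl⟩ := exists_perm_apply_pair h h'
  exact (Equiv.sum_comp (Equiv.mulRight σ) fun π : Equiv.Perm α => f (π i) (π j)).symm

lemma sum_sum_eq_two_mul_add {f : Fin n → Fin n → ℝ} (hf : ∀ i j, f i j = f j i) :
    ∑ j, ∑ i, f i j = 2 * ∑ j, ∑ i ∈ Finset.Iio j, f i j + ∑ j, f j j := by
  have h1 : ∀ j, ∑ i, f i j = ∑ i ∈ Finset.Iio j, f i j + f j j + ∑ i ∈ Finset.Ioi j, f i j := by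
    intro j
    have e : (Finset.univ : Finset (Fin n)) = Finset.Iic j ∪ Finset.Ioi j := by
      ext i; simp [le_or_gt]
    have e2 : Finset.Iic j = insert j (Finset.Iio j) := by
      ext i; simp [le_iff_eq_or_lt]
    rw [e, Finset.sum_union, e2, Finset.sum_insert (by simp), add_comm (f j j)]
    rw [Finset.disjoint_left]
    intro i hi hi'
    exact absurd (Finset.mem_Iic.1 hi) (not_le.2 (Finset.mem_Ioi.1 hi'))
  have h2 : ∑ j, ∑ i ∈ Finset.Ioi j, f i j = ∑ j, ∑ i ∈ Finset.Iio j, f i j := by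
    rw [Finset.sum_comm' (t' := Finset.univ) (s' := fun i => Finset.Iio i) (by simp)]
    exact Finset.sum_congr rfl fun j _ => Finset.sum_congr rfl fun i _ => hf _ _
  simp_rw [h1, Finset.sum_add_distrib, h2]
  ring

/-- Pair signs are symmetric, so the sum over `i < j` is half of the full double sum without its
diagonal, and both of those are invariant under relabelling. -/
lemma signSum_comp_perm (u : Fin n → Euc n) (π : Equiv.Perm (Fin n)) :
    signSum lam k n (u ∘ π) = signSum lam k n u := by
  have h0 : ∀ w : Fin n → Euc n, signSum lam k n w =
      ∑ j, ∑ i ∈ Finset.Iio j, pairSign lam k w i j := fun w => by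
    rw [signSum, Finset.filter_true_of_mem fun j _ => j.2]
  have h1 := sum_sum_eq_two_mul_add (pairSign_comm lam k (u ∘ π))
  have h2 := sum_sum_eq_two_mul_add (pairSign_comm lam k u)
  have h3 : ∑ j, ∑ i, pairSign lam k (u ∘ π) i j = ∑ j, ∑ i, pairSign lam k u i j := by
    rw [← Equiv.sum_comp π fun j => ∑ i, pairSign lam k u i j]
    exact Finset.sum_congr rfl fun j _ =>
      Equiv.sum_comp π fun i => pairSign lam k u i (π j)
  have h4 : ∑ j, pairSign lam k (u ∘ π) j j = ∑ j, pairSign lam k u j j :=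
    Equiv.sum_comp π fun j => pairSign lam k u j j
  rw [h0, h0]
  linarith

lemma sum_card_Iio (htn : t ≤ n) :
    ∑ j ∈ Finset.univ.filter (fun j : Fin n => (j : ℕ) < t), (j : ℝ) = t * (t - 1) / 2 := by
  rw [sum_filter_lt_eq htn (fun j => (j : ℝ)), sum_range_cast]

/-- Permutations act transitively on ordered pairs of distinct indices, so each pair contributes the
same permutation sum. -/
lemma sum_perm_signSum (htn : t ≤ n) (u : Fin n → Euc n) {a b : Fin n} (hab : a ≠ b) :
    ∑ π : Equiv.Perm (Fin n), signSum lam k t (u ∘ π) =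
      t * (t - 1) / 2 * ∑ π : Equiv.Perm (Fin n), pairSign lam k u (π a) (π b) := by
  unfold signSum
  rw [Finset.sum_comm, ← sum_card_Iio htn, Finset.sum_mul]
  refine Finset.sum_congr rfl fun j _ => ?_
  rw [Finset.sum_comm]
  have h : ∀ i ∈ Finset.Iio j, ∑ π : Equiv.Perm (Fin n), pairSign lam k (u ∘ π) i j =
      ∑ π : Equiv.Perm (Fin n), pairSign lam k u (π a) (π b) := fun i hi =>
    sum_perm_apply_pair (pairSign lam k u) (Finset.mem_Iio.1 hi).ne hab
  rw [Finset.sum_congr rfl h]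
  simp

lemma abs_signSum_le (htn : t ≤ n) (u : Fin n → Euc n) :
    |signSum lam k t u| ≤ t * (t - 1) / 2 := by
  rw [← sum_card_Iio htn]
  refine (Finset.abs_sum_le_sum_abs _ _).trans (Finset.sum_le_sum fun j _ => ?_)
  refine (Finset.abs_sum_le_sum_abs _ _).trans ?_
  simp [pairSign]

/-- The full average of the pair signs is the average over all permutations of the rows of the
average over the pairs among the first `t` rows. -/
lemma signSum_sub_eq_sum_perm (ht : 2 ≤ t) (htn : t ≤ n) (u : Fin n → Euc n) (m : ℝ) :
    t * (t - 1) / 2 * (n.factorial * (signSum lam k n u - n * (n - 1) / 2 * m)) =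
      n * (n - 1) / 2 * ∑ π : Equiv.Perm (Fin n),
        (signSum lam k t (u ∘ π) - t * (t - 1) / 2 * m) := by
  have hab : (⟨0, by omega⟩ : Fin n) ≠ ⟨1, by omega⟩ := by simp
  have h1 := sum_perm_signSum (lam := lam) (k := k) htn u hab
  have h2 := sum_perm_signSum (lam := lam) (k := k) le_rfl u hab
  simp_rw [signSum_comp_perm] at h2
  rw [Finset.sum_const, nsmul_eq_mul, Finset.card_univ, Fintype.card_perm, Fintype.card_fin] at h2
  rw [Finset.sum_sub_distrib, h1, mul_sub (n.factorial : ℝ), h2, Finset.sum_const, nsmul_eq_mul,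
    Finset.card_univ, Fintype.card_perm, Fintype.card_fin]
  ring

/-- If the full average deviates by `2η`, permutations with deviation at most `η` cannot account for
it, so at least a fraction `η/2` of all permutations is bad. By exchangeability the expected
fraction of bad permutations is the probability that the first `t` rows are bad, and Markov's
inequality concludes. -/
lemma IsHaarFrameLaw.mul_measureReal_signSum_gt_le {ν : Measure (Fin n → Euc n)}
    (hν : IsHaarFrameLaw ν) (ht : 2 ≤ t) (htn : t ≤ n) {m η : ℝ} (hm : |m| ≤ 1) (hη : 0 < η) :
    η * ν.real {u | 2 * η * (n * (n - 1) / 2) < |signSum lam k n u - n * (n - 1) / 2 * m|} ≤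
      2 * ν.real {u | η * (t * (t - 1) / 2) < |signSum lam k t u - t * (t - 1) / 2 * m|} := by
  classical
  have := hν.isProbabilityMeasure
  set N : ℝ := n * (n - 1) / 2 with hN
  set T : ℝ := t * (t - 1) / 2 with hT
  have ht' : (2 : ℝ) ≤ t := by exact_mod_cast ht
  have htn' : (t : ℝ) ≤ n := by exact_mod_cast htn
  have hT0 : 0 < T := by rw [hT]; nlinarith
  have hN0 : 0 < N := by rw [hN]; nlinarith
  set B := {u : Fin n → Euc n | η * T < |signSum lam k t u - T * m|} with hB
  have hBm : MeasurableSet B :=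
    measurableSet_lt measurable_const (((measurable_signSum lam k t).sub_const _).abs)
  have hperm : ∀ π : Equiv.Perm (Fin n), Measurable fun u : Fin n → Euc n => u ∘ π :=
    fun π => measurable_pi_lambda _ fun i => measurable_pi_apply _
  set F : (Fin n → Euc n) → ℝ := fun u =>
    ∑ π : Equiv.Perm (Fin n), Set.indicator B (fun _ => (1 : ℝ)) (u ∘ π) with hF
  have hfac : (0 : ℝ) < n.factorial := by exact_mod_cast n.factorial_pos
  have hind : ∀ u, 0 ≤ Set.indicator B (fun _ => (1 : ℝ)) u := fun u =>
    Set.indicator_nonneg (fun _ _ => zero_le_one) _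
  have hFsub : {u | 2 * η * N < |signSum lam k n u - N * m|} ⊆
      {u | η / 2 * n.factorial ≤ F u} := by
    intro u hu
    have hu' : 2 * η * N < |signSum lam k n u - N * m| := hu
    have key := signSum_sub_eq_sum_perm (lam := lam) (k := k) ht htn u m
    rw [← hN, ← hT] at key
    -- Signs and `m` are bounded by `1`, so a bad permutation contributes at most `2T`.
    have hb : ∀ π : Equiv.Perm (Fin n), |signSum lam k t (u ∘ π) - T * m| ≤
        η * T + 2 * T * Set.indicator B (fun _ => (1 : ℝ)) (u ∘ π) := by
      intro π
      by_cases hπ : u ∘ π ∈ B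
      · rw [Set.indicator_of_mem hπ]
        have e1 := abs_signSum_le (lam := lam) (k := k) htn (u ∘ π)
        have e2 := abs_sub (signSum lam k t (u ∘ π)) (T * m)
        rw [abs_mul, abs_of_pos hT0] at e2
        have e3 : T * |m| ≤ T := mul_le_of_le_one_right hT0.le hm
        have : 0 < η * T := by positivity
        rw [← hT] at e1
        linarith
      · rw [Set.indicator_of_notMem hπ]
        have : ¬ η * T < |signSum lam k t (u ∘ π) - T * m| := hπ
        linarith
    have h1 : T * (n.factorial * |signSum lam k n u - N * m|) ≤
        N * (n.factorial * (η * T) + 2 * T * F u) := by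
      have h2 : T * (n.factorial * |signSum lam k n u - N * m|) =
          |T * (n.factorial * (signSum lam k n u - N * m))| := by
        rw [abs_mul, abs_mul, abs_of_pos hT0, abs_of_pos hfac]
      rw [h2, key, abs_mul, abs_of_pos hN0]
      refine mul_le_mul_of_nonneg_left ?_ hN0.le
      refine (Finset.abs_sum_le_sum_abs _ _).trans ((Finset.sum_le_sum fun π _ => hb π).trans ?_)
      rw [Finset.sum_add_distrib, Finset.sum_const, nsmul_eq_mul, Finset.card_univ,
        Fintype.card_perm, Fintype.card_fin, hF, Finset.mul_sum]
    have h3 : T * (n.factorial * (2 * η * N)) <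
        T * (n.factorial * |signSum lam k n u - N * m|) := by
      gcongr
    have h4 : T * N * (n.factorial * η) < T * N * (2 * F u) := by linarith
    have h5 := lt_of_mul_lt_mul_left h4 (by positivity)
    change η / 2 * n.factorial ≤ F u
    linarith
  have hint : ∀ π : Equiv.Perm (Fin n),
      Integrable (fun u => Set.indicator B (fun _ => (1 : ℝ)) (u ∘ π)) ν := fun π => by
    refine Integrable.of_bound
      ((measurable_const.indicator hBm).comp (hperm π)).aestronglyMeasurable
      1 (Eventually.of_forall fun u => ?_)
    rw [Real.norm_of_nonneg (hind _)]
    exact Set.indicator_le_self' (fun _ _ => zero_le_one) _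
  have hFint : Integrable F ν := integrable_finsetSum _ fun π _ => hint π
  have hF0 : 0 ≤ᵐ[ν] F := Eventually.of_forall fun u => Finset.sum_nonneg fun π _ => hind _
  have hInt : ∫ u, F u ∂ν = n.factorial * ν.real B := by
    rw [hF, integral_finsetSum _ fun π _ => hint π]
    have : ∀ π : Equiv.Perm (Fin n),
        ∫ u, Set.indicator B (fun _ => (1 : ℝ)) (u ∘ π) ∂ν = ν.real B := fun π => by
      rw [← hν.measureReal_perm π hBm]
      exact integral_indicator_one ((hperm π) hBm)
    simp_rw [this]
    rw [Finset.sum_const, nsmul_eq_mul, Finset.card_univ, Fintype.card_perm, Fintype.card_fin]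
  have hmk := mul_meas_ge_le_integral_of_nonneg hF0 hFint (η / 2 * n.factorial)
  rw [hInt] at hmk
  have hmono := measureReal_mono (μ := ν) hFsub
  have h6 : n.factorial * (η / 2 * ν.real {u | η / 2 * n.factorial ≤ F u}) ≤
      n.factorial * ν.real B := by linarith
  have h7 := le_of_mul_le_mul_left h6 hfac
  have h8 : η * ν.real {u | 2 * η * N < |signSum lam k n u - N * m|} ≤
      η * ν.real {u | η / 2 * n.factorial ≤ F u} := by gcongr
  linarith

end NodalCount
end

/-! ### Choice of parameters and summability of the exceptional probabilities. -/

noncomputable section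

namespace NodalCount

variable {n : ℕ}

/-- A slowly growing bound for the normalized eigenvalues. -/
def spectralCutoff (n : ℕ) : ℝ := (n : ℝ) ^ (1 / 100 : ℝ)

lemma spectralCutoff_nonneg (n : ℕ) : 0 ≤ spectralCutoff n := by unfold spectralCutoff; positivity

lemma spectralCutoff_pow (n : ℕ) : spectralCutoff n ^ 100 = n := by
  rw [spectralCutoff, ← Real.rpow_natCast, ← Real.rpow_mul (Nat.cast_nonneg n)]
  norm_num

lemma spectralCutoff_pow_fifty (n : ℕ) : spectralCutoff n ^ 50 = Real.sqrt n := by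
  rw [← spectralCutoff_pow n, show spectralCutoff n ^ 100 = (spectralCutoff n ^ 50) ^ 2 by ring,
    Real.sqrt_sq (pow_nonneg (spectralCutoff_nonneg n) _)]

lemma tendsto_spectralCutoff : Tendsto spectralCutoff atTop atTop :=
  (tendsto_rpow_atTop (by norm_num)).comp tendsto_natCast_atTop_atTop

/-- The tolerated deviation of the average pair sign from its mean. -/
def deviation (n : ℕ) : ℝ := 10 ^ 6 / (spectralCutoff n * Real.sqrt n)

lemma frameError_le {L : ℝ} {t : ℕ} (hL : 2 ≤ L) (hn : L ^ 100 = n) (hsn : L ^ 50 = Real.sqrt n)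
    (ht : (t : ℝ) ≤ L ^ 80) : frameError n t L ≤ 1088 / L ^ 16 := by
  have hL0 : 0 < L := by linarith
  have h1 : 64 * L ^ 3 / L ^ 50 ≤ 64 / L ^ 16 := by
    rw [div_le_div_iff₀ (by positivity) (by positivity)]
    calc 64 * L ^ 3 * L ^ 16 = 64 * L ^ 19 := by ring
      _ ≤ 64 * L ^ 50 := by gcongr <;> [linarith; norm_num]
  have h2 : 1024 * t * L ^ 4 / L ^ 100 ≤ 1024 / L ^ 16 := by
    rw [div_le_div_iff₀ (by positivity) (by positivity)]
    calc 1024 * t * L ^ 4 * L ^ 16 ≤ 1024 * L ^ 80 * L ^ 4 * L ^ 16 := by gcongr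
      _ = 1024 * L ^ 100 := by ring
  have h3 : (1088 : ℝ) / L ^ 16 = 64 / L ^ 16 + 1024 / L ^ 16 := by ring
  rw [frameError, ← hsn, ← hn, h3]
  exact add_le_add h1 h2

lemma driftError_le {L : ℝ} {t : ℕ} (hL : 2 ≤ L) (hn : L ^ 100 = n) (hsn : L ^ 50 = Real.sqrt n)
    (ht : (t : ℝ) ≤ L ^ 80) : driftError n t L ≤ 240000 / (L * L ^ 50) := by
  have hL0 : 0 < L := by linarith
  have hL1 : 1 ≤ L := by linarith
  have hts : Real.sqrt t ≤ L ^ 40 := by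
    rw [show L ^ 40 = Real.sqrt (L ^ 80) by
      rw [show L ^ 80 = (L ^ 40) ^ 2 by ring, Real.sqrt_sq (by positivity)]]
    exact Real.sqrt_le_sqrt ht
  have h1 : 140 * frameError n t L * L ^ 3 / L ^ 50 ≤ 160000 / (L * L ^ 50) := by
    rw [div_le_div_iff₀ (by positivity) (by positivity)]
    calc 140 * frameError n t L * L ^ 3 * (L * L ^ 50)
        ≤ 140 * (1088 / L ^ 16) * L ^ 3 * (L * L ^ 50) := by
          gcongr
          exact frameError_le hL hn hsn ht
      _ = 152320 * (L ^ 54 / L ^ 16) := by ring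
      _ ≤ 160000 * L ^ 50 := by
          rw [← mul_div_assoc, div_le_iff₀ (by positivity)]
          calc 152320 * L ^ 54 ≤ 160000 * L ^ 66 := by gcongr <;> norm_num
            _ = _ := by ring
  have h2 : 68 * L ^ 3 * Real.sqrt t / L ^ 100 ≤ 68 / (L * L ^ 50) := by
    rw [div_le_div_iff₀ (by positivity) (by positivity)]
    calc 68 * L ^ 3 * Real.sqrt t * (L * L ^ 50) ≤ 68 * L ^ 3 * L ^ 40 * (L * L ^ 50) := by gcongr
      _ = 68 * L ^ 94 := by ring
      _ ≤ 68 * L ^ 100 := by gcongr; norm_num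
  have h3 : 58800 * L ^ 6 / L ^ 100 ≤ 58800 / (L * L ^ 50) := by
    rw [div_le_div_iff₀ (by positivity) (by positivity)]
    calc 58800 * L ^ 6 * (L * L ^ 50) = 58800 * L ^ 57 := by ring
      _ ≤ 58800 * L ^ 100 := by gcongr; norm_num
  have h4 : (240000 : ℝ) / (L * L ^ 50) = 160000 / (L * L ^ 50) + 68 / (L * L ^ 50) +
      58800 / (L * L ^ 50) + 21132 / (L * L ^ 50) := by ring
  have h5 : 0 ≤ 21132 / (L * L ^ 50) := by positivity
  rw [driftError, ← hsn, ← hn, h4]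
  linarith

/-- With `t = m^4 ≈ L^80`, `τ = m^5 = t^(5/4)` and `√n = L^50`, the martingale term relative to
`t^2` is about `L^2 t^(-3/4) ≈ L^(-58)`, below the target `L^(-51)`. The drift term is handled by
`driftError_le`, and the column term is about `L^(-78)`. -/
lemma signError_le {L m : ℝ} {t : ℕ} (hL : 2 ≤ L) (hn : L ^ 100 = n) (hsn : L ^ 50 = Real.sqrt n)
    (htm : (t : ℝ) = m ^ 4) (hm1 : L ^ 20 / 2 ≤ m) (hm2 : m ≤ L ^ 20) :
    signError n t L (m ^ 5) ≤ 10 ^ 6 / (L * L ^ 50) * ((t : ℝ) * (t - 1) / 2) := by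
  have hL0 : 0 < L := by linarith
  have hL1 : 1 ≤ L := by linarith
  have hm0 : 0 < m := lt_of_lt_of_le (by positivity) hm1
  have ht : (t : ℝ) ≤ L ^ 80 := by
    rw [htm]
    calc m ^ 4 ≤ (L ^ 20) ^ 4 := by gcongr
      _ = _ := by ring
  have hm3 : 2 ≤ m := by
    have : (2 : ℝ) ^ 20 ≤ L ^ 20 := by gcongr
    norm_num at this
    linarith
  have ht2 : (2 : ℝ) ≤ t := by
    rw [htm]
    calc (2 : ℝ) ≤ 2 ^ 4 := by norm_num
      _ ≤ m ^ 4 := by gcongr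
  have hT : (t : ℝ) ^ 2 / 4 ≤ (t : ℝ) * (t - 1) / 2 := by nlinarith
  have h1 : L ^ 2 * m ^ 5 ≤ 32 / (L * L ^ 50) * t ^ 2 := by
    rw [div_mul_eq_mul_div, le_div_iff₀ (by positivity), htm]
    calc L ^ 2 * m ^ 5 * (L * L ^ 50) = L ^ 53 * m ^ 5 := by ring
      _ ≤ L ^ 60 * m ^ 5 := by gcongr; norm_num
      _ = 8 * (L ^ 20 / 2) ^ 3 * m ^ 5 := by ring
      _ ≤ 32 * m ^ 3 * m ^ 5 := by gcongr; norm_num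
      _ = _ := by ring
  have h2 : 64 * L ^ 2 * t ≤ 1024 / (L * L ^ 50) * t ^ 2 := by
    rw [div_mul_eq_mul_div, le_div_iff₀ (by positivity)]
    have : L ^ 80 ≤ 16 * t := by
      calc L ^ 80 = 16 * (L ^ 20 / 2) ^ 4 := by ring
        _ ≤ 16 * m ^ 4 := by gcongr
        _ = _ := by rw [htm]
    calc 64 * L ^ 2 * t * (L * L ^ 50) = 64 * L ^ 53 * t := by ring
      _ ≤ 64 * L ^ 80 * t := by gcongr; norm_num
      _ ≤ 64 * (16 * t) * t := by gcongr
      _ = _ := by ring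
  have h3 : (t : ℝ) ^ 2 * driftError n t L ≤ 240000 / (L * L ^ 50) * t ^ 2 := by
    rw [mul_comm]
    gcongr
    exact driftError_le hL hn hsn ht
  have h4 : 10 ^ 6 / (L * L ^ 50) * ((t : ℝ) ^ 2 / 4) ≤
      10 ^ 6 / (L * L ^ 50) * ((t : ℝ) * (t - 1) / 2) := by gcongr
  have h5 : 10 ^ 6 / (L * L ^ 50) * ((t : ℝ) ^ 2 / 4) = 32 / (L * L ^ 50) * t ^ 2 +
      1024 / (L * L ^ 50) * t ^ 2 + 240000 / (L * L ^ 50) * t ^ 2 +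
      8944 / (L * L ^ 50) * t ^ 2 := by ring
  have h6 : 0 ≤ 8944 / (L * L ^ 50) * (t : ℝ) ^ 2 := by positivity
  unfold signError
  linarith

lemma abs_meanSign_le {l L : ℝ} (hl : |l| ≤ L) (hLn : L ≤ Real.sqrt n) : |meanSign n l| ≤ 1 := by
  have hpi : 2 / Real.pi ≤ 1 := by rw [div_le_one Real.pi_pos]; linarith [Real.pi_gt_three]
  have hpi0 : 0 < 2 / Real.pi := by positivity
  have hs : Real.sqrt (2 / Real.pi) ≤ 1 := Real.sqrt_le_one.2 hpi
  have hL0 : 0 ≤ L := (abs_nonneg _).trans hl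
  rw [meanSign, abs_mul, abs_mul, abs_of_pos hpi0,
    abs_of_nonneg (by positivity : 0 ≤ Real.sqrt (2 / Real.pi) / Real.sqrt n)]
  calc 2 / Real.pi * |l| * (Real.sqrt (2 / Real.pi) / Real.sqrt n)
      ≤ 1 * Real.sqrt n * (1 / Real.sqrt n) := by
        gcongr
        exact hl.trans hLn
    _ = Real.sqrt n / Real.sqrt n := by ring
    _ ≤ 1 := div_self_le_one _

/-- The bound for the probability that some average pair sign deviates from its mean. -/
def deviationProb (n : ℕ) : ℝ :=
  n * (spectralCutoff n * Real.sqrt n * (6 * n ^ 2 * tailBound n (spectralCutoff n) +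
    2 * Real.exp (6 - spectralCutoff n)))

lemma IsHaarFrameLaw.measureReal_deviation_lt_le {ν : Measure (Fin n → Euc n)}
    (hν : IsHaarFrameLaw ν) {lam : Fin n → ℝ} (hL : 2 ≤ spectralCutoff n)
    (hlam : ∀ m, |lam m| ≤ spectralCutoff n) (hsum : ∑ m, lam m = 0)
    (hsum2 : ∑ m, lam m ^ 2 = n) (k : Fin n) :
    ν.real {u | 2 * deviation n * (n * (n - 1) / 2) <
      |signSum lam k n u - n * (n - 1) / 2 * meanSign n (lam k)|} ≤
      spectralCutoff n * Real.sqrt n * (6 * n ^ 2 * tailBound n (spectralCutoff n) +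
        2 * Real.exp (6 - spectralCutoff n)) := by
  have hn := spectralCutoff_pow n
  have hsn := spectralCutoff_pow_fifty n
  have hdev : deviation n = 10 ^ 6 / (spectralCutoff n * spectralCutoff n ^ 50) := by
    rw [hsn, deviation]
  set L := spectralCutoff n
  have hL0 : 0 < L := by linarith
  have hL1 : 1 ≤ L := by linarith
  have hLp : ∀ p : ℕ, 2 ^ p ≤ L ^ p := fun p => by gcongr
  -- Taking `t = m^4` a fourth power makes `τ = m^5` satisfy `t^2 √t = τ^2` with equality.
  set m : ℕ := ⌊L ^ 20⌋₊ with hm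
  have hm2 : (m : ℝ) ≤ L ^ 20 := Nat.floor_le (by positivity)
  have hm1 : L ^ 20 / 2 ≤ m := by
    have h1 := Nat.lt_floor_add_one (L ^ 20)
    have h2 := hLp 20
    norm_num at h2
    rw [← hm] at h1
    linarith
  have hm3 : (2 : ℝ) ≤ m := by
    have h2 := hLp 20
    norm_num at h2
    linarith
  have htm : ((m ^ 4 : ℕ) : ℝ) = (m : ℝ) ^ 4 := by push_cast; ring
  have ht80 : ((m ^ 4 : ℕ) : ℝ) ≤ L ^ 80 := by
    rw [htm]
    calc (m : ℝ) ^ 4 ≤ (L ^ 20) ^ 4 := by gcongr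
      _ = _ := by ring
  have ht2 : 2 ≤ m ^ 4 := by
    have : 2 ≤ m := by exact_mod_cast hm3
    calc 2 ≤ 2 ^ 4 := by norm_num
      _ ≤ m ^ 4 := by gcongr
  have htn : m ^ 4 ≤ n := by
    have : ((m ^ 4 : ℕ) : ℝ) ≤ n := by
      rw [← hn]
      exact ht80.trans (pow_le_pow_right₀ hL1 (by norm_num))
    exact_mod_cast this
  have hLn : 32 * L ≤ Real.sqrt n := by
    rw [← hsn]
    have := hLp 49
    calc 32 * L ≤ L ^ 49 * L := by gcongr; norm_num at this ⊢; linarith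
      _ = _ := by ring
  have htL : ((m ^ 4 : ℕ) : ℝ) * L ^ 2 ≤ n / 4 := by
    rw [← hn, le_div_iff₀ (by norm_num)]
    have := hLp 18
    calc ((m ^ 4 : ℕ) : ℝ) * L ^ 2 * 4 ≤ L ^ 80 * L ^ 2 * L ^ 18 := by
          gcongr
          norm_num at this
          linarith
      _ = _ := by ring
  have hθ : frameError n (m ^ 4) L ≤ 1 / 8 := by
    refine (frameError_le hL hn hsn ht80).trans ?_
    rw [div_le_div_iff₀ (by positivity) (by norm_num)]
    have := hLp 16
    norm_num at this
    linarith
  have hτ0 : 0 < (m : ℝ) ^ 5 := by positivity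
  have hτ : 2 * ((m ^ 4 : ℕ) : ℝ) ≤ (m : ℝ) ^ 5 := by
    rw [htm]
    calc 2 * (m : ℝ) ^ 4 ≤ m * m ^ 4 := by gcongr
      _ = _ := by ring
  have hτ2 : ((m ^ 4 : ℕ) : ℝ) ^ 2 * Real.sqrt (m ^ 4 : ℕ) ≤ ((m : ℝ) ^ 5) ^ 2 := by
    rw [htm, show (m : ℝ) ^ 4 = ((m : ℝ) ^ 2) ^ 2 by ring, Real.sqrt_sq (by positivity)]
    exact le_of_eq (by ring)
  have h1 := hν.measureReal_abs_signSum_gt_le hL1 hLn htL htn hθ hlam hsum hsum2 k hτ0 hτ hτ2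
  have hη : 0 < deviation n := by rw [hdev]; positivity
  have hm1' : |meanSign n (lam k)| ≤ 1 := abs_meanSign_le (hlam k) (by linarith)
  have h2 := hν.mul_measureReal_signSum_gt_le (lam := lam) (k := k) ht2 htn hm1' hη
  have := hν.isProbabilityMeasure
  have h3 : ν.real {u | deviation n * (((m ^ 4 : ℕ) : ℝ) * ((m ^ 4 : ℕ) - 1) / 2) <
      |signSum lam k (m ^ 4) u -
        ((m ^ 4 : ℕ) : ℝ) * ((m ^ 4 : ℕ) - 1) / 2 * meanSign n (lam k)|} ≤
      6 * n ^ 2 * tailBound n L + 2 * Real.exp (6 - L) := by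
    refine (measureReal_mono ?_).trans h1
    intro u hu
    change _ < |(_ : ℝ)| at hu ⊢
    refine lt_of_le_of_lt ?_ hu
    rw [hdev]
    exact signError_le hL hn hsn htm hm1 hm2
  have h4 := h2.trans (mul_le_mul_of_nonneg_left h3 zero_le_two)
  have hB : 0 ≤ 6 * (n : ℝ) ^ 2 * tailBound n L + 2 * Real.exp (6 - L) := by
    have := tailBound_nonneg n L
    positivity
  rw [← hsn]
  rw [hdev, div_mul_eq_mul_div, div_le_iff₀ (by positivity)] at h4
  rw [hdev]
  -- Dividing by the deviation costs a factor `2 L √n / 10^6`; the constant is thrown away.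
  have h5 : 0 ≤ L * L ^ 50 * (6 * (n : ℝ) ^ 2 * tailBound n L + 2 * Real.exp (6 - L)) := by
    positivity
  linarith

lemma IsHaarFrameLaw.measureReal_exists_deviation_lt_le {ν : Measure (Fin n → Euc n)}
    (hν : IsHaarFrameLaw ν) {lam : Fin n → ℝ} (hL : 2 ≤ spectralCutoff n)
    (hlam : ∀ m, |lam m| ≤ spectralCutoff n) (hsum : ∑ m, lam m = 0)
    (hsum2 : ∑ m, lam m ^ 2 = n) :
    ν.real {u | ∃ k, 2 * deviation n * (n * (n - 1) / 2) <
      |signSum lam k n u - n * (n - 1) / 2 * meanSign n (lam k)|} ≤ deviationProb n := by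
  have := hν.isProbabilityMeasure
  have h : {u : Fin n → Euc n | ∃ k, 2 * deviation n * (n * (n - 1) / 2) <
      |signSum lam k n u - n * (n - 1) / 2 * meanSign n (lam k)|} =
      ⋃ k, {u | 2 * deviation n * (n * (n - 1) / 2) <
        |signSum lam k n u - n * (n - 1) / 2 * meanSign n (lam k)|} := by
    ext u
    rw [Set.mem_iUnion]
    rfl
  rw [h, deviationProb]
  refine (measureReal_iUnion_fintype_le _).trans ?_
  refine (Finset.sum_le_sum fun k _ =>
    hν.measureReal_deviation_lt_le hL hlam hsum hsum2 k).trans ?_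
  simp

lemma exp_neg_le_factorial_div (p : ℕ) {x : ℝ} (hx : 0 < x) :
    Real.exp (-x) ≤ p.factorial / x ^ p := by
  have h := Real.pow_div_factorial_le_exp x hx.le p
  have hf : (0 : ℝ) < p.factorial := by exact_mod_cast p.factorial_pos
  rw [Real.exp_neg, inv_le_comm₀ (Real.exp_pos _) (by positivity), inv_div]
  exact h

lemma summable_deviationProb : Summable deviationProb := by
  -- The polynomial prefactor is of order at most `n^5`, and `exp (-n^(1/100))` is at most a
  -- constant over `n^p`; `p = 7` leaves the summable `n^(-2)`.
  obtain ⟨p, hp⟩ : ∃ p : ℕ, p = 7 := ⟨_, rfl⟩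
  set K : ℝ := (12 * tailConst + 2 * Real.exp 6) * (100 * p).factorial with hK
  have htc := tailConst_pos
  have hK0 : 0 ≤ K := by positivity
  refine Summable.of_nonneg_of_le (f := fun n : ℕ => K * (1 / (n : ℝ) ^ 2)) (fun n => ?_)
    (fun n => ?_) ((Real.summable_one_div_nat_pow.2 one_lt_two).mul_left K)
  · have := tailBound_nonneg n (spectralCutoff n)
    have := spectralCutoff_nonneg n
    unfold deviationProb
    positivity
  · rcases Nat.eq_zero_or_pos n with rfl | hn
    · simp [deviationProb]
    have hn1 : (1 : ℝ) ≤ n := by exact_mod_cast hn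
    have hL0 : 0 < spectralCutoff n := by unfold spectralCutoff; positivity
    have hLn : spectralCutoff n * Real.sqrt n ≤ n := by
      have h1 : 1 ≤ spectralCutoff n := Real.one_le_rpow hn1 (by norm_num)
      rw [← spectralCutoff_pow_fifty, ← pow_succ']
      exact (pow_le_pow_right₀ h1 (by norm_num : 51 ≤ 100)).trans (spectralCutoff_pow n).le
    have he : Real.exp (-spectralCutoff n) ≤ (100 * p).factorial / (n : ℝ) ^ p := by
      refine (exp_neg_le_factorial_div (100 * p) hL0).trans (le_of_eq ?_)
      rw [pow_mul, spectralCutoff_pow]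
    have h6 : Real.exp (6 - spectralCutoff n) = Real.exp 6 * Real.exp (-spectralCutoff n) := by
      rw [← Real.exp_add, sub_eq_add_neg]
    have hn3 : (1 : ℝ) ≤ n ^ 3 := one_le_pow₀ hn1
    rw [deviationProb, tailBound, h6]
    set e := Real.exp (-spectralCutoff n) with hedef
    have he0 : 0 < e := Real.exp_pos _
    calc (n : ℝ) * (spectralCutoff n * Real.sqrt n * (6 * n ^ 2 * (tailConst * (n + 1) * e) +
          2 * (Real.exp 6 * e)))
        ≤ n * (n * (6 * n ^ 2 * (tailConst * (n + n) * e) + 2 * (Real.exp 6 * (n ^ 3 * e)))) := by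
          gcongr
          exact le_mul_of_one_le_left he0.le hn3
      _ = (12 * tailConst + 2 * Real.exp 6) * n ^ 5 * e := by ring
      _ ≤ (12 * tailConst + 2 * Real.exp 6) * n ^ 5 * ((100 * p).factorial / (n : ℝ) ^ p) := by
          gcongr
      _ = K * (n ^ 5 / (n : ℝ) ^ p) := by rw [hK]; ring
      _ = _ := by
          congr 1
          rw [hp]
          field_simp

end NodalCount
end

/-! ### Independence of eigenvalues and frame, and Borel-Cantelli. -/

noncomputable section

namespace NodalCount

lemma ae_eventually_notMem_of_le {Ω : Type*} [MeasurableSpace Ω] {P : Measure Ω}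
    {s : ℕ → Set Ω} {b : ℕ → ℝ} (hb : Summable b)
    (hs : ∀ᶠ n in atTop, P (s n) ≤ ENNReal.ofReal (b n)) :
    ∀ᵐ ω ∂P, ∀ᶠ n in atTop, ω ∉ s n := by
  obtain ⟨N, hN⟩ := eventually_atTop.1 hs
  have h1 : ∑' n, P (s (n + N)) ≠ ∞ := by
    have hb' : Summable fun n => b (n + N) := (summable_nat_add_iff N).2 hb
    refine ne_top_of_le_ne_top hb'.tsum_ofReal_ne_top ?_
    exact ENNReal.tsum_le_tsum fun n => hN _ (Nat.le_add_left N n)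
  filter_upwards [ae_eventually_notMem h1] with ω hω
  obtain ⟨M, hM⟩ := eventually_atTop.1 hω
  filter_upwards [eventually_ge_atTop (M + N)] with n hn
  have := hM (n - N) (by omega)
  rwa [Nat.sub_add_cancel (by omega)] at this

section Independence

variable {Ω : Type*} [MeasurableSpace Ω] {P : Measure Ω} [IsProbabilityMeasure P] {n : ℕ}
  {Λ : Ω → Fin n → ℝ} {Φ : Ω → Matrix.orthogonalGroup (Fin n) ℝ}

/-- Independence makes the joint law a product, so by Fubini a bound uniform over deterministic
eigenvalues passes to random ones. -/
lemma IsOrthogonalEnsemble.measure_prod_mem_le (h : IsOrthogonalEnsemble P Λ Φ)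
    {B : Set ((Fin n → ℝ) × Matrix.orthogonalGroup (Fin n) ℝ)} (hB : MeasurableSet B) {b : ℝ≥0∞}
    (hb : ∀ l, (P.map Φ) {Q | (l, Q) ∈ B} ≤ b) : P {ω | (Λ ω, Φ ω) ∈ B} ≤ b := by
  have hΛ := h.measurable_eigenvalues
  have hΦ := h.measurable_frame
  have : IsProbabilityMeasure (P.map Λ) := Measure.isProbabilityMeasure_map hΛ.aemeasurable
  have : IsProbabilityMeasure (P.map Φ) := Measure.isProbabilityMeasure_map hΦ.aemeasurable
  have h1 := (indepFun_iff_map_prod_eq_prod_map_map hΛ.aemeasurable hΦ.aemeasurable).1 h.indep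
  have h2 : P {ω | (Λ ω, Φ ω) ∈ B} = ((P.map Λ).prod (P.map Φ)) B := by
    rw [← h1, Measure.map_apply (hΛ.prodMk hΦ) hB]
    rfl
  rw [h2, Measure.prod_apply hB]
  calc ∫⁻ l, (P.map Φ) (Prod.mk l ⁻¹' B) ∂(P.map Λ) ≤ ∫⁻ _l, b ∂(P.map Λ) :=
        lintegral_mono fun l => hb l
    _ = b := by simp

lemma IsOrthogonalEnsemble.isHaarFrameLaw (h : IsOrthogonalEnsemble P Λ Φ) :
    IsHaarFrameLaw ((P.map Φ).map fun R : Matrix.orthogonalGroup (Fin n) ℝ =>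
      rows (R : Matrix (Fin n) (Fin n) ℝ)) := by
  have : IsProbabilityMeasure (P.map Φ) :=
    Measure.isProbabilityMeasure_map h.measurable_frame.aemeasurable
  have := h.haar
  exact isHaarFrameLaw_map_rows _ fun Q => map_mul_left_eq_self _ Q

lemma measurable_signSum_prod (k : Fin n) :
    Measurable fun p : (Fin n → ℝ) × (Fin n → Euc n) => signSum p.1 k n p.2 := by
  unfold signSum pairSign entry
  simp_rw [inner_eq_sum, diagMul_apply]
  refine Finset.measurable_sum _ fun j _ => Finset.measurable_sum _ fun i _ =>
    measurable_sgn.comp (((Finset.measurable_sum _ fun m _ => ?_).mul ?_).mul ?_) <;> fun_prop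

/-- The eigenvalues are centred, normalized and bounded by the cutoff. -/
structure IsBalanced (lam : Fin n → ℝ) : Prop where
  abs_le : ∀ m, |lam m| ≤ spectralCutoff n
  sum_eq : ∑ m, lam m = 0
  sum_sq_eq : ∑ m, lam m ^ 2 = n

lemma measurableSet_isBalanced : MeasurableSet {lam : Fin n → ℝ | IsBalanced lam} := by
  have h : {lam : Fin n → ℝ | IsBalanced lam} =
      (⋂ m, {lam : Fin n → ℝ | |lam m| ≤ spectralCutoff n}) ∩
        ({lam : Fin n → ℝ | ∑ m, lam m = 0} ∩ {lam : Fin n → ℝ | ∑ m, lam m ^ 2 = n}) := by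
    ext lam
    rw [Set.mem_inter_iff, Set.mem_iInter]
    exact ⟨fun h => ⟨h.1, h.2, h.3⟩, fun h => ⟨h.1, h.2.1, h.2.2⟩⟩
  rw [h]
  refine MeasurableSet.inter (MeasurableSet.iInter fun m => ?_) (MeasurableSet.inter ?_ ?_)
  · exact measurableSet_le (measurable_pi_apply m).abs measurable_const
  · exact measurableSet_eq_fun (by fun_prop) measurable_const
  · exact measurableSet_eq_fun (by fun_prop) measurable_const

lemma IsOrthogonalEnsemble.measure_deviation_lt_le (h : IsOrthogonalEnsemble P Λ Φ)
    (hL : 2 ≤ spectralCutoff n) :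
    P {ω | IsBalanced (Λ ω) ∧ ∃ k, 2 * deviation n * (n * (n - 1) / 2) <
      |signSum (Λ ω) k n (rows (Φ ω : Matrix (Fin n) (Fin n) ℝ)) -
        n * (n - 1) / 2 * meanSign n (Λ ω k)|} ≤ ENNReal.ofReal (deviationProb n) := by
  set S : Set ((Fin n → ℝ) × (Fin n → Euc n)) := {p | IsBalanced p.1 ∧ ∃ k,
    2 * deviation n * (n * (n - 1) / 2) <
      |signSum p.1 k n p.2 - n * (n - 1) / 2 * meanSign n (p.1 k)|} with hS
  have hSm : MeasurableSet S := by
    have e : S = (Prod.fst ⁻¹' {lam : Fin n → ℝ | IsBalanced lam}) ∩ ⋃ k,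
        {p : (Fin n → ℝ) × (Fin n → Euc n) | 2 * deviation n * (n * (n - 1) / 2) <
          |signSum p.1 k n p.2 - n * (n - 1) / 2 * meanSign n (p.1 k)|} := by
      ext p
      rw [Set.mem_inter_iff, Set.mem_iUnion]
      rfl
    rw [e]
    refine (measurable_fst measurableSet_isBalanced).inter (MeasurableSet.iUnion fun k => ?_)
    refine measurableSet_lt measurable_const (((measurable_signSum_prod k).sub ?_).abs)
    unfold meanSign
    fun_prop
  have hg : Measurable fun p : (Fin n → ℝ) × Matrix.orthogonalGroup (Fin n) ℝ =>
      (p.1, rows (p.2 : Matrix (Fin n) (Fin n) ℝ)) :=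
    measurable_fst.prodMk (measurable_rows.comp measurable_snd)
  refine h.measure_prod_mem_le (hg hSm) fun l => ?_
  have hν := h.isHaarFrameLaw
  set ν := (P.map Φ).map fun R : Matrix.orthogonalGroup (Fin n) ℝ =>
      rows (R : Matrix (Fin n) (Fin n) ℝ) with hνdef
  have := hν.isProbabilityMeasure
  have hslice : MeasurableSet {u : Fin n → Euc n | (l, u) ∈ S} := measurable_prodMk_left hSm
  have h1 : (P.map Φ) {Q | (l, Q) ∈ (fun p : (Fin n → ℝ) × Matrix.orthogonalGroup (Fin n) ℝ =>
      (p.1, rows (p.2 : Matrix (Fin n) (Fin n) ℝ))) ⁻¹' S} = ν {u | (l, u) ∈ S} := by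
    rw [hνdef, Measure.map_apply measurable_rows hslice]
    rfl
  rw [h1]
  by_cases hl : IsBalanced l
  · rw [← ofReal_measureReal]
    refine ENNReal.ofReal_le_ofReal (le_trans (measureReal_mono ?_)
      (hν.measureReal_exists_deviation_lt_le hL hl.abs_le hl.sum_eq hl.sum_sq_eq))
    exact fun u hu => And.right hu
  · have : {u : Fin n → Euc n | (l, u) ∈ S} = ∅ :=
      Set.eq_empty_iff_forall_notMem.2 fun u hu => hl (And.left hu)
    rw [this]
    simp

end Independence

section Asymptotics

variable {Ω : Type*} [MeasurableSpace Ω] {P : Measure Ω} [IsProbabilityMeasure P]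

lemma IsTildeO.eventually_abs_le {f : ℕ → ℝ} {α β : ℝ} (hf : IsTildeO f α) (hαβ : α < β) :
    ∀ᶠ n : ℕ in atTop, |f n| ≤ (n : ℝ) ^ β := by
  obtain ⟨N, C₁, C₂, -, hC₁, -, h⟩ := hf
  have h1 := (isLittleO_log_rpow_rpow_atTop C₂ (sub_pos.2 hαβ)).comp_tendsto
    tendsto_natCast_atTop_atTop
  filter_upwards [h1.def (c := 1 / C₁) (by positivity), eventually_gt_atTop N,
    eventually_ge_atTop 1] with n hn1 hn2 hn3
  have hn0 : (1 : ℝ) ≤ n := by exact_mod_cast hn3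
  have hn0' : (0 : ℝ) < n := by linarith
  simp only [Function.comp_apply] at hn1
  rw [Real.norm_of_nonneg (Real.rpow_nonneg (Real.log_nonneg hn0) _),
    Real.norm_of_nonneg (by positivity)] at hn1
  refine (h n hn2).le.trans ?_
  calc C₁ * (n : ℝ) ^ α * Real.log n ^ C₂
      ≤ C₁ * (n : ℝ) ^ α * (1 / C₁ * (n : ℝ) ^ (β - α)) := by gcongr
    _ = (n : ℝ) ^ α * (n : ℝ) ^ (β - α) := by field_simp
    _ = (n : ℝ) ^ β := by rw [← Real.rpow_add hn0']; congr 1; ring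

lemma measurable_avg {n : ℕ} : Measurable fun x : Fin n → ℝ => avg x := by
  unfold avg; fun_prop

lemma measurable_std {n : ℕ} : Measurable fun x : Fin n → ℝ => std x := by
  have := measurable_avg (n := n)
  unfold std
  fun_prop

/-- Logarithms are absorbed by small powers: the failure probability is eventually at most
`n^(-5/4)`, which is summable, and `r n` is at most `n^(1/100)`. -/
lemma SpectralGrowthBound.ae_eventually_le {Λ : (n : ℕ) → Ω → Fin n → ℝ}
    (h : SpectralGrowthBound P Λ) (hΛ : ∀ n, Measurable (Λ n)) :
    ∀ᵐ ω ∂P, ∀ᶠ n in atTop,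
      ‖(fun i : Fin n => (Λ n ω i - avg (Λ n ω)) / std (Λ n ω))‖ ≤ spectralCutoff n := by
  obtain ⟨r, δ, hr, hδ, hb⟩ := h
  set G : (n : ℕ) → Set Ω := fun n =>
    {ω | ‖(fun i : Fin n => (Λ n ω i - avg (Λ n ω)) / std (Λ n ω))‖ ≤ r n} with hG
  have hGm : ∀ n, MeasurableSet (G n) := fun n => by
    have h1 := (measurable_avg (n := n)).comp (hΛ n)
    have h2 := (measurable_std (n := n)).comp (hΛ n)
    refine measurableSet_le (Measurable.norm (measurable_pi_lambda _ fun i => ?_)) measurable_const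
    exact (((measurable_pi_apply i).comp (hΛ n)).sub h1).div h2
  have hsum : Summable fun n : ℕ => (n : ℝ) ^ (-5 / 4 : ℝ) :=
    Real.summable_nat_rpow.2 (by norm_num)
  have hP : ∀ᶠ n in atTop, P (G n)ᶜ ≤ ENNReal.ofReal ((n : ℝ) ^ (-5 / 4 : ℝ)) := by
    filter_upwards [hδ.eventually_abs_le (β := -5 / 4) (by norm_num)] with n hn
    rw [← ofReal_measureReal, probReal_compl_eq_one_sub (hGm n)]
    refine ENNReal.ofReal_le_ofReal ?_
    have h1 : 1 - δ n ≤ P.real (G n) := hb n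
    have h2 := le_abs_self (δ n)
    linarith
  filter_upwards [ae_eventually_notMem_of_le hsum hP] with ω hω
  filter_upwards [hω, hr.eventually_abs_le (β := 1 / 100) (by norm_num)] with n hn1 hn2
  have h1 : ω ∈ G n := not_not.1 hn1
  exact (show _ ≤ r n from h1).trans ((le_abs_self _).trans hn2)

lemma isBalanced_of_avg_eq_zero {n : ℕ} (hn : 0 < n) {x : Fin n → ℝ} (h0 : avg x = 0)
    (h1 : std x = 1) (hx : ‖(fun i : Fin n => (x i - avg x) / std x)‖ ≤ spectralCutoff n) :
    IsBalanced x := by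
  have hn' : (n : ℝ) ≠ 0 := by exact_mod_cast hn.ne'
  refine ⟨fun m => ?_, ?_, ?_⟩
  · have := (norm_le_pi_norm (fun i : Fin n => (x i - avg x) / std x) m).trans hx
    simpa [h0, h1] using this
  · rw [avg, div_eq_zero_iff] at h0
    exact h0.resolve_right hn'
  · rw [std, Real.sqrt_eq_one, h0, div_eq_one_iff_eq hn'] at h1
    simpa using h1

/-- Almost surely, all average pair signs are eventually close to their means. -/
lemma ae_eventually_signSum_le {Λ : (n : ℕ) → Ω → Fin n → ℝ}
    {Φ : (n : ℕ) → Ω → Matrix.orthogonalGroup (Fin n) ℝ}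
    (hA : ∀ n, IsOrthogonalEnsemble P (Λ n) (Φ n)) (hgrowth : SpectralGrowthBound P Λ)
    (hnorm : ∀ n, 2 ≤ n → ∀ᵐ ω ∂P, avg (Λ n ω) = 0 ∧ std (Λ n ω) = 1) :
    ∀ᵐ ω ∂P, ∀ᶠ n in atTop, ∀ k : Fin n,
      |signSum (Λ n ω) k n (rows (Φ n ω : Matrix (Fin n) (Fin n) ℝ)) -
        n * (n - 1) / 2 * meanSign n (Λ n ω k)| ≤ 2 * deviation n * (n * (n - 1) / 2) := by
  have h1 : ∀ᶠ n in atTop, P {ω | IsBalanced (Λ n ω) ∧ ∃ k, 2 * deviation n * (n * (n - 1) / 2) <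
      |signSum (Λ n ω) k n (rows (Φ n ω : Matrix (Fin n) (Fin n) ℝ)) -
        n * (n - 1) / 2 * meanSign n (Λ n ω k)|} ≤ ENNReal.ofReal (deviationProb n) := by
    filter_upwards [tendsto_spectralCutoff.eventually_ge_atTop 2] with n hn
    exact (hA n).measure_deviation_lt_le hn
  have h2 : ∀ᵐ ω ∂P, ∀ n, 2 ≤ n → avg (Λ n ω) = 0 ∧ std (Λ n ω) = 1 := by
    rw [ae_all_iff]
    intro n
    by_cases hn : 2 ≤ n
    · filter_upwards [hnorm n hn] with ω hω _ using hω
    · exact Eventually.of_forall fun ω h => absurd h hn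
  filter_upwards [ae_eventually_notMem_of_le summable_deviationProb h1, h2,
    hgrowth.ae_eventually_le fun n => (hA n).measurable_eigenvalues] with ω hω1 hω2 hω3
  filter_upwards [hω1, hω3, eventually_ge_atTop 2] with n hn1 hn2 hn3 k
  by_contra hcon
  obtain ⟨e0, e1⟩ := hω2 n hn3
  exact hn1 ⟨isBalanced_of_avg_eq_zero (by omega) e0 e1 hn2, k, not_le.1 hcon⟩

end Asymptotics

end NodalCount
end

/-! ### Deterministic reduction of nodal counts to sign sums, and empirical measures. -/

noncomputable section

namespace NodalCount

section Deterministic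

variable {n : ℕ} {lam : Fin n → ℝ} {Φ : Matrix.orthogonalGroup (Fin n) ℝ}

lemma ensembleMatrix_apply (lam : Fin n → ℝ) (Φ : Matrix.orthogonalGroup (Fin n) ℝ) (i j : Fin n) :
    ensembleMatrix lam Φ i j = entry lam (rows (Φ : Matrix (Fin n) (Fin n) ℝ)) i j := by
  rw [ensembleMatrix, Matrix.mul_apply, entry, inner_eq_sum]
  refine Finset.sum_congr rfl fun m _ => ?_
  rw [Matrix.mul_diagonal, Matrix.transpose_apply, diagMul_apply]
  simp only [rows]
  ring

/-- For a simple eigenvalue, passing to the coordinates `Φᵀ v` leaves an eigenvector of a diagonal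
matrix, supported on the single index `k`. For a repeated eigenvalue the column is prescribed. -/
lemma IsEigenvectorSystem.exists_eq_smul {v : Fin n → Fin n → ℝ}
    (h : IsEigenvectorSystem lam Φ v) (k : Fin n) :
    ∃ c : ℝ, c ≠ 0 ∧ v k = c • fun i => (Φ : Matrix (Fin n) (Fin n) ℝ) i k := by
  obtain ⟨h0, heig, hrep⟩ := h k
  by_cases hk : ∃ l, l ≠ k ∧ lam l = lam k
  · exact ⟨1, one_ne_zero, by rw [one_smul, hrep hk]⟩
  · push Not at hk
    set M : Matrix (Fin n) (Fin n) ℝ := (Φ : Matrix (Fin n) (Fin n) ℝ) with hM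
    have hMM : M.transpose * M = 1 := (Matrix.mem_orthogonalGroup_iff' _ _).1 Φ.2
    have hMM' : M * M.transpose = 1 := (Matrix.mem_orthogonalGroup_iff _ _).1 Φ.2
    set w := M.transpose.mulVec (v k) with hw
    have hv : v k = M.mulVec w := by rw [hw, Matrix.mulVec_mulVec, hMM', Matrix.one_mulVec]
    have h1 : (Matrix.diagonal lam).mulVec w = lam k • w := by
      have h2 := congrArg M.transpose.mulVec heig
      rw [ensembleMatrix, Matrix.mulVec_smul, ← hw, Matrix.mulVec_mulVec, ← Matrix.mul_assoc,
        ← Matrix.mul_assoc, ← hM, hMM, Matrix.one_mul, ← Matrix.mulVec_mulVec, ← hw] at h2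
      exact h2
    have h2 : ∀ m, m ≠ k → w m = 0 := by
      intro m hm
      have h3 := congrFun h1 m
      rw [Matrix.mulVec_diagonal, Pi.smul_apply, smul_eq_mul, ← sub_eq_zero, ← sub_mul] at h3
      exact (mul_eq_zero.1 h3).resolve_left (sub_ne_zero.2 (hk m hm))
    have h3 : v k = w k • fun i => M i k := by
      ext i
      rw [hv, Matrix.mulVec, dotProduct, Finset.sum_eq_single k]
      · rw [Pi.smul_apply, smul_eq_mul, mul_comm]
      · intro m _ hm
        rw [h2 m hm, mul_zero]
      · simp
    refine ⟨w k, fun hz => h0 ?_, h3⟩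
    rw [h3, hz, zero_smul]

lemma nodalCount_smul (A : Matrix (Fin n) (Fin n) ℝ) (x : Fin n → ℝ) {c : ℝ} (hc : c ≠ 0) :
    nodalCount A (c • x) = nodalCount A x := by
  have h : ∀ i j, 0 < A i j * (c • x) i * (c • x) j ↔ 0 < A i j * x i * x j := fun i j => by
    have e : A i j * (c • x) i * (c • x) j = c ^ 2 * (A i j * x i * x j) := by
      simp only [Pi.smul_apply, smul_eq_mul]
      ring
    rw [e, mul_pos_iff_of_pos_left (by positivity)]
  unfold nodalCount
  simp_rw [h]

/-- The convention `sgn 0 = -1` matches the strict inequality in the nodal count, so the identity is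
exact even for vanishing products. -/
lemma nodalCount_eq (A : Matrix (Fin n) (Fin n) ℝ) (x : Fin n → ℝ) :
    (nodalCount A x : ℝ) =
      (n * (n - 1) / 2 + ∑ j, ∑ i ∈ Finset.Iio j, sgn (A i j * x i * x j)) / 2 := by
  classical
  have h1 : nodalCount A x = ∑ j, ∑ i ∈ Finset.Iio j, if 0 < A i j * x i * x j then 1 else 0 := by
    rw [nodalCount, Nat.card_eq_fintype_card, Fintype.card_subtype, Finset.card_filter,
      Fintype.sum_prod_type, Finset.sum_comm]
    refine Finset.sum_congr rfl fun j _ => ?_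
    rw [← Finset.filter_gt_eq_Iio, Finset.sum_filter]
    refine Finset.sum_congr rfl fun i _ => ?_
    simp only [ite_and]
  have h2 : ∀ y : ℝ, (((if 0 < y then 1 else 0 : ℕ)) : ℝ) = (1 + sgn y) / 2 := fun y => by
    unfold sgn
    split_ifs <;> norm_num
  have h3 : ∑ j : Fin n, (j : ℝ) = n * (n - 1) / 2 := by
    rw [Fin.sum_univ_eq_sum_range (fun j => (j : ℝ)) n, sum_range_cast]
  rw [h1]
  push_cast [h2]
  simp_rw [← Finset.sum_div, Finset.sum_add_distrib, Finset.sum_const, Fin.card_Iio, nsmul_eq_mul,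
    mul_one]
  rw [h3]

lemma IsEigenvectorSystem.nodalCount_eq {v : Fin n → Fin n → ℝ}
    (h : IsEigenvectorSystem lam Φ v) (k : Fin n) :
    (nodalCount (ensembleMatrix lam Φ) (v k) : ℝ) = (n * (n - 1) / 2 +
      signSum lam k n (rows (Φ : Matrix (Fin n) (Fin n) ℝ))) / 2 := by
  obtain ⟨c, hc, hv⟩ := h.exists_eq_smul k
  rw [hv, nodalCount_smul _ _ hc, NodalCount.nodalCount_eq, signSum,
    Finset.filter_true_of_mem fun j _ => j.2]
  simp_rw [ensembleMatrix_apply]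
  rfl

/-- The constant in the normalization of the nodal count. -/
def normalizingConst : ℝ := Real.pi ^ (3 / 2 : ℝ) / Real.sqrt 2

lemma normalizingConst_pos : 0 < normalizingConst := by
  unfold normalizingConst; have := Real.pi_pos; positivity

/-- The constant `π^(3/2)/√2` is the reciprocal of `(1/π) √(2/π)`, half the mean-sign coefficient.
-/
lemma normalizingConst_mul_meanSign (hn : 0 < n) (l : ℝ) :
    normalizingConst * (meanSign n l / 2) * Real.sqrt n = l := by
  have hpi := Real.pi_pos
  have hn' : (0 : ℝ) < n := by exact_mod_cast hn
  have h1 : Real.pi ^ (3 / 2 : ℝ) = Real.pi * Real.sqrt Real.pi := by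
    rw [show (3 / 2 : ℝ) = 1 + 1 / 2 by norm_num, Real.rpow_add hpi, Real.rpow_one,
      Real.sqrt_eq_rpow]
  have h2 : Real.sqrt Real.pi ≠ 0 := (Real.sqrt_pos.2 hpi).ne'
  have h3 : Real.sqrt n ≠ 0 := (Real.sqrt_pos.2 hn').ne'
  rw [normalizingConst, meanSign, h1, Real.sqrt_div zero_le_two]
  field_simp

lemma abs_normalize_nodalCount_sub_le (hn : 2 ≤ n) {v : Fin n → Fin n → ℝ}
    (h : IsEigenvectorSystem lam Φ v) (k : Fin n) {η : ℝ}
    (hη : |signSum lam k n (rows (Φ : Matrix (Fin n) (Fin n) ℝ)) -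
      n * (n - 1) / 2 * meanSign n (lam k)| ≤ 2 * η * (n * (n - 1) / 2)) :
    |normalize n (nodalCount (ensembleMatrix lam Φ) (v k)) - lam k| ≤
      normalizingConst * η * Real.sqrt n := by
  have hn2 : (2 : ℝ) ≤ n := by exact_mod_cast hn
  have hN0 : 0 < (n : ℝ) * (n - 1) / 2 := by nlinarith
  have hc := normalizingConst_pos
  have e : normalize n (nodalCount (ensembleMatrix lam Φ) (v k)) - lam k =
      normalizingConst * ((signSum lam k n (rows (Φ : Matrix (Fin n) (Fin n) ℝ)) -
        n * (n - 1) / 2 * meanSign n (lam k)) / (2 * (n * (n - 1) / 2))) * Real.sqrt n := by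
    have hl := normalizingConst_mul_meanSign (by omega : 0 < n) (lam k)
    rw [normalize, h.nodalCount_eq,
      Nat.cast_choose_two, ← normalizingConst]
    set N : ℝ := n * (n - 1) / 2
    field_simp
    linear_combination 2 * N * hl
  rw [e, abs_mul, abs_mul, abs_of_pos hc, abs_of_nonneg (Real.sqrt_nonneg _), abs_div,
    abs_of_pos (by positivity : 0 < 2 * ((n : ℝ) * (n - 1) / 2))]
  gcongr
  rw [div_le_iff₀ (by positivity)]
  linarith

/-- The shift is less than `n` out of about `n^2/2` pairs, so after scaling by `√n` it is still of
order `n^(-1/2)`. -/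
lemma abs_normalize_nodalSurplus_sub_le (hn : 2 ≤ n) (A : Matrix (Fin n) (Fin n) ℝ)
    (x : Fin n → ℝ) (k : Fin n) :
    |normalize n (nodalSurplus A x k) - normalize n (nodalCount A x)| ≤
      normalizingConst * (4 / Real.sqrt n) := by
  have hn2 : (2 : ℝ) ≤ n := by exact_mod_cast hn
  have hs : 0 < Real.sqrt n := Real.sqrt_pos.2 (by linarith)
  have hsq : Real.sqrt n * Real.sqrt n = n := Real.mul_self_sqrt (by linarith)
  have hN0 : 0 < (n : ℝ) * (n - 1) / 2 := by nlinarith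
  have hc := normalizingConst_pos
  have hk : (k : ℝ) ≤ n := by exact_mod_cast k.2.le
  have e : normalize n (nodalSurplus A x k) - normalize n (nodalCount A x) =
      -(normalizingConst * (k / (n * (n - 1) / 2) * Real.sqrt n)) := by
    rw [normalize, normalize, nodalSurplus, Nat.cast_choose_two, ← normalizingConst]
    push_cast
    ring
  rw [e, abs_neg, abs_of_nonneg (by positivity)]
  gcongr
  rw [div_mul_eq_mul_div, div_le_div_iff₀ hN0 hs, mul_assoc, hsq]
  nlinarith

end Deterministic

section Empirical

lemma integral_emp {n : ℕ} (x : Fin n → ℝ) (f : ℝ → ℝ) :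
    ∫ y, f y ∂(emp x) = (n : ℝ)⁻¹ * ∑ k, f (x k) := by
  rw [emp, integral_smul_measure, integral_finsetSum_measure]
  · simp [integral_dirac]
  · intro k _
    exact integrable_dirac (by simp)

/-- A compactly supported continuous test function is uniformly continuous, so uniformly close
points give averages with vanishing difference. -/
lemma tendsto_integral_emp_of_close {f : ℝ → ℝ} (hf : Continuous f) (hfc : HasCompactSupport f)
    {x y : (n : ℕ) → Fin n → ℝ} {ε : ℕ → ℝ} (hε : Tendsto ε atTop (𝓝 0))
    (hxy : ∀ᶠ n in atTop, ∀ k, |y n k - x n k| ≤ ε n) {l : ℝ}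
    (hx : Tendsto (fun n => ∫ s, f s ∂(emp (x n))) atTop (𝓝 l)) :
    Tendsto (fun n => ∫ s, f s ∂(emp (y n))) atTop (𝓝 l) := by
  have huc : UniformContinuous f := hfc.uniformContinuous_of_continuous hf
  have h : Tendsto (fun n => ∫ s, f s ∂(emp (y n)) - ∫ s, f s ∂(emp (x n))) atTop (𝓝 0) := by
    -- This form supplies `n > N`, hence `n ≥ 1`, which is needed to cancel the factor `1/n`.
    rw [Metric.tendsto_atTop']
    intro r hr
    obtain ⟨d, hd, hfd⟩ := Metric.uniformContinuous_iff.1 huc (r / 2) (half_pos hr)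
    obtain ⟨N, hN⟩ := eventually_atTop.1 (hxy.and (hε.eventually_lt_const hd))
    refine ⟨N, fun n hn => ?_⟩
    obtain ⟨h1, h2⟩ := hN n hn.le
    have hn0 : (0 : ℝ) < n := by exact_mod_cast (by omega : 0 < n)
    rw [dist_zero_right, integral_emp, integral_emp, ← mul_sub, ← Finset.sum_sub_distrib,
      norm_mul, norm_inv, Real.norm_natCast]
    have h3 : ‖∑ k, (f (y n k) - f (x n k))‖ ≤ n * (r / 2) := by
      refine (norm_sum_le _ _).trans ?_
      calc ∑ k, ‖f (y n k) - f (x n k)‖ ≤ ∑ _k : Fin n, r / 2 := Finset.sum_le_sum fun k _ => by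
            rw [← dist_eq_norm]
            exact (hfd (by rw [Real.dist_eq]; exact (h1 k).trans_lt h2)).le
        _ = n * (r / 2) := by simp
    calc (n : ℝ)⁻¹ * ‖∑ k, (f (y n k) - f (x n k))‖ ≤ (n : ℝ)⁻¹ * (n * (r / 2)) := by gcongr
      _ = r / 2 := by field_simp
      _ < r := half_lt_self hr
  simpa using h.add hx

lemma tendsto_normalizingConst_mul_deviation :
    Tendsto (fun n => normalizingConst * deviation n * Real.sqrt n) atTop (𝓝 0) := by
  have h : Tendsto (fun n => normalizingConst * 10 ^ 6 / spectralCutoff n) atTop (𝓝 0) :=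
    tendsto_spectralCutoff.const_div_atTop _
  refine h.congr' ?_
  filter_upwards [eventually_ge_atTop 1] with n hn
  have hn0 : (0 : ℝ) < n := by exact_mod_cast hn
  have hL : spectralCutoff n ≠ 0 := by unfold spectralCutoff; positivity
  rw [deviation]
  field_simp

lemma tendsto_normalizingConst_mul_div_sqrt :
    Tendsto (fun n : ℕ => normalizingConst * (4 / Real.sqrt n)) atTop (𝓝 0) := by
  have h : Tendsto (fun n : ℕ => Real.sqrt n) atTop atTop :=
    Real.tendsto_sqrt_atTop.comp tendsto_natCast_atTop_atTop
  simpa using (h.const_div_atTop 4).const_mul normalizingConst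

end Empirical

end NodalCount
end

theorem corollary1p2 {Ω : Type*} [MeasurableSpace Ω] (P : Measure Ω) [IsProbabilityMeasure P]
    (Λ : (n : ℕ) → Ω → Fin n → ℝ)
    (Φ : (n : ℕ) → Ω → Matrix.orthogonalGroup (Fin n) ℝ)
    (hA : ∀ n, NodalCount.IsOrthogonalEnsemble P (Λ n) (Φ n))
    (hgrowth : NodalCount.SpectralGrowthBound P Λ)
    (hnorm : ∀ n, 2 ≤ n →
      ∀ᵐ ω ∂P, NodalCount.avg (Λ n ω) = 0 ∧ NodalCount.std (Λ n ω) = 1)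
    (ρ : Measure ℝ) [IsProbabilityMeasure ρ]
    (hρ : NodalCount.ConvergesAS P (fun n ω => NodalCount.emp (Λ n ω)) ρ)
    (v : (n : ℕ) → Ω → Fin n → Fin n → ℝ)
    (hv : ∀ n, ∀ᵐ ω ∂P, NodalCount.IsEigenvectorSystem (Λ n ω) (Φ n ω) (v n ω)) :
    NodalCount.ConvergesAS P
      (fun n ω => NodalCount.emp fun k : Fin n => NodalCount.normalize n
        (NodalCount.nodalCount (NodalCount.ensembleMatrix (Λ n ω) (Φ n ω)) (v n ω k))) ρ ∧
    NodalCount.ConvergesAS P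
      (fun n ω => NodalCount.emp fun k : Fin n => NodalCount.normalize n
        (NodalCount.nodalSurplus (NodalCount.ensembleMatrix (Λ n ω) (Φ n ω)) (v n ω k) k)) ρ := by
  have hclose : ∀ᵐ ω ∂P, ∀ᶠ n in atTop, ∀ k : Fin n,
      |NodalCount.normalize n
        (NodalCount.nodalCount (NodalCount.ensembleMatrix (Λ n ω) (Φ n ω)) (v n ω k)) - Λ n ω k| ≤
      NodalCount.normalizingConst * NodalCount.deviation n * Real.sqrt n := by
    filter_upwards [NodalCount.ae_eventually_signSum_le hA hgrowth hnorm, ae_all_iff.2 hv]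
      with ω h1 h2
    filter_upwards [h1, eventually_ge_atTop 2] with n hn1 hn2 k
    exact NodalCount.abs_normalize_nodalCount_sub_le hn2 (h2 n) k (hn1 k)
  have hcount : NodalCount.ConvergesAS P
      (fun n ω => NodalCount.emp fun k : Fin n => NodalCount.normalize n
        (NodalCount.nodalCount (NodalCount.ensembleMatrix (Λ n ω) (Φ n ω)) (v n ω k))) ρ := by
    intro f hf hfc
    filter_upwards [hclose, hρ f hf hfc] with ω h1 h2
    exact NodalCount.tendsto_integral_emp_of_close hf hfc
      NodalCount.tendsto_normalizingConst_mul_deviation h1 h2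
  refine ⟨hcount, fun f hf hfc => ?_⟩
  -- The surplus is compared with the count rather than with the eigenvalues; that comparison is
  -- deterministic and adds no exceptional event.
  filter_upwards [hcount f hf hfc] with ω h1
  refine NodalCount.tendsto_integral_emp_of_close hf hfc
    NodalCount.tendsto_normalizingConst_mul_div_sqrt ?_ h1
  filter_upwards [eventually_ge_atTop 2] with n hn k
  exact NodalCount.abs_normalize_nodalSurplus_sub_le hn _ _ k
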